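/- All digraphs are finite and simple. For a digraph $G$ and a vertex $v$ let $R_G(v)$ be the set of vertices reachable from $v$ in $G$ (including $v$), and for a vertex weighting $\mathbf a:V(G)\to\mathbb R$ and $S\subseteq V(G)$ put $\mathbf a(S)=\sum_{v\in S}a_v$. A polyforest is a digraph whose underlying undirected graph is a forest. The feedback edge number $f$ of $G$ is the minimum number of edges whose deletion turns $G$ into a polyforest. Let $G$ be an acyclic digraph with weighting $\mathbf a$, $n=|V(G)|$, $m=|E(G)|$. Consider the following two algorithms. *Algorithm 1* (input: a polyforest $T$ without directed cycles and a weighting $\mathbf a$): find a topological order of $V(T)$; for all $v$ in reverse topological order set $r(v)\leftarrow a_v+\sum_{w:(v,w)\in E(T)}r(w)$; return $r$. *Algorithm 2* (input: $G$ and $\mathbf a$): compute a polyforest $T$ on $V(G)$ by removing $f$ edges from $G$; let $r^{(0)}$ be the output of Algorithm 1 on $(T,\mathbf a)$ and $G^{(0)}=T$; let $(s_1,t_1),\dots,(s_f,t_f)$ be the removed edges in any order. For $i=1,\dots,f$, working in $H=G^{(i-1)}$: - compute the set $R^\nabla$ of vertices that can reach $s_i$ and the set $R_\Delta=R_H(t_i)$;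 - compute the boundary set $B$ of all $b\in R^\nabla$ from which there is a path in $H$ to some vertex of $R_\Delta$ with no internal vertex in $R^\nabla$; - for every $b\in B$ compute $R_H(b)$ and the vertices that can reach $b$, and so for every $v\in R^\nabla$ the set $\mathrm{MARK}[v]=R_H(v)\cap B$; - for every $v\in R^\nabla$ whose set $K=\mathrm{MARK}[v]$ is not yet a key of a trie $\mathrm{GAIN}$ (empty at the start of the round), store $\mathrm{GAIN}[K]=\mathbf a\bigl(R_\Delta\setminus\bigcup_{b\in K}R_H(b)\bigr)$; - put $r^{(i)}(v)=r^{(i-1)}(v)+\mathrm{GAIN}[\mathrm{MARK}[v]]$ for $v\in R^\nabla$, $r^{(i)}(v)=r^{(i-1)}(v)$ for all other $v$, and $G^{(i)}=G^{(i-1)}+(s_i,t_i)$. Return $r^{(f)}$. **Theorem.** (1) For every acyclic digraph $G$ and every $\mathbf a:V(G)\to\mathbb R$, Algorithm 2 has a run, and every run, whatever polyforest $T$, topological order and order of the removed edges it chooses, returns the weighted reachability numbers: $r^{(f)}(v)=\mathbf a(R_G(v))$ for every $v\in V(G)$. (2) Algorithm 2, implemented on a unit-cost random access machine whose cells hold natural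 numbers or real weights (word operations: constants $0,1$, copying, adding one, comparing, indexing; weight operations: zero, copying, adding) and whose input is a repetition-free list of the edges of $G$ (in any order) on the vertex set $\{0,\dots,n-1\}$ together with the array $\mathbf a$, returns $\mathbf a(R_G(v))$ for every $v$, in time $\mathcal O(f^3n+f^2m+n+m+1)$ and, counted in memory cells accessed, in space $\mathcal O(fn+n+m+1)$, with absolute constants. In particular, for $f\ge 1$ it runs in time $\mathcal O(f^3n+f^2m)$ and space $\mathcal O(fn+m)$. -/

import Mathlib

namespace DescendantCounting

/-! ### Digraphs, reachability, feedback edge number -/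

section Graph

variable {V : Type*}

/-- No directed cycles (in particular no self-loops and no pairs of antiparallel edges). -/
def IsAcyclic (G : Digraph V) : Prop := ∀ v, ¬ Relation.TransGen G.Adj v v

/-- The underlying undirected graph is a forest. This is only used for subgraphs of acyclic
digraphs, where distinct edges have distinct underlying undirected edges. -/
def IsPolyforest (T : Digraph V) : Prop := T.toSimpleGraphInclusive.IsAcyclic

/-- Deletion of a set of edges. -/
def deleteEdges (G : Digraph V) (F : Finset (V × V)) : Digraph V where
  Adj u v := G.Adj u v ∧ (u, v) ∉ F

/-- The digraph `G + e`. -/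
def addEdge (G : Digraph V) (e : V × V) : Digraph V where
  Adj u v := G.Adj u v ∨ (u, v) = e

/-- The minimum number of edges whose deletion leaves a polyforest. -/
noncomputable def feedbackEdgeNumber (G : Digraph V) : ℕ :=
  sInf {k | ∃ F : Finset (V × V),
    (∀ e ∈ F, G.Adj e.1 e.2) ∧ IsPolyforest (deleteEdges G F) ∧ F.card = k}

variable [Fintype V]

open Classical in
/-- `R_G(v)`: the vertices reachable from `v`, including `v` itself. -/
noncomputable def reachSet (G : Digraph V) (v : V) : Finset V :=
  {w | Relation.ReflTransGen G.Adj v w}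

/-- `a(R_G(v))`. -/
noncomputable def weightedReach (G : Digraph V) (a : V → ℝ) (v : V) : ℝ :=
  ∑ w ∈ reachSet G v, a w

/-! ### The two algorithms as pseudocode

Algorithm 1 computes the weighted reachability numbers of a polyforest, and Algorithm 2 those of
an acyclic digraph, by reverting the edges that were deleted to obtain a polyforest.

All the choices that the pseudocode leaves open (the spanning polyforest, the topological order,
the order in which the deleted edges are reverted) are left open here as well. -/

/-- `order` lists every vertex once, and no edge goes from a later to an earlier vertex. -/
def IsTopologicalOrder (G : Digraph V) (order : List V) : Prop :=
  order.Nodup ∧ (∀ v, v ∈ order) ∧ order.Pairwise fun u v => ¬ G.Adj v u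

open Classical in
/-- Algorithm 1. For all `v` in reverse order, `r(v) ← a_v + ∑ r(w)` over the out-neighbours `w`. -/
noncomputable def polyforestReach (T : Digraph V) (a : V → ℝ) (order : List V) : V → ℝ :=
  order.foldr (fun v r => Function.update r v (a v + ∑ w with T.Adj v w, r w)) (fun _ => 0)

open Classical in
/-- The vertices that can reach `s`. -/
noncomputable def coreachSet (G : Digraph V) (s : V) : Finset V :=
  {v | Relation.ReflTransGen G.Adj v s}

open Classical in
/-- The boundary set for a digraph `G` that does not contain the edge `(s, t)`: the vertices `b`
that reach `s` and have a path (with list `p` of internal vertices) to a vertex `c` reachable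
from `t`, such that no internal vertex reaches `s`. -/
noncomputable def boundarySet (G : Digraph V) (s t : V) : Finset V :=
  {b | b ∈ coreachSet G s ∧ ∃ p : List V, ∃ c ∈ reachSet G t,
    (b :: (p ++ [c])).IsChain G.Adj ∧ ∀ x ∈ p, x ∉ coreachSet G s}

open Classical in
/-- `MARK[v]`: the boundaries that `v` can reach. -/
noncomputable def mark (G : Digraph V) (s t v : V) : Finset V :=
  {b ∈ boundarySet G s t | Relation.ReflTransGen G.Adj v b}

open Classical in
/-- `GAIN[K]`: the weight of the vertices reachable from `t` but from no vertex of `K`. -/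
noncomputable def gain (G : Digraph V) (a : V → ℝ) (t : V) (K : Finset V) : ℝ :=
  ∑ x ∈ reachSet G t \ K.biUnion (reachSet G), a x

open Classical in
/-- One round of Algorithm 2 for the edge `e = (s, t)`: the update of `r`. -/
noncomputable def updateReach (G : Digraph V) (a : V → ℝ) (e : V × V) (r : V → ℝ) : V → ℝ :=
  fun v => if v ∈ coreachSet G e.1 then r v + gain G a e.2 (mark G e.1 e.2 v) else r v

/-- The rounds of Algorithm 2 for the edges of a list, starting from a digraph and a vector. -/
noncomputable def rounds (a : V → ℝ) : List (V × V) → Digraph V → (V → ℝ) → (V → ℝ)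
  | [], _, r => r
  | e :: es, G, r => rounds a es (addEdge G e) (updateReach G a e r)

/-- `r` is the result of some run of Algorithm 2 on the digraph `G` with vertex weighting `a`:
`T` is a polyforest obtained by removing `feedbackEdgeNumber G` edges from `G`, Algorithm 1 is run
on `T` along a topological order, and the removed edges are reverted in the order of the list
`F`. -/
def IsAlgorithm2Result (G : Digraph V) (a : V → ℝ) (r : V → ℝ) : Prop :=
  ∃ T : Digraph V, T ≤ G ∧ IsPolyforest T ∧
    ∃ order : List V, IsTopologicalOrder T order ∧
      ∃ F : List (V × V), F.Nodup ∧ F.length = feedbackEdgeNumber G ∧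
        (∀ u v, (u, v) ∈ F ↔ G.Adj u v ∧ ¬ T.Adj u v) ∧
        r = rounds a F T (polyforestReach T a order)

end Graph

section Machine

set_option linter.constructorNameAsVariable false

/-! ### A random access machine with unit costs

A cell holds a natural number (a word) or an element of `K` (a weight; `K = ℝ` below). The only
operations on words are constants, copying, adding one and comparing; the only operations on
weights are zero, copying and adding. The only constants
that the program below uses are `0` and `1`, so a word never exceeds the largest initial word plus
the number of steps. Cells are addressed by a name and
at most two indices, which are taken from scalar words. -/

/-- Names of words, arrays of words and matrices of words. -/
inductive W
  -- the input: numbers of vertices and edges, sources and targets of the edges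
  | n | m | src | dst
  -- adjacency lists: for each vertex its first out-edge and its out-degree,
  -- for each edge the next edge in the list; the same for in-edges
  | hOut | nxtOut | degOut | hIn | nxtIn | degIn
  -- the edges of the polyforest, and the list of deleted edges
  | inT | rev | nRev
  -- searches
  | vis | queue | head | tail | cnt
  -- the two vertex sets, the boundary list, marks and reachability sets of boundaries
  | setU | setD | bd | nB | markOf | reachOf
  -- the trie
  | child | has | leaf | nNode | node | bit | cov
  -- scalars
  | zero | one | i | j | k | e | s | t | b | u | v | w | x | cur
  deriving DecidableEq

/-- Names of arrays of weights: the input, the result, and the values stored in the trie. -/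
inductive A
  | a | r | gval
  deriving DecidableEq

/-- The address of a word. Scalars have both indices `0`, arrays have second index `0`. -/
abbrev WAddr := W × ℕ × ℕ

/-- The address of a weight. -/
abbrev AAddr := A × ℕ × ℕ

/-- Memory cells. -/
abbrev Cell := WAddr ⊕ AAddr

/-- A reference to a scalar `x`, an array entry `x[i]` or a matrix entry `x[i][j]`, where the
indices `i`, `j` are scalar words. -/
inductive Ref (N : Type)
  | var (x : N)
  | arr (x : N) (i : W)
  | mat (x : N) (i j : W)

/-- The address that a reference denotes, given the contents of the words. -/
def Ref.addr {N : Type} (f : WAddr → ℕ) : Ref N → N × ℕ × ℕ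
  | .var x => (x, 0, 0)
  | .arr x i => (x, f (i, 0, 0), 0)
  | .mat x i j => (x, f (i, 0, 0), f (j, 0, 0))

/-- The cells that hold the indices of a reference. -/
def Ref.indexCells {N : Type} : Ref N → Finset Cell
  | .var _ => ∅
  | .arr _ i => {.inl (i, 0, 0)}
  | .mat _ i j => {.inl (i, 0, 0), .inl (j, 0, 0)}

/-- The cells accessed to read or write a word through a reference. -/
def Ref.wordCells (f : WAddr → ℕ) (x : Ref W) : Finset Cell :=
  insert (.inl (x.addr f)) x.indexCells

/-- The cells accessed to read or write a weight through a reference. -/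
def Ref.weightCells (f : WAddr → ℕ) (x : Ref A) : Finset Cell :=
  insert (.inr (x.addr f)) x.indexCells

/-- Word expressions. -/
inductive WExpr
  | lit (c : ℕ)
  | get (x : Ref W)
  | succ (x : Ref W)

def WExpr.eval (f : WAddr → ℕ) : WExpr → ℕ
  | .lit c => c
  | .get x => f (x.addr f)
  | .succ x => f (x.addr f) + 1

def WExpr.cells (f : WAddr → ℕ) : WExpr → Finset Cell
  | .lit _ => ∅
  | .get x => x.wordCells f
  | .succ x => x.wordCells f

/-- Weight expressions. -/
inductive AExpr
  | zero
  | get (x : Ref A)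
  | add (x y : Ref A)

def AExpr.eval {K : Type} [Zero K] [Add K] (f : WAddr → ℕ) (g : AAddr → K) : AExpr → K
  | .zero => 0
  | .get x => g (x.addr f)
  | .add x y => g (x.addr f) + g (y.addr f)

def AExpr.cells (f : WAddr → ℕ) : AExpr → Finset Cell
  | .zero => ∅
  | .get x => x.weightCells f
  | .add x y => x.weightCells f ∪ y.weightCells f

/-- Conditions. -/
inductive Cond
  | tt
  | eq (p q : WExpr)
  | lt (p q : WExpr)

def Cond.holds (f : WAddr → ℕ) : Cond → Bool
  | .tt => true
  | .eq p q => decide (p.eval f = q.eval f)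
  | .lt p q => decide (p.eval f < q.eval f)

def Cond.cells (f : WAddr → ℕ) : Cond → Finset Cell
  | .tt => ∅
  | .eq p q => p.cells f ∪ q.cells f
  | .lt p q => p.cells f ∪ q.cells f

/-- Programs. `loop p c S` evaluates `p` once and then repeats `S` while the condition `c` holds,
but at most as many times as the value of `p` says. (A machine needs one further counter for each
of the constantly many loops of a program.) -/
inductive Stmt
  | skip
  | setW (x : Ref W) (p : WExpr)
  | setA (x : Ref A) (p : AExpr)
  | seq (S S' : Stmt)
  | ite (c : Cond) (S S' : Stmt)
  | loop (p : WExpr) (c : Cond) (S : Stmt)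

/-- The memory contents, the number of elementary steps made so far, and the set of cells that
have been read or written so far. -/
structure State (K : Type) where
  word : WAddr → ℕ
  weight : AAddr → K
  time : ℕ
  used : Finset Cell

section Semantics

variable {K : Type}

/-- Account for one elementary step that accesses the cells in `C`. -/
def State.charge (σ : State K) (C : Finset Cell) : State K :=
  { σ with time := σ.time + 1, used := σ.used ∪ C }

/-- Repeat `S` while `c` holds, at most the given number of times; every test of `c` is a step. -/
def iterate (c : Cond) (S : State K → State K) : ℕ → State K → State K
  | 0, σ => σ
  | k + 1, σ =>
    if c.holds σ.word then iterate c S k (S (σ.charge (c.cells σ.word)))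
    else σ.charge (c.cells σ.word)

/-- Execution. Every assignment, every test and every evaluation of a loop bound is a step. -/
def Stmt.exec [Zero K] [Add K] : Stmt → State K → State K
  | .skip => fun σ => σ.charge ∅
  | .setW x p => fun σ =>
    { σ.charge (x.wordCells σ.word ∪ p.cells σ.word) with
      word := Function.update σ.word (x.addr σ.word) (p.eval σ.word) }
  | .setA x p => fun σ =>
    { σ.charge (x.weightCells σ.word ∪ p.cells σ.word) with
      weight := Function.update σ.weight (x.addr σ.word) (p.eval σ.word σ.weight) }
  | .seq S S' => fun σ => S'.exec (S.exec σ)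
  | .ite c S S' => fun σ =>
    if c.holds σ.word then S.exec (σ.charge (c.cells σ.word))
    else S'.exec (σ.charge (c.cells σ.word))
  | .loop p c S => fun σ =>
    iterate c S.exec (p.eval σ.word) (σ.charge (p.cells σ.word))

end Semantics

/-! ### Algorithm 2 as a program of the machine -/

/-- Sequential composition. -/
def block : List Stmt → Stmt
  | [] => .skip
  | S :: L => .seq S (block L)

/-- The value of a scalar. -/
abbrev val (x : W) : WExpr := .get (.var x)

/-- The value of an array entry. -/
abbrev entry (x i : W) : WExpr := .get (.arr x i)

/-- `x ← p`. -/
abbrev assign (x : W) (p : WExpr) : Stmt := .setW (.var x) p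

/-- `x[i] ← p`. -/
abbrev put (x i : W) (p : WExpr) : Stmt := .setW (.arr x i) p

/-- `x ← x + 1`. -/
abbrev incr (x : W) : Stmt := .setW (.var x) (.succ (.var x))

/-- `x[i] ← x[i] + 1`. -/
abbrev incrAt (x i : W) : Stmt := .setW (.arr x i) (.succ (.arr x i))

/-- If `c` then `S`. -/
abbrev when (c : Cond) (S : Stmt) : Stmt := .ite c S .skip

/-- For `x = 0, …, p - 1` do `S`. -/
def forUp (x : W) (p : WExpr) (S : Stmt) : Stmt :=
  block [assign x (.lit 0), .loop p .tt (block [S, incr x])]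

/-- A direction in which edges are followed: first edge and number of edges of a vertex, next edge
in the list of the vertex, and the endpoint that is reached. -/
structure Dir where
  first : W
  deg : W
  next : W
  tip : W

/-- Follow the edges forwards. -/
def fwd : Dir := ⟨.hOut, .degOut, .nxtOut, .dst⟩

/-- Follow the edges backwards. -/
def bwd : Dir := ⟨.hIn, .degIn, .nxtIn, .src⟩

/-- For all edges `cur` at the vertex `u` in direction `d`, with other endpoint `w`, do `S`. -/
def scan (d : Dir) (S : Stmt) : Stmt := block
  [ assign .cur (entry d.first .u),
    .loop (entry d.deg .u) .tt (block
      [ assign .w (entry d.tip .cur), S, assign .cur (entry d.next .cur) ]) ]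

/-- Append `x` to the queue. -/
def push (x : W) : Stmt := block [put .queue .tail (val x), incr .tail]

/-- Empty the queue. -/
def clearQueue : Stmt := block [assign .head (.lit 0), assign .tail (.lit 0)]

/-- Repeatedly remove the first vertex `u` from the queue and do `S`, until the queue is empty.
(At most `n` vertices are ever put into a queue.) -/
def serve (S : Stmt) : Stmt :=
  .loop (val .n) (.lt (val .head) (val .tail))
    (block [assign .u (entry .queue .head), incr .head, S])

/-- `x[v] ← c` for all vertices `v`. -/
def fill (x : W) (c : ℕ) : Stmt := forUp .v (val .n) (put x .v (.lit c))

/-- `x[v] ← y[v]` for all vertices `v`. -/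
def copy (x y : W) : Stmt := forUp .v (val .n) (put x .v (entry y .v))

/-- Make the current digraph edgeless. -/
def clearEdges : Stmt := block [fill .degOut 0, fill .degIn 0]

/-- Insert the edge number `e` into the current digraph. -/
def insertEdge : Stmt := block
  [ assign .u (entry .src .e),
    put .nxtOut .e (entry .hOut .u), put .hOut .u (val .e), incrAt .degOut .u,
    assign .u (entry .dst .e),
    put .nxtIn .e (entry .hIn .u), put .hIn .u (val .e), incrAt .degIn .u ]

/-- Make `T` the edge set of a spanning polyforest of `G`, by searching the underlying undirected
graph; make `rev` the list of the other edges; make the polyforest the current digraph. -/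
def spanningPolyforest : Stmt :=
  let visit : Stmt := when (.eq (entry .vis .w) (.lit 0)) (block
    [ put .vis .w (.lit 1), put .inT .cur (.lit 1), push .w ])
  block
    [ clearEdges,
      forUp .e (val .m) (block [put .inT .e (.lit 0), insertEdge]),
      fill .vis 0,
      clearQueue,
      forUp .x (val .n) (when (.eq (entry .vis .x) (.lit 0)) (block
        [ put .vis .x (.lit 1), push .x, serve (block [scan fwd visit, scan bwd visit]) ])),
      clearEdges,
      assign .nRev (.lit 0),
      forUp .e (val .m) (.ite (.eq (entry .inT .e) (.lit 1))
        insertEdge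
        (block [put .rev .nRev (val .e), incr .nRev])) ]

/-- Algorithm 1 on the current digraph. The queue becomes a reverse topological order. -/
def algorithm1 : Stmt := block
  [ clearQueue,
    fill .cnt 0,
    forUp .v (val .n) (when (.eq (entry .degOut .v) (.lit 0)) (push .v)),
    serve (scan bwd (block
      [ incrAt .cnt .w, when (.eq (entry .cnt .w) (entry .degOut .w)) (push .w) ])),
    forUp .k (val .n) (block
      [ assign .u (entry .queue .k),
        .setA (.arr .r .u) (.get (.arr .a .u)),
        scan fwd (.setA (.arr .r .u) (.add (.arr .r .u) (.arr .r .w))) ]) ]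

/-- Breadth-first search from the vertex `x` in direction `d`: `vis[v]` becomes `1` if `v` is
found and `0` otherwise. -/
def search (d : Dir) (x : W) : Stmt := block
  [ clearQueue,
    fill .vis 0,
    put .vis x (.lit 1), push x,
    serve (scan d (when (.eq (entry .vis .w) (.lit 0)) (block
      [ put .vis .w (.lit 1), push .w ]))) ]

/-- Compute the list `bd` of the boundaries, by a breadth-first search on the transposed digraph
that starts from the set `setD` and does not go forward when it touches the set `setU`. -/
def boundary : Stmt := block
  [ clearQueue,
    fill .vis 0,
    assign .nB (.lit 0),
    forUp .v (val .n) (when (.eq (entry .setD .v) (.lit 1)) (block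
      [ put .vis .v (.lit 1), push .v ])),
    serve (scan bwd (when (.eq (entry .vis .w) (.lit 0)) (block
      [ put .vis .w (.lit 1),
        .ite (.eq (entry .setU .w) (.lit 1))
          (block [put .bd .nB (val .w), incr .nB])
          (push .w) ]))) ]

/-- For the `j`-th boundary `b`: `markOf[j][v]` tells whether `v` reaches `b`, and `reachOf[j][v]`
whether `b` reaches `v`. So `MARK[v]` is represented by the bits `markOf[j][v]`. -/
def marks : Stmt := forUp .j (val .nB) (block
  [ assign .b (entry .bd .j),
    search bwd .b,
    forUp .v (val .n) (.setW (.mat .markOf .j .v) (entry .vis .v)),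
    search fwd .b,
    forUp .v (val .n) (.setW (.mat .reachOf .j .v) (entry .vis .v)) ])

/-- Append a trie node without children and without value. (The root is node `0` and is no
child, so that `0` stands for a missing child.) -/
def newNode : Stmt := block
  [ .setW (.mat .child .zero .nNode) (.lit 0), .setW (.mat .child .one .nNode) (.lit 0),
    put .has .nNode (.lit 0), incr .nNode ]

/-- `gval[node] ←` the weight of the vertices `x` in `setD` that are reached by no boundary that is
marked for `v`. -/
def computeGain : Stmt := block
  [ .setA (.arr .gval .node) .zero,
    forUp .x (val .n) (when (.eq (entry .setD .x) (.lit 1)) (block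
      [ assign .cov (.lit 0),
        forUp .j (val .nB) (when (.eq (.get (.mat .markOf .j .v)) (.lit 1))
          (when (.eq (.get (.mat .reachOf .j .x)) (.lit 1)) (assign .cov (.lit 1)))),
        when (.eq (val .cov) (.lit 0))
          (.setA (.arr .gval .node) (.add (.arr .gval .node) (.arr .a .x))) ])) ]

/-- Build the trie `GAIN`; `leaf[v]` becomes the node with key `MARK[v]`. -/
def gains : Stmt := block
  [ assign .zero (.lit 0), assign .one (.lit 1), assign .nNode (.lit 0),
    newNode,
    forUp .v (val .n) (when (.eq (entry .setU .v) (.lit 1)) (block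
      [ assign .node (.lit 0),
        forUp .j (val .nB) (block
          [ assign .bit (.get (.mat .markOf .j .v)),
            when (.eq (.get (.mat .child .bit .node)) (.lit 0)) (block
              [ .setW (.mat .child .bit .node) (val .nNode), newNode ]),
            assign .node (.get (.mat .child .bit .node)) ]),
        when (.eq (entry .has .node) (.lit 0)) (block
          [ put .has .node (.lit 1), computeGain ]),
        put .leaf .v (val .node) ])) ]

/-- One round, for the `i`-th edge of the list `rev`. -/
def round : Stmt := block
  [ assign .e (entry .rev .i),
    assign .s (entry .src .e),
    assign .t (entry .dst .e),
    search bwd .s, copy .setU .vis,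
    search fwd .t, copy .setD .vis,
    boundary,
    marks,
    gains,
    forUp .v (val .n) (when (.eq (entry .setU .v) (.lit 1)) (block
      [ assign .node (entry .leaf .v),
        .setA (.arr .r .v) (.add (.arr .r .v) (.arr .gval .node)) ])),
    insertEdge ]

/-- Algorithm 2. -/
def algorithm2 : Stmt := block
  [ spanningPolyforest,
    algorithm1,
    forUp .i (val .nRev) round ]

/-- The machine is about to start on the digraph with vertices `0, …, n - 1` and list of edges
`edges`, with vertex weighting `a`. Nothing is assumed about the contents of the other cells. -/
structure IsInitial {K : Type} (σ : State K) (n : ℕ) (edges : List (Fin n × Fin n))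
    (a : Fin n → K) : Prop where
  numVertices : σ.word (.n, 0, 0) = n
  numEdges : σ.word (.m, 0, 0) = edges.length
  source : ∀ k (h : k < edges.length), σ.word (.src, k, 0) = (edges[k].1 : ℕ)
  target : ∀ k (h : k < edges.length), σ.word (.dst, k, 0) = (edges[k].2 : ℕ)
  weight : ∀ v : Fin n, σ.weight (.a, (v : ℕ), 0) = a v
  time : σ.time = 0
  used : σ.used = ∅

end Machine

end DescendantCounting

/-!
Correctness of the pseudocode rests on one fact about paths. Let `G + (s, t)` be acyclic. A vertex
`v` gains new descendants from the edge `(s, t)` only if it reaches `s`, and then it gains those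
descendants of `t` that it did not reach before. A path of `G` from `v` to a descendant of `t` has
to leave the set `U` of vertices that reach `s`, and it does so at a boundary. Hence the vertices
gained are the descendants of `t` that no boundary marked for `v` reaches
(`reach_iff_exists_mark`, `updateReach_weightedReach`). In a polyforest, distinct successors of a
vertex have disjoint sets of descendants, so that the recursion of Algorithm 1 counts every vertex
once (`weightedReach_eq_add_sum`).

The time bound rests on counting edges. After the insertion of `k` edges into a forest, every
nonempty vertex set `X` spans at most `|X| - 1 + k` edges (`Sparse`). The set `U` and the set `W` of
the other vertices that reach a descendant of `t` are both connected, and every boundary is the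
source of an edge from `U` to `W`. Moreover, `U` spans one edge beyond a spanning tree for each of
its branching vertices, those with at least two out-edges into `U`. So there are at most `k + 1`
boundaries and branching vertices altogether (`card_boundary_add_branching_le`). Following the
out-edges of the remaining vertices in `U`, one sees that every mark occurs at `s`, at a boundary
or at a branching vertex, whence there are at most `k + 2` different marks
(`card_image_marks_le`). Each boundary costs two searches, and each mark one computation of a gain
in time `O(k n)`, so that a round takes time `O(k² n + k m)`.

The program is verified in a program logic: `WP M S f g Q` says that `S`, run from the memory
contents `f` and `g`, uses only cells in `M` and ends with a time and memory contents that satisfy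
`Q`. The set `M` is fixed in advance (`allowed`), and its cardinality is the space bound. Loops have
rules with invariants (`wp_forUp`, `wp_scan`, `wp_serve`), and a syntactic check of the names to
which a statement assigns shows what it leaves unchanged (`Frame`). At most `f` edges are
deleted by `spanningPolyforest`, since the forest found by its search has at least as many edges as
any other (`ForestMax`).
-/

set_option linter.constructorNameAsVariable false

namespace DescendantCounting

/-! ### Counting edges in digraphs that are close to a polyforest -/

section Counting

variable {V E : Type*}

/-- The adjacency relation of the digraph with edge set `S`, where the edge `e` leads from `src e`
to `dst e`. -/
def EdgeRel (S : Finset E) (src dst : E → V) (u v : V) : Prop :=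
  ∃ e ∈ S, src e = u ∧ dst e = v

open Classical in
/-- The edges of `S` with both ends in `X`. -/
noncomputable def edgesWithin (S : Finset E) (src dst : E → V) (X : Finset V) : Finset E :=
  {e ∈ S | src e ∈ X ∧ dst e ∈ X}

/-- Every nonempty vertex set `X` spans at most `|X| - 1 + k` edges. For `k = 0` this characterizes
forests, and the addition of an edge increases `k` by at most one. -/
def Sparse (k : ℕ) (S : Finset E) (src dst : E → V) : Prop :=
  ∀ X : Finset V, X.Nonempty → (edgesWithin S src dst X).card + 1 ≤ X.card + k

theorem Sparse.mono {k : ℕ} {S S' : Finset E} {src dst : E → V} (h : Sparse k S src dst)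
    (hS : S' ⊆ S) : Sparse k S' src dst := by
  intro X hX
  refine le_trans ?_ (h X hX)
  gcongr
  intro e he
  simp only [edgesWithin, Finset.mem_filter] at he ⊢
  exact ⟨hS he.1, he.2⟩

open Classical in
theorem Sparse.insert {k : ℕ} {S : Finset E} {src dst : E → V} (h : Sparse k S src dst) (e : E) :
    Sparse (k + 1) (Insert.insert e S) src dst := by
  intro X hX
  have h1 := h X hX
  have : edgesWithin (Insert.insert e S) src dst X ⊆
      Insert.insert e (edgesWithin S src dst X) := by
    intro x
    simp only [edgesWithin, Finset.mem_filter, Finset.mem_insert]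
    tauto
  have h2 := (Finset.card_le_card this).trans (Finset.card_insert_le _ _)
  omega

open Classical in
/-- A forest remains a forest when a new vertex `v` is attached to it by an edge `e`. -/
theorem Sparse.insert_leaf {S : Finset E} {src dst : E → V} {Q : Finset V} {v : V} {e : E}
    (h : Sparse 0 S src dst) (hQ : ∀ e ∈ S, src e ∈ Q ∧ dst e ∈ Q) (hv : v ∉ Q)
    (he : src e = v ∧ dst e ∈ Q ∨ dst e = v ∧ src e ∈ Q) :
    Sparse 0 (Insert.insert e S) src dst := by
  intro X hX
  by_cases hvX : v ∈ X
  · by_cases hne : (X.erase v).Nonempty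
    · have h1 := h _ hne
      have h3 : edgesWithin (Insert.insert e S) src dst X ⊆
          Insert.insert e (edgesWithin S src dst (X.erase v)) := by
        intro x
        simp only [edgesWithin, Finset.mem_filter, Finset.mem_insert, Finset.mem_erase]
        rintro ⟨rfl | hx, h1, h2⟩
        · exact Or.inl rfl
        · exact Or.inr ⟨hx, ⟨fun h => hv (h ▸ (hQ x hx).1), h1⟩,
            ⟨fun h => hv (h ▸ (hQ x hx).2), h2⟩⟩
      have h4 := (Finset.card_le_card h3).trans (Finset.card_insert_le _ _)
      have := Finset.card_erase_add_one hvX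
      omega
    · have : ∀ x ∈ X, x = v := by
        intro x hx
        by_contra hxv
        exact hne ⟨x, Finset.mem_erase.2 ⟨hxv, hx⟩⟩
      have h3 : edgesWithin (Insert.insert e S) src dst X = ∅ := by
        simp only [edgesWithin, Finset.filter_eq_empty_iff, Finset.mem_insert]
        rintro x (rfl | hx) ⟨h1, h2⟩
        · have e1 := this _ h1
          have e2 := this _ h2
          rcases he with he | he
          · exact hv (e2 ▸ he.2)
          · exact hv (e1 ▸ he.2)
        · exact hv (this _ h1 ▸ (hQ x hx).1)
      rw [h3]
      have := Finset.card_pos.2 hX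
      simpa using this
  · have h3 : edgesWithin (Insert.insert e S) src dst X ⊆ edgesWithin S src dst X := by
      intro x
      simp only [edgesWithin, Finset.mem_filter, Finset.mem_insert]
      rintro ⟨rfl | hx, h1, h2⟩
      · rcases he with he | he
        · exact absurd (he.1 ▸ h1) hvX
        · exact absurd (he.1 ▸ h2) hvX
      · exact ⟨hx, h1, h2⟩
    exact le_trans (by gcongr) (h X hX)

open Classical in
/-- Distinct edges of an acyclic digraph are distinct as undirected edges, so that a polyforest has
as few edges in every vertex set as the underlying forest. -/
theorem IsPolyforest.sparse [Fintype V] {T : Digraph V} (hT : IsAcyclic T) (h : IsPolyforest T) :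
    Sparse 0 {e : V × V | T.Adj e.1 e.2} Prod.fst Prod.snd := by
  intro X hX
  have hne : Nonempty (X : Set V) := hX.to_subtype
  obtain ⟨F, hle, -, hF⟩ :=
    (SimpleGraph.connected_top (V := (X : Set V))).exists_isTree_le_of_le_of_isAcyclic
      le_top (h.induce (X : Set V))
  have hcard := hF.card_edgeFinset
  have hX' : Fintype.card (X : Set V) = X.card := by simp
  rw [hX'] at hcard
  rw [add_zero, ← hcard, add_le_add_iff_right]
  have hmem : ∀ e ∈ edgesWithin {e : V × V | T.Adj e.1 e.2} Prod.fst Prod.snd X,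
      T.Adj e.1 e.2 ∧ e.1 ∈ X ∧ e.2 ∈ X := by
    intro e he
    simpa [edgesWithin] using he
  refine Finset.card_le_card_of_injOn
    (fun e => if he : e.1 ∈ X ∧ e.2 ∈ X then s(⟨e.1, he.1⟩, ⟨e.2, he.2⟩) else s(hne.some, hne.some))
    ?_ ?_
  · intro e he
    obtain ⟨h1, h2, h3⟩ := hmem e he
    simp only [h2, h3, and_self, dif_pos, SimpleGraph.coe_edgeFinset, SimpleGraph.mem_edgeSet]
    refine hle ?_
    simp only [SimpleGraph.comap_adj, Function.Embedding.subtype_apply]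
    refine ⟨?_, Or.inl h1⟩
    intro heq
    exact hT e.1 (Relation.TransGen.single (by simpa [← heq] using h1))
  · intro e he e' he' heq
    obtain ⟨h1, h2, h3⟩ := hmem e he
    obtain ⟨h1', h2', h3'⟩ := hmem e' he'
    simp only [h2, h3, h2', h3', and_self, dif_pos, Sym2.eq_iff, Subtype.mk.injEq] at heq
    rcases heq with ⟨a, b⟩ | ⟨a, b⟩
    · exact Prod.ext a b
    · exact absurd ((Relation.TransGen.single (a := e.1) (b := e.2) h1).tail
        (by rw [a, b]; exact h1')) (hT e.1)

section Boundary

open Relation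

variable {S : Finset E} {src dst : E → V}

open Classical in
/-- The vertices in `U` with at least two out-edges that end in `U`. -/
noncomputable def branching (S : Finset E) (src dst : E → V) (U : Finset V) : Finset V :=
  {v ∈ U | ∃ e ∈ S, ∃ e' ∈ S, e ≠ e' ∧ src e = v ∧ src e' = v ∧ dst e ∈ U ∧ dst e' ∈ U}

open Classical in
/-- Let every vertex of `U` reach `s ∈ U`. Then `U` spans at least `|U| - 1` edges, and one more for
every branching vertex of `U`. -/
theorem card_add_branching_le [Nonempty E] (hac : ∀ v, ¬ TransGen (EdgeRel S src dst) v v)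
    {U : Finset V} {s : V}
    (hU : ∀ v, v ∈ U ↔ ReflTransGen (EdgeRel S src dst) v s) :
    U.card + (branching S src dst U).card ≤ (edgesWithin S src dst U).card + 1 := by
  have hsU : s ∈ U := (hU s).2 .refl
  have hout : ∀ v ∈ U.erase s, ∃ e ∈ S, src e = v ∧ dst e ∈ U := by
    intro v hv
    obtain ⟨hvs, hv⟩ := Finset.mem_erase.1 hv
    rcases ReflTransGen.cases_head ((hU v).1 hv) with h | ⟨c, ⟨e, he, h1, h2⟩, h3⟩
    · exact absurd h hvs
    · exact ⟨e, he, h1, h2 ▸ (hU c).2 h3⟩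
  choose! o ho1 ho2 ho3 using hout
  have hbr : ∀ v ∈ branching S src dst U, ∃ e ∈ S, src e = v ∧ dst e ∈ U ∧ e ≠ o v := by
    intro v hv
    obtain ⟨-, e, he, e', he', hne, h1, h2, h3, h4⟩ := Finset.mem_filter.1 hv
    by_cases h : e = o v
    · exact ⟨e', he', h2, h4, fun h' => hne (h.trans h'.symm)⟩
    · exact ⟨e, he, h1, h3, h⟩
  choose! o' ho1' ho2' ho3' ho4' using hbr
  have hbs : ∀ v ∈ branching S src dst U, v ∈ U.erase s := by
    intro v hv
    refine Finset.mem_erase.2 ⟨?_, (Finset.mem_filter.1 hv).1⟩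
    rintro rfl
    exact hac v ((TransGen.single ⟨_, ho1' v hv, ho2' v hv, rfl⟩).trans_left
      ((hU _).1 (ho3' v hv)))
  have hc1 : ((U.erase s).image o).card = (U.erase s).card :=
    Finset.card_image_of_injOn fun x hx y hy h => by rw [← ho2 x hx, ← ho2 y hy]; exact congrArg _ h
  have hc2 : ((branching S src dst U).image o').card = (branching S src dst U).card :=
    Finset.card_image_of_injOn fun x hx y hy h => by
      rw [← ho2' x hx, ← ho2' y hy]; exact congrArg _ h
  have hdis : Disjoint ((U.erase s).image o) ((branching S src dst U).image o') := by
    rw [Finset.disjoint_left]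
    intro e h1 h2
    obtain ⟨x, hx, rfl⟩ := Finset.mem_image.1 h1
    obtain ⟨y, hy, hxy⟩ := Finset.mem_image.1 h2
    have : x = y := by rw [← ho2 x hx, ← ho2' y hy, hxy]
    subst this
    exact ho4' x hy hxy
  have hsub : (U.erase s).image o ∪ (branching S src dst U).image o' ⊆ edgesWithin S src dst U := by
    intro e he
    simp only [edgesWithin, Finset.mem_filter]
    rcases Finset.mem_union.1 he with he | he
    · obtain ⟨x, hx, rfl⟩ := Finset.mem_image.1 he
      exact ⟨ho1 x hx, (ho2 x hx).symm ▸ (Finset.mem_erase.1 hx).2, ho3 x hx⟩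
    · obtain ⟨x, hx, rfl⟩ := Finset.mem_image.1 he
      exact ⟨ho1' x hx, (ho2' x hx).symm ▸ (Finset.mem_erase.1 (hbs x hx)).2, ho3' x hx⟩
  have := Finset.card_le_card hsub
  rw [Finset.card_union_of_disjoint hdis, hc1, hc2] at this
  have := Finset.card_erase_add_one hsU
  omega

open Classical in
/-- A set `W` that is connected, because each of its vertices reaches within `W` a vertex that is
reachable from `t` within `W`, spans at least `|W| - 1` edges. -/
theorem card_le_edgesWithin [Nonempty E] {W D : Finset V} {t : V}
    (hD : ∀ v, v ∈ D ↔ ReflTransGen (EdgeRel S src dst) t v)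
    (hDW : D ⊆ W) (hW : ∀ v ∈ W, ∃ c ∈ D, ReflTransGen (EdgeRel S src dst) v c)
    (hcl : ∀ v ∈ W, ∀ c ∈ D, ∀ w, EdgeRel S src dst v w → ReflTransGen (EdgeRel S src dst) w c →
      w ∈ W) :
    W.card ≤ (edgesWithin S src dst W).card + 1 := by
  have htD : t ∈ D := (hD t).2 .refl
  have hout : ∀ v ∈ W \ D, ∃ e ∈ S, src e = v ∧ dst e ∈ W := by
    intro v hv
    obtain ⟨hv, hvD⟩ := Finset.mem_sdiff.1 hv
    obtain ⟨c, hc, hvc⟩ := hW v hv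
    rcases ReflTransGen.cases_head hvc with h | ⟨w, ⟨e, he, h1, h2⟩, h3⟩
    · exact absurd (h ▸ hc) hvD
    · exact ⟨e, he, h1, hcl v hv c hc _ ⟨e, he, h1, rfl⟩ (h2 ▸ h3)⟩
  choose! o ho1 ho2 ho3 using hout
  have hin : ∀ v ∈ D.erase t, ∃ e ∈ S, dst e = v ∧ src e ∈ D := by
    intro v hv
    obtain ⟨hvt, hv⟩ := Finset.mem_erase.1 hv
    rcases ReflTransGen.cases_tail ((hD v).1 hv) with h | ⟨c, h3, ⟨e, he, h1, h2⟩⟩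
    · exact absurd h hvt
    · exact ⟨e, he, h2, h1 ▸ (hD c).2 h3⟩
  choose! p hp1 hp2 hp3 using hin
  have hc1 : ((W \ D).image o).card = (W \ D).card :=
    Finset.card_image_of_injOn fun x hx y hy h => by rw [← ho2 x hx, ← ho2 y hy]; exact congrArg _ h
  have hc2 : ((D.erase t).image p).card = (D.erase t).card :=
    Finset.card_image_of_injOn fun x hx y hy h => by rw [← hp2 x hx, ← hp2 y hy]; exact congrArg _ h
  have hdis : Disjoint ((W \ D).image o) ((D.erase t).image p) := by
    rw [Finset.disjoint_left]
    intro e h1 h2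
    obtain ⟨x, hx, rfl⟩ := Finset.mem_image.1 h1
    obtain ⟨y, hy, hxy⟩ := Finset.mem_image.1 h2
    have := hp3 y hy
    rw [hxy, ho2 x hx] at this
    exact (Finset.mem_sdiff.1 hx).2 this
  have hsub : (W \ D).image o ∪ (D.erase t).image p ⊆ edgesWithin S src dst W := by
    intro e he
    simp only [edgesWithin, Finset.mem_filter]
    rcases Finset.mem_union.1 he with he | he
    · obtain ⟨x, hx, rfl⟩ := Finset.mem_image.1 he
      exact ⟨ho1 x hx, (ho2 x hx).symm ▸ (Finset.mem_sdiff.1 hx).1, ho3 x hx⟩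
    · obtain ⟨x, hx, rfl⟩ := Finset.mem_image.1 he
      exact ⟨hp1 x hx, hDW (hp3 x hx), (hp2 x hx).symm ▸ hDW (Finset.mem_erase.1 hx).2⟩
  have := Finset.card_le_card hsub
  rw [Finset.card_union_of_disjoint hdis, hc1, hc2] at this
  have := Finset.card_erase_add_one htD
  have := Finset.card_sdiff_add_card_eq_card hDW
  omega

open Classical in
/-- The vertices that reach `s` and those that reach a vertex reachable from `t`, but do not reach
`s`, are two connected vertex sets, and every boundary is the source of an edge between them. So
boundaries and branching vertices contribute to the cyclomatic number. -/
theorem card_boundary_add_branching_le [Nonempty E] {k : ℕ} {U D B : Finset V} {s t : V}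
    (hS : Sparse k S src dst)
    (hac : ∀ v, ¬ TransGen (EdgeRel S src dst) v v)
    (hts : ¬ ReflTransGen (EdgeRel S src dst) t s)
    (hU : ∀ v, v ∈ U ↔ ReflTransGen (EdgeRel S src dst) v s)
    (hD : ∀ v, v ∈ D ↔ ReflTransGen (EdgeRel S src dst) t v)
    (hB : ∀ b ∈ B, b ∈ U ∧ ∃ w ∉ U, EdgeRel S src dst b w ∧
      ∃ c ∈ D, ReflTransGen (EdgeRel S src dst) w c) :
    B.card + (branching S src dst U).card ≤ k + 1 := by
  -- every vertex outside `U` that reaches `D` is in `D` or the source of an edge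
  let W : Finset V := {x ∈ D ∪ S.image src ∪ S.image dst |
    x ∉ U ∧ ∃ c ∈ D, ReflTransGen (EdgeRel S src dst) x c}
  have hW : ∀ x, x ∈ W ↔ x ∉ U ∧ ∃ c ∈ D, ReflTransGen (EdgeRel S src dst) x c := by
    intro x
    simp only [W, Finset.mem_filter, Finset.mem_union, and_iff_right_iff_imp]
    rintro ⟨-, c, hc, hxc⟩
    rcases ReflTransGen.cases_head hxc with h | ⟨w, ⟨e, he, h1, h2⟩, h3⟩
    · exact Or.inl (Or.inl (h ▸ hc))
    · exact Or.inl (Or.inr (h1 ▸ Finset.mem_image_of_mem _ he))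
  have hDU : ∀ x ∈ D, x ∉ U := fun x hx hxU => hts (((hD x).1 hx).trans ((hU x).1 hxU))
  have hDW : D ⊆ W := fun x hx => (hW x).2 ⟨hDU x hx, x, hx, .refl⟩
  have hcU := card_add_branching_le hac hU
  have hcW := card_le_edgesWithin hD hDW (fun v hv => ((hW v).1 hv).2)
    (fun v hv c hc w hvw hwc => (hW w).2 ⟨fun hw => ((hW v).1 hv).1
      ((hU v).2 (.head hvw ((hU w).1 hw))), c, hc, hwc⟩)
  have hB' : ∀ b ∈ B, ∃ e ∈ S, src e = b ∧ dst e ∈ W := by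
    intro b hb
    obtain ⟨-, w, hw, ⟨e, he, h1, h2⟩, h⟩ := hB b hb
    exact ⟨e, he, h1, h2 ▸ (hW w).2 ⟨hw, h⟩⟩
  choose! o ho1 ho2 ho3 using hB'
  have hc1 : (B.image o).card = B.card :=
    Finset.card_image_of_injOn fun x hx y hy h => by rw [← ho2 x hx, ← ho2 y hy]; exact congrArg _ h
  have hUW : Disjoint U W := Finset.disjoint_left.2 fun x h1 h2 => ((hW x).1 h2).1 h1
  have hd1 : Disjoint (edgesWithin S src dst U) (edgesWithin S src dst W) := by
    rw [Finset.disjoint_left]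
    intro e h1 h2
    exact Finset.disjoint_left.1 hUW (Finset.mem_filter.1 h1).2.1 (Finset.mem_filter.1 h2).2.1
  have hd2 : Disjoint (edgesWithin S src dst U ∪ edgesWithin S src dst W) (B.image o) := by
    rw [Finset.disjoint_left]
    intro e h1 h2
    obtain ⟨b, hb, rfl⟩ := Finset.mem_image.1 h2
    rcases Finset.mem_union.1 h1 with h1 | h1
    · exact Finset.disjoint_left.1 hUW (Finset.mem_filter.1 h1).2.2 (ho3 b hb)
    · exact Finset.disjoint_left.1 hUW (hB b hb).1 (ho2 b hb ▸ (Finset.mem_filter.1 h1).2.1)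
  have hsub : edgesWithin S src dst U ∪ edgesWithin S src dst W ∪ B.image o ⊆
      edgesWithin S src dst (U ∪ W) := by
    intro e he
    simp only [edgesWithin, Finset.mem_filter, Finset.mem_union] at he ⊢
    rcases he with (h | h) | h
    · exact ⟨h.1, Or.inl h.2.1, Or.inl h.2.2⟩
    · exact ⟨h.1, Or.inr h.2.1, Or.inr h.2.2⟩
    · obtain ⟨b, hb, rfl⟩ := Finset.mem_image.1 h
      exact ⟨ho1 b hb, Or.inl (by rw [ho2 b hb]; exact (hB b hb).1), Or.inr (ho3 b hb)⟩
  have h1 := Finset.card_le_card hsub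
  rw [Finset.card_union_of_disjoint hd2, Finset.card_union_of_disjoint hd1, hc1] at h1
  have h2 := hS (U ∪ W) ⟨s, Finset.mem_union_left _ ((hU s).2 .refl)⟩
  rw [Finset.card_union_of_disjoint hUW] at h2
  omega

open Classical in
/-- A vertex that is neither `s` nor a boundary nor branching has a single out-edge into `U`, and so
reaches the same boundaries as its successor. Hence few sets of boundaries occur as marks. -/
theorem card_image_marks_le {α : Type*} {U B : Finset V} {s : V} (κ : V → α)
    (hU : ∀ v, v ∈ U ↔ ReflTransGen (EdgeRel S src dst) v s) (hB : B ⊆ U)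
    (hκ : ∀ u ∈ U, ∀ v ∈ U, (∀ b ∈ B, ReflTransGen (EdgeRel S src dst) u b ↔
      ReflTransGen (EdgeRel S src dst) v b) → κ u = κ v) :
    (U.image κ).card ≤ B.card + (branching S src dst U).card + 1 := by
  let X : Finset V := insert s (B ∪ branching S src dst U)
  have hX : U.image κ ⊆ X.image κ := by
    intro y hy
    obtain ⟨v, hv, rfl⟩ := Finset.mem_image.1 hy
    have := (hU v).1 hv
    clear hv hy
    induction this using ReflTransGen.head_induction_on with
    | refl => exact Finset.mem_image_of_mem _ (Finset.mem_insert_self _ _)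
    | @head v c hvc hcs ih =>
      by_cases hvX : v ∈ X
      · exact Finset.mem_image_of_mem _ hvX
      have hcU : c ∈ U := (hU c).2 hcs
      have hvU : v ∈ U := (hU v).2 (.head hvc hcs)
      rw [hκ v hvU c hcU]
      · exact ih
      intro b hb
      refine ⟨fun h => ?_, fun h => .head hvc h⟩
      simp only [X, Finset.mem_insert, Finset.mem_union, not_or] at hvX
      rcases ReflTransGen.cases_head h with h | ⟨c', hvc', hc'b⟩
      · exact absurd (h ▸ hb) hvX.2.1
      · have hc' : c' ∈ U := (hU c').2 (hc'b.trans ((hU b).1 (hB hb)))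
        obtain ⟨e, he, h1, h2⟩ := hvc
        obtain ⟨e', he', h1', h2'⟩ := hvc'
        have : e = e' := by
          by_contra hne
          exact hvX.2.2 (Finset.mem_filter.2 ⟨hvU, e, he, e', he', hne, h1, h1',
            h2 ▸ hcU, h2' ▸ hc'⟩)
        rw [← h2, this, h2']
        exact hc'b
  calc (U.image κ).card ≤ (X.image κ).card := Finset.card_le_card hX
    _ ≤ X.card := Finset.card_image_le
    _ ≤ (B ∪ branching S src dst U).card + 1 := Finset.card_insert_le _ _
    _ ≤ _ := by gcongr; exact Finset.card_union_le _ _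

open Classical in
/-- In a polyforest, the sets of vertices reachable from two distinct successors of a vertex are
disjoint. -/
theorem Sparse.eq_of_reach (hS : Sparse 0 S src dst) {e e' : E} {x : V}
    (hac : ∀ v, ¬ TransGen (EdgeRel S src dst) v v) (he : e ∈ S) (he' : e' ∈ S)
    (hsrc : src e = src e') (hx : ReflTransGen (EdgeRel S src dst) (dst e) x)
    (hx' : ReflTransGen (EdgeRel S src dst) (dst e') x) : e = e' := by
  by_contra hne
  have : Nonempty E := ⟨e⟩
  let U : Finset V := {y ∈ Insert.insert x (S.image src) | ReflTransGen (EdgeRel S src dst) y x}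
  have hU : ∀ v, v ∈ U ↔ ReflTransGen (EdgeRel S src dst) v x := by
    intro v
    refine ⟨fun h => (Finset.mem_filter.1 h).2, fun h => Finset.mem_filter.2 ⟨?_, h⟩⟩
    rcases ReflTransGen.cases_head h with rfl | ⟨_, ⟨e, he, rfl, -⟩, -⟩
    · exact Finset.mem_insert_self _ _
    · exact Finset.mem_insert_of_mem (Finset.mem_image_of_mem _ he)
  have h1 := card_add_branching_le hac hU
  have h2 := hS U ⟨x, (hU x).2 .refl⟩
  have h3 : src e ∈ branching S src dst U :=
    Finset.mem_filter.2 ⟨(hU _).2 (.head ⟨e, he, rfl, rfl⟩ hx), e, he, e', he', hne, rfl, hsrc.symm,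
      (hU _).2 hx, (hU _).2 hx'⟩
  have := Finset.card_pos.2 ⟨_, h3⟩
  omega

end Boundary

end Counting

end DescendantCounting

namespace DescendantCounting

/-! ### Correctness of the pseudocode -/

section Pseudocode

open Relation

variable {V : Type*}

theorem IsAcyclic.mono {G H : Digraph V} (hG : IsAcyclic G) (h : H ≤ G) : IsAcyclic H :=
  fun v hv => hG v (TransGen.mono (fun _ _ h' => h h') _ _ hv)

theorem IsAcyclic.not_reach {G : Digraph V} (hG : IsAcyclic G) {u v : V} (h : G.Adj u v) :
    ¬ ReflTransGen G.Adj v u := fun h' => hG u (TransGen.head' h h')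

theorem IsAcyclic.ne {G : Digraph V} (hG : IsAcyclic G) {u v : V} (h : G.Adj u v) : u ≠ v := by
  rintro rfl
  exact hG.not_reach h .refl

theorem deleteEdges_le (G : Digraph V) (F : Finset (V × V)) : deleteEdges G F ≤ G :=
  fun _ _ h => h.1

/-- A path in `G + (s, t)` either avoids the new edge, or reaches `s` before it and leaves `t` after
it. -/
theorem reach_addEdge_iff {G : Digraph V} {s t : V} (h : IsAcyclic (addEdge G (s, t))) (v w : V) :
    ReflTransGen (addEdge G (s, t)).Adj v w ↔
      ReflTransGen G.Adj v w ∨ ReflTransGen G.Adj v s ∧ ReflTransGen G.Adj t w := by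
  have hmono : ∀ x y, ReflTransGen G.Adj x y → ReflTransGen (addEdge G (s, t)).Adj x y :=
    fun x y => ReflTransGen.mono (fun _ _ h => Or.inl h) x y
  constructor
  · intro hvw
    induction hvw with
    | refl => exact Or.inl .refl
    | tail _ hxy ih =>
      rcases hxy with hxy | hxy
      · exact ih.imp (fun h => h.tail hxy) (fun h => ⟨h.1, h.2.tail hxy⟩)
      · obtain ⟨rfl, rfl⟩ := Prod.mk.inj hxy
        rcases ih with ih | ih
        · exact Or.inr ⟨ih, .refl⟩
        · exact absurd (hmono _ _ ih.2) (h.not_reach (Or.inr rfl))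
  · rintro (h | h)
    · exact hmono _ _ h
    · exact (hmono _ _ h.1).trans (.head (Or.inr rfl) (hmono _ _ h.2))

variable [Fintype V]

@[simp] theorem mem_reachSet {G : Digraph V} {v w : V} :
    w ∈ reachSet G v ↔ ReflTransGen G.Adj v w := by simp [reachSet]

@[simp] theorem mem_coreachSet {G : Digraph V} {s v : V} :
    v ∈ coreachSet G s ↔ ReflTransGen G.Adj v s := by simp [coreachSet]

/-- Once a path has left the set of vertices that reach `s`, it never returns. So the boundaries are
the vertices that reach `s` and have an edge to a vertex that does not, but reaches the
descendants of `t`. -/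
theorem mem_boundarySet {G : Digraph V} {s t b : V} (hts : ¬ ReflTransGen G.Adj t s) :
    b ∈ boundarySet G s t ↔ ReflTransGen G.Adj b s ∧ ∃ w, G.Adj b w ∧ ¬ ReflTransGen G.Adj w s ∧
      ∃ c, ReflTransGen G.Adj t c ∧ ReflTransGen G.Adj w c := by
  classical
  simp only [boundarySet, Finset.mem_filter, Finset.mem_univ, true_and, mem_coreachSet,
    mem_reachSet]
  refine and_congr_right fun _ => ?_
  constructor
  · rintro ⟨p, c, hc, hch, hp⟩
    have hcs : ¬ ReflTransGen G.Adj c s := fun h => hts (hc.trans h)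
    cases p with
    | nil => exact ⟨c, by simpa using hch, hcs, c, hc, .refl⟩
    | cons w p =>
      rw [List.cons_append, List.isChain_cons_cons] at hch
      refine ⟨w, hch.1, hp w (by simp), c, hc, ?_⟩
      have := hch.2
      rw [← List.cons_append] at this
      have h := List.relationReflTransGen_of_exists_isChain_cons (p ++ [c]) (by simpa using this)
        (by rfl)
      simpa using h
  · rintro ⟨w, hbw, hws, c, hc, hwc⟩
    obtain ⟨l, hl, hlast⟩ := List.exists_isChain_cons_of_relationReflTransGen hwc
    refine ⟨(w :: l).dropLast, c, hc, ?_, ?_⟩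
    · have : (w :: l).dropLast ++ [c] = w :: l := by
        rw [← hlast]; exact List.dropLast_append_getLast _
      rw [this]
      exact List.isChain_cons_cons.2 ⟨hbw, hl⟩
    · intro x hx hxs
      have hx := List.mem_of_mem_dropLast hx
      have hwx : ReflTransGen G.Adj w x := by
        have := List.IsChain.induction (p := fun y => ReflTransGen G.Adj w y) (w :: l) hl
          (fun _ _ h h' => h'.tail h) (fun _ => by simpa using ReflTransGen.refl)
        exact this x hx
      exact hws (hwx.trans hxs)

/-- The vertices that `v` gains from the edge `(s, t)`: a path from `v` to a descendant of `t`
leaves the set of vertices that reach `s` at a boundary. -/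
theorem reach_iff_exists_mark {G : Digraph V} {s t v x : V} (hts : ¬ ReflTransGen G.Adj t s)
    (hv : ReflTransGen G.Adj v s) (hx : ReflTransGen G.Adj t x) :
    ReflTransGen G.Adj v x ↔ ∃ b ∈ mark G s t v, ReflTransGen G.Adj b x := by
  classical
  constructor
  · intro hvx
    induction hvx using ReflTransGen.head_induction_on with
    | refl => exact absurd (hx.trans hv) hts
    | @head v w hvw hwx ih =>
      by_cases hw : ReflTransGen G.Adj w s
      · obtain ⟨b, hb, hbx⟩ := ih hw
        simp only [mark, Finset.mem_filter] at hb ⊢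
        exact ⟨b, ⟨hb.1, .head hvw hb.2⟩, hbx⟩
      · refine ⟨v, ?_, .head hvw hwx⟩
        simp only [mark, Finset.mem_filter]
        exact ⟨(mem_boundarySet hts).2 ⟨hv, w, hvw, hw, x, hx, hwx⟩, .refl⟩
  · rintro ⟨b, hb, hbx⟩
    simp only [mark, Finset.mem_filter] at hb
    exact hb.2.trans hbx

/-- A round is correct: the vertices that `v` gains are disjoint from those that it reached
before. -/
theorem updateReach_weightedReach {G : Digraph V} {e : V × V} (a : V → ℝ)
    (h : IsAcyclic (addEdge G e)) :
    updateReach G a e (weightedReach G a) = weightedReach (addEdge G e) a := by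
  classical
  obtain ⟨s, t⟩ := e
  have hts : ¬ ReflTransGen G.Adj t s := fun hts =>
    h.not_reach (Or.inr rfl) (ReflTransGen.mono (fun _ _ h => Or.inl h) _ _ hts)
  funext v
  simp only [updateReach, mem_coreachSet]
  split_ifs with hv
  · have h1 : reachSet (addEdge G (s, t)) v = reachSet G v ∪
        (reachSet G t \ (mark G s t v).biUnion (reachSet G)) := by
      ext x
      simp only [mem_reachSet, reach_addEdge_iff h, Finset.mem_union, Finset.mem_sdiff,
        Finset.mem_biUnion, hv, true_and]
      by_cases hx : ReflTransGen G.Adj t x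
      · have := reach_iff_exists_mark hts hv hx
        tauto
      · tauto
    rw [weightedReach, weightedReach, h1, Finset.sum_union, gain]
    rw [Finset.disjoint_left]
    intro x hx hx'
    simp only [mem_reachSet, Finset.mem_sdiff, Finset.mem_biUnion] at hx hx'
    exact hx'.2 ((reach_iff_exists_mark hts hv hx'.1).1 hx)
  · rw [weightedReach, weightedReach]
    congr 1
    ext x
    simp only [mem_reachSet, reach_addEdge_iff h, hv, false_and, or_false]

/-- The rounds maintain that `r` contains the weighted reachability numbers of the current
digraph. -/
theorem rounds_weightedReach {G : Digraph V} (a : V → ℝ) (hG : IsAcyclic G) (F : List (V × V)) :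
    ∀ T : Digraph V, T ≤ G → (∀ e ∈ F, G.Adj e.1 e.2) →
      (∀ u v, G.Adj u v → T.Adj u v ∨ (u, v) ∈ F) →
      rounds a F T (weightedReach T a) = weightedReach G a := by
  induction F with
  | nil =>
    intro T hT _ h
    have : T = G := le_antisymm hT fun u v huv => by simpa using h u v huv
    rw [rounds, this]
  | cons e F ih =>
    intro T hT hF h
    have hle : addEdge T e ≤ G := by
      rintro u v (huv | huv)
      · exact hT huv
      · have := hF e (by simp)
        rwa [← huv] at this
    rw [rounds, updateReach_weightedReach a (hG.mono hle)]
    refine ih _ hle (fun e he => hF e (by simp [he])) fun u v huv => ?_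
    rcases h u v huv with h | h
    · exact Or.inl (Or.inl h)
    · rcases List.mem_cons.1 h with h | h
      · exact Or.inl (Or.inr h)
      · exact Or.inr h

/-- The recursion formula of Algorithm 1. -/
theorem weightedReach_eq_add_sum {T : Digraph V} (a : V → ℝ) (hT : IsAcyclic T)
    (hdis : ∀ v w w' x, T.Adj v w → T.Adj v w' → ReflTransGen T.Adj w x →
      ReflTransGen T.Adj w' x → w = w') (v : V) (N : Finset V) (hN : ∀ w, w ∈ N ↔ T.Adj v w) :
    weightedReach T a v = a v + ∑ w ∈ N, weightedReach T a w := by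
  classical
  have h1 : reachSet T v = insert v (N.biUnion (reachSet T)) := by
    ext x
    simp only [mem_reachSet, Finset.mem_insert, Finset.mem_biUnion, hN]
    constructor
    · intro h
      rcases ReflTransGen.cases_head h with h | ⟨w, h1, h2⟩
      · exact Or.inl h.symm
      · exact Or.inr ⟨w, h1, h2⟩
    · rintro (rfl | ⟨w, h1, h2⟩)
      · exact .refl
      · exact .head h1 h2
  rw [weightedReach, h1, Finset.sum_insert, Finset.sum_biUnion]
  · rfl
  · intro w hw w' hw' hne
    refine Finset.disjoint_left.2 fun x hx hx' => hne ?_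
    exact hdis v w w' x ((hN w).1 hw) ((hN w').1 hw') (mem_reachSet.1 hx) (mem_reachSet.1 hx')
  · simp only [Finset.mem_biUnion, mem_reachSet, not_exists, not_and, hN]
    exact fun w hw => hT.not_reach hw

theorem IsPolyforest.eq_of_reach {T : Digraph V} (hT : IsAcyclic T) (h : IsPolyforest T)
    (v w w' x : V) (hw : T.Adj v w) (hw' : T.Adj v w') (hx : ReflTransGen T.Adj w x)
    (hx' : ReflTransGen T.Adj w' x) : w = w' := by
  classical
  have hrel : EdgeRel {e : V × V | T.Adj e.1 e.2} Prod.fst Prod.snd = T.Adj := by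
    funext u v
    simp [EdgeRel]
  have := (h.sparse hT).eq_of_reach (e := (v, w)) (e' := (v, w')) (x := x)
    (by rw [hrel]; exact hT) (by simpa using hw) (by simpa using hw') rfl
    (by rw [hrel]; exact hx) (by rw [hrel]; exact hx')
  exact (Prod.mk.inj this).2

/-- Algorithm 1 is correct for every topological order. -/
theorem polyforestReach_eq_weightedReach {T : Digraph V} (a : V → ℝ) (hT : IsAcyclic T)
    (h : IsPolyforest T) {order : List V} (ho : IsTopologicalOrder T order) :
    polyforestReach T a order = weightedReach T a := by
  classical
  obtain ⟨hnd, hmem, hpw⟩ := ho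
  -- generalized to the final segments of the order, which are closed under successors
  suffices H : ∀ l : List V, l.Nodup → l.Pairwise (fun u v => ¬ T.Adj v u) →
      (∀ v ∈ l, ∀ w, T.Adj v w → w ∈ l) → ∀ v ∈ l, polyforestReach T a l v = weightedReach T a v by
    funext v
    exact H order hnd hpw (fun _ _ w _ => hmem w) v (hmem v)
  intro l
  induction l with
  | nil => simp
  | cons u l ih =>
    intro hnd hpw hcl v hv
    rw [List.nodup_cons] at hnd
    rw [List.pairwise_cons] at hpw
    have hcl' : ∀ v ∈ l, ∀ w, T.Adj v w → w ∈ l := by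
      intro v hv w hvw
      rcases List.mem_cons.1 (hcl v (by simp [hv]) w hvw) with h | h
      · exact absurd (h ▸ hvw) (hpw.1 v hv)
      · exact h
    have ih := ih hnd.2 hpw.2 hcl'
    simp only [polyforestReach, List.foldr_cons] at ih ⊢
    by_cases hvu : v = u
    · subst hvu
      rw [Function.update_self, weightedReach_eq_add_sum a hT (h.eq_of_reach hT) v
        {w | T.Adj v w} (by simp)]
      congr 1
      refine Finset.sum_congr rfl fun w hw => ih w ?_
      have hw := (Finset.mem_filter.1 hw).2
      rcases List.mem_cons.1 (hcl v (by simp) w hw) with h | h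
      · exact absurd h.symm (hT.ne hw)
      · exact h
    · rw [Function.update_of_ne hvu]
      exact ih v ((List.mem_cons.1 hv).resolve_left hvu)

theorem exists_isTopologicalOrder {T : Digraph V} (hT : IsAcyclic T) :
    ∃ order, IsTopologicalOrder T order := by
  classical
  -- the number of reachable vertices decreases along every edge
  let le : V → V → Prop := fun u v => (reachSet T v).card ≤ (reachSet T u).card
  have : Std.Total le := ⟨fun u v => le_total _ _⟩
  have : IsTrans V le := ⟨fun u v w h1 h2 => le_trans h2 h1⟩
  refine ⟨(Finset.univ : Finset V).toList.insertionSort le, ?_, ?_, ?_⟩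
  · exact ((List.perm_insertionSort _ _).nodup_iff).2 (Finset.nodup_toList _)
  · intro v
    exact ((List.perm_insertionSort _ _).mem_iff).2 (by simp)
  · refine (List.pairwise_insertionSort le _).imp fun {u v} huv hvu => ?_
    refine absurd huv (not_le.2 (Finset.card_lt_card ?_))
    refine Finset.ssubset_iff_subset_ne.2 ⟨fun x hx => ?_, fun h => ?_⟩
    · exact mem_reachSet.2 (.head hvu (mem_reachSet.1 hx))
    · have : v ∈ reachSet T u := h ▸ mem_reachSet.2 .refl
      exact hT.not_reach hvu (mem_reachSet.1 this)

/-- The feedback edge number is attained. -/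
theorem exists_card_eq_feedbackEdgeNumber (G : Digraph V) :
    ∃ F : Finset (V × V), (∀ e ∈ F, G.Adj e.1 e.2) ∧ IsPolyforest (deleteEdges G F) ∧
      F.card = feedbackEdgeNumber G := by
  classical
  refine Nat.sInf_mem (s := {k | ∃ F : Finset (V × V), (∀ e ∈ F, G.Adj e.1 e.2) ∧
    IsPolyforest (deleteEdges G F) ∧ F.card = k})
    ⟨_, Finset.univ.filter fun e : V × V => G.Adj e.1 e.2, by simp, ?_, rfl⟩
  have : (deleteEdges G (Finset.univ.filter fun e : V × V => G.Adj e.1 e.2)).toSimpleGraphInclusive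
      = ⊥ := by
    ext u v
    simp [Digraph.toSimpleGraphInclusive, deleteEdges]
  rw [IsPolyforest, this]
  exact SimpleGraph.isAcyclic_bot

theorem isAlgorithm2Result_iff {G : Digraph V} (a : V → ℝ) (hG : IsAcyclic G) (r : V → ℝ) :
    IsAlgorithm2Result G a r ↔ r = fun v => weightedReach G a v := by
  classical
  have key : ∀ {T : Digraph V} {order : List V} {F : List (V × V)}, T ≤ G → IsPolyforest T →
      IsTopologicalOrder T order → (∀ u v, (u, v) ∈ F ↔ G.Adj u v ∧ ¬ T.Adj u v) →
      rounds a F T (polyforestReach T a order) = weightedReach G a := by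
    intro T order F hT hpf ho hF
    rw [polyforestReach_eq_weightedReach a (hG.mono hT) hpf ho]
    refine rounds_weightedReach a hG F T hT (fun e he => ((hF _ _).1 he).1) fun u v huv => ?_
    rw [hF]
    tauto
  constructor
  · rintro ⟨T, hT, hpf, order, ho, F, -, -, hF, rfl⟩
    exact key hT hpf ho hF
  · rintro rfl
    obtain ⟨F, hF, hpf, hcard⟩ := exists_card_eq_feedbackEdgeNumber G
    obtain ⟨order, ho⟩ := exists_isTopologicalOrder (hG.mono (deleteEdges_le G F))
    have hF' : ∀ u v, (u, v) ∈ F.toList ↔ G.Adj u v ∧ ¬ (deleteEdges G F).Adj u v := by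
      intro u v
      simp only [Finset.mem_toList, deleteEdges, not_and, not_not]
      exact ⟨fun h => ⟨hF _ h, fun _ => h⟩, fun h => h.2 h.1⟩
    exact ⟨_, deleteEdges_le G F, hpf, order, ho, F.toList, F.nodup_toList,
      by rw [Finset.length_toList, hcard], hF', (key (deleteEdges_le G F) hpf ho hF').symm⟩

end Pseudocode

end DescendantCounting

namespace DescendantCounting

/-! ### A program logic for the machine -/

/-- Contents of the words. -/
abbrev Words := WAddr → ℕ

/-- Contents of the weights. -/
abbrev Weights := AAddr → ℝ

instance : Fintype W where
  elems := {.n, .m, .src, .dst, .hOut, .nxtOut, .degOut, .hIn, .nxtIn, .degIn, .inT, .rev, .nRev,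
    .vis, .queue, .head, .tail, .cnt, .setU, .setD, .bd, .nB, .markOf, .reachOf, .child, .has,
    .leaf, .nNode, .node, .bit, .cov, .zero, .one, .i, .j, .k, .e, .s, .t, .b, .u, .v, .w, .x, .cur}
  complete x := by cases x <;> decide

instance : Fintype A where
  elems := {.a, .r, .gval}
  complete x := by cases x <;> decide

/-- The cells that the program may use: all scalars and array entries with index at most `L`,
matrices of marks with `F` rows and `n` columns, and a trie with `L` nodes. -/
def allowed (L F n : ℕ) : Finset Cell :=
  (Finset.univ ×ˢ Finset.range (L + 1) ×ˢ {0} ∪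
    ({.markOf, .reachOf} ×ˢ Finset.range F ×ˢ Finset.range n ∪
      {.child} ×ˢ Finset.range 2 ×ˢ Finset.range (L + 1))).disjSum
  (Finset.univ ×ˢ Finset.range (L + 1) ×ˢ {0})

theorem card_allowed_le (L F n : ℕ) : (allowed L F n).card ≤ 50 * (L + 1) + 2 * (F * n) := by
  have h1 : Fintype.card W = 45 := rfl
  have h2 : Fintype.card A = 3 := rfl
  have h3 : ({W.markOf, W.reachOf} : Finset W).card = 2 := rfl
  rw [allowed, Finset.card_disjSum]
  have h4 := Finset.card_union_le ((Finset.univ : Finset W) ×ˢ Finset.range (L + 1) ×ˢ {0})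
    (({.markOf, .reachOf} : Finset W) ×ˢ Finset.range F ×ˢ Finset.range n ∪
      ({.child} : Finset W) ×ˢ Finset.range 2 ×ˢ Finset.range (L + 1))
  have h5 := Finset.card_union_le
    (({.markOf, .reachOf} : Finset W) ×ˢ Finset.range F ×ˢ Finset.range n)
    (({.child} : Finset W) ×ˢ Finset.range 2 ×ˢ Finset.range (L + 1))
  simp only [Finset.card_product, Finset.card_range, Finset.card_univ, Finset.card_singleton, h1,
    h2, h3] at h4 h5 ⊢
  omega

section Cells

variable {L F n : ℕ}

@[simp] theorem inl_mem_allowed {x : W} {i j : ℕ} : (.inl (x, i, j) : Cell) ∈ allowed L F n ↔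
    i ≤ L ∧ j = 0 ∨ (x = .markOf ∨ x = .reachOf) ∧ i < F ∧ j < n ∨ x = .child ∧ i < 2 ∧ j ≤ L := by
  simp only [allowed, Finset.inl_mem_disjSum, Finset.mem_union, Finset.mem_product,
    Finset.mem_univ, Finset.mem_range, Finset.mem_singleton, Finset.mem_insert,
    Order.lt_add_one_iff, true_and]

@[simp] theorem inr_mem_allowed {x : A} {i j : ℕ} : (.inr (x, i, j) : Cell) ∈ allowed L F n ↔
    i ≤ L ∧ j = 0 := by
  simp only [allowed, Finset.inr_mem_disjSum, Finset.mem_product, Finset.mem_univ,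
    Finset.mem_range, Finset.mem_singleton, Order.lt_add_one_iff, true_and]

end Cells

attribute [simp] Ref.addr Ref.indexCells Ref.wordCells Ref.weightCells WExpr.eval WExpr.cells
  AExpr.eval AExpr.cells Cond.holds Cond.cells Finset.insert_subset_iff Finset.union_subset_iff

section Exec

/-- Add to the time and to the used cells of a state. -/
def State.shift (t : ℕ) (C : Finset Cell) (σ : State ℝ) : State ℝ :=
  { σ with time := t + σ.time, used := C ∪ σ.used }

theorem State.shift_charge (t : ℕ) (C D : Finset Cell) (σ : State ℝ) :
    (σ.shift t C).charge D = (σ.charge D).shift t C := by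
  simp [State.shift, State.charge, add_assoc, Finset.union_assoc]

theorem iterate_shift {c : Cond} {S : State ℝ → State ℝ}
    (hS : ∀ t C σ, S (State.shift t C σ) = (S σ).shift t C) (k t : ℕ) (C : Finset Cell) :
    ∀ σ, iterate c S k (State.shift t C σ) = (iterate c S k σ).shift t C := by
  induction k with
  | zero => intro σ; rfl
  | succ k ih =>
    intro σ
    have : (State.shift t C σ).word = σ.word := rfl
    simp only [iterate, this, State.shift_charge, hS, ih]
    split_ifs <;> rfl

/-- Execution does not depend on the time and the cells used before. -/
theorem Stmt.exec_shift (S : Stmt) :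
    ∀ t C, ∀ σ : State ℝ, S.exec (σ.shift t C) = (S.exec σ).shift t C := by
  induction S with
  | skip => intro t C σ; exact State.shift_charge t C ∅ σ
  | setW x p =>
    intro t C σ
    simp [Stmt.exec, State.shift, State.charge, add_assoc, Finset.union_assoc]
  | setA x p =>
    intro t C σ
    simp [Stmt.exec, State.shift, State.charge, add_assoc, Finset.union_assoc]
  | seq S S' h h' => intro t C σ; simp only [Stmt.exec, h, h']
  | ite c S S' h h' =>
    intro t C σ
    have : (State.shift t C σ).word = σ.word := rfl
    simp only [Stmt.exec, this, State.shift_charge, h, h']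
    split_ifs <;> rfl
  | loop p c S h =>
    intro t C σ
    have : (State.shift t C σ).word = σ.word := rfl
    simp only [Stmt.exec, this, State.shift_charge, iterate_shift h]

/-- `WP M S f g Q`: run from the memory contents `f`, `g`, the statement `S` uses only cells in
`M`, and `Q` holds for the time that it takes and for the memory contents at its end. -/
def WP (M : Finset Cell) (S : Stmt) (f : Words) (g : Weights)
    (Q : ℕ → Words → Weights → Prop) : Prop :=
  (S.exec ⟨f, g, 0, ∅⟩).used ⊆ M ∧
    Q (S.exec ⟨f, g, 0, ∅⟩).time (S.exec ⟨f, g, 0, ∅⟩).word (S.exec ⟨f, g, 0, ∅⟩).weight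

variable {M : Finset Cell} {S S' : Stmt} {f : Words} {g : Weights}
  {Q : ℕ → Words → Weights → Prop}

/-- Every execution can be computed from the one that starts with time `0` and no used cells. -/
theorem exec_eq_shift (S : Stmt) (σ : State ℝ) :
    S.exec σ = (S.exec ⟨σ.word, σ.weight, 0, ∅⟩).shift σ.time σ.used := by
  rw [← Stmt.exec_shift]
  congr 1
  simp [State.shift]

theorem WP.mono {Q' : ℕ → Words → Weights → Prop} (h : WP M S f g Q)
    (hQ : ∀ t f g, Q t f g → Q' t f g) : WP M S f g Q' := ⟨h.1, hQ _ _ _ h.2⟩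

@[simp] theorem wp_skip : WP M .skip f g Q ↔ Q 1 f g := by
  simp [WP, Stmt.exec, State.charge]

@[simp] theorem wp_setW {x : Ref W} {p : WExpr} : WP M (.setW x p) f g Q ↔
    x.wordCells f ∪ p.cells f ⊆ M ∧ Q 1 (Function.update f (x.addr f) (p.eval f)) g := by
  simp [WP, Stmt.exec, State.charge]

@[simp] theorem wp_setA {x : Ref A} {p : AExpr} : WP M (.setA x p) f g Q ↔
    x.weightCells f ∪ p.cells f ⊆ M ∧ Q 1 f (Function.update g (x.addr f) (p.eval f g)) := by
  simp [WP, Stmt.exec, State.charge]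

theorem wp_seq : WP M (.seq S S') f g Q ↔
    WP M S f g fun t f' g' => WP M S' f' g' fun t' => Q (t + t') := by
  simp only [WP, Stmt.exec]
  rw [exec_eq_shift S']
  simp [State.shift, and_assoc]

theorem wp_charge {C : Finset Cell} : ((S.exec (State.charge ⟨f, g, 0, ∅⟩ C)).used ⊆ M ∧
    Q (S.exec (State.charge ⟨f, g, 0, ∅⟩ C)).time (S.exec (State.charge ⟨f, g, 0, ∅⟩ C)).word
      (S.exec (State.charge ⟨f, g, 0, ∅⟩ C)).weight) ↔
    C ⊆ M ∧ WP M S f g fun t => Q (1 + t) := by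
  rw [exec_eq_shift S]
  simp [State.shift, State.charge, WP, and_assoc]

@[simp] theorem wp_ite {c : Cond} : WP M (.ite c S S') f g Q ↔ c.cells f ⊆ M ∧
    if c.holds f then WP M S f g fun t => Q (1 + t) else WP M S' f g fun t => Q (1 + t) := by
  unfold WP
  simp only [Stmt.exec]
  split_ifs
  · exact wp_charge
  · exact wp_charge

@[simp] theorem wp_block_nil : WP M (block []) f g Q ↔ Q 1 f g := wp_skip

@[simp] theorem wp_block_cons {l : List Stmt} : WP M (block (S :: l)) f g Q ↔
    WP M S f g fun t f' g' => WP M (block l) f' g' fun t' => Q (t + t') := wp_seq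

end Exec

section Frame

/-- The name in a reference. -/
def Ref.name {N : Type} : Ref N → N
  | .var x => x
  | .arr x _ => x
  | .mat x _ _ => x

/-- Whether a statement assigns to words with the name `y`. -/
def Stmt.writes (y : W) : Stmt → Bool
  | .skip => false
  | .setW x _ => x.name = y
  | .setA _ _ => false
  | .seq S S' => S.writes y || S'.writes y
  | .ite _ S S' => S.writes y || S'.writes y
  | .loop _ _ S => S.writes y

/-- Whether a statement assigns to weights with the name `y`. -/
def Stmt.writesA (y : A) : Stmt → Bool
  | .skip => false
  | .setW _ _ => false
  | .setA x _ => x.name = y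
  | .seq S S' => S.writesA y || S'.writesA y
  | .ite _ S S' => S.writesA y || S'.writesA y
  | .loop _ _ S => S.writesA y

/-- The memory contents differ at most under names to which `S` assigns. -/
structure Frame (S : Stmt) (f : Words) (g : Weights) (f' : Words) (g' : Weights) : Prop where
  word : ∀ y, S.writes y = false → ∀ i j, f' (y, i, j) = f (y, i, j)
  weight : ∀ y, S.writesA y = false → ∀ i j, g' (y, i, j) = g (y, i, j)

theorem Frame.refl (S : Stmt) (f : Words) (g : Weights) : Frame S f g f g :=
  ⟨fun _ _ _ _ => rfl, fun _ _ _ _ => rfl⟩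

theorem Frame.trans {S : Stmt} {f f' f'' : Words} {g g' g'' : Weights} (h : Frame S f g f' g')
    (h' : Frame S f' g' f'' g'') : Frame S f g f'' g'' :=
  ⟨fun y hy i j => (h'.word y hy i j).trans (h.word y hy i j),
    fun y hy i j => (h'.weight y hy i j).trans (h.weight y hy i j)⟩

theorem Frame.mono {S S' : Stmt} {f f' : Words} {g g' : Weights} (h : Frame S f g f' g')
    (hw : ∀ y, S'.writes y = false → S.writes y = false)
    (ha : ∀ y, S'.writesA y = false → S.writesA y = false) : Frame S' f g f' g' :=
  ⟨fun y hy => h.word y (hw y hy), fun y hy => h.weight y (ha y hy)⟩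

theorem Ref.addr_fst {N : Type} (f : Words) (x : Ref N) : (x.addr f).1 = x.name := by
  cases x <;> rfl

theorem Stmt.frame (S : Stmt) : ∀ σ : State ℝ,
    Frame S σ.word σ.weight (S.exec σ).word (S.exec σ).weight := by
  induction S with
  | skip => intro σ; exact .refl _ _ _
  | setW x p =>
    intro σ
    refine ⟨fun y hy i j => ?_, fun _ _ _ _ => rfl⟩
    refine Function.update_of_ne (fun h => ?_) _ _
    have : y = x.name := by rw [← Ref.addr_fst σ.word x, ← h]
    simp [Stmt.writes, this] at hy
  | setA x p =>
    intro σ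
    refine ⟨fun _ _ _ _ => rfl, fun y hy i j => ?_⟩
    refine Function.update_of_ne (fun h => ?_) _ _
    have : y = x.name := by rw [← Ref.addr_fst σ.word x, ← h]
    simp [Stmt.writesA, this] at hy
  | seq S S' h h' =>
    intro σ
    refine Frame.trans ((h σ).mono ?_ ?_) ((h' (S.exec σ)).mono ?_ ?_) <;>
      simp +contextual [Stmt.writes, Stmt.writesA]
  | ite c S S' h h' =>
    intro σ
    simp only [Stmt.exec]
    split_ifs
    · refine (h (σ.charge _)).mono ?_ ?_ <;> simp +contextual [Stmt.writes, Stmt.writesA]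
    · refine (h' (σ.charge _)).mono ?_ ?_ <;> simp +contextual [Stmt.writes, Stmt.writesA]
  | loop p c S h =>
    intro σ
    have : ∀ k, ∀ σ : State ℝ, Frame (.loop p c S) σ.word σ.weight
        (iterate c S.exec k σ).word (iterate c S.exec k σ).weight := by
      intro k
      induction k with
      | zero => intro σ; exact .refl _ _ _
      | succ k ih =>
        intro σ
        simp only [iterate]
        split_ifs
        · refine Frame.trans (Frame.mono (h (σ.charge _)) ?_ ?_) (ih _) <;>
            simp +contextual [Stmt.writes, Stmt.writesA]
        · exact .refl _ _ _
    exact this _ (σ.charge _)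

variable {M : Finset Cell} {S S' : Stmt} {f : Words} {g : Weights}
  {Q : ℕ → Words → Weights → Prop}

theorem WP.frame (h : WP M S f g Q) :
    WP M S f g fun t f' g' => Frame S f g f' g' ∧ Q t f' g' :=
  ⟨h.1, S.frame ⟨f, g, 0, ∅⟩, h.2⟩

/-- Sequential composition, with the frame of the first statement. -/
theorem WP.cons {l : List Stmt} {Q' : ℕ → Words → Weights → Prop} (h : WP M S f g Q')
    (h' : ∀ t f' g', Frame S f g f' g' → Q' t f' g' →
      WP M (block l) f' g' fun t' => Q (t + t')) : WP M (block (S :: l)) f g Q :=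
  wp_block_cons.2 (h.frame.mono fun t f' g' hQ => h' t f' g' hQ.1 hQ.2)

end Frame

section Loops

variable {M : Finset Cell} {S : Stmt} {f : Words} {g : Weights} {Q : ℕ → Words → Weights → Prop}

/-- The invariant `I` has as arguments the number of iterations that have been made and the time. -/
theorem wp_iterate {c : Cond} {K : ℕ} (I : ℕ → ℕ → Words → Weights → Prop)
    (hc : ∀ j t f' g', I j t f' g' → c.cells f' ⊆ M)
    (step : ∀ j < K, ∀ t f' g', I j t f' g' → c.holds f' →
      WP M S f' g' fun t' f'' g'' => I (j + 1) (t + t' + 1) f'' g'')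
    (post : ∀ j t f' g', I j t f' g' → (j = K → Q t f' g') ∧ (¬ c.holds f' → Q (t + 1) f' g')) :
    ∀ k j, j + k = K → ∀ σ : State ℝ, σ.used ⊆ M → I j σ.time σ.word σ.weight →
      (iterate c S.exec k σ).used ⊆ M ∧ Q (iterate c S.exec k σ).time (iterate c S.exec k σ).word
        (iterate c S.exec k σ).weight := by
  intro k
  induction k with
  | zero =>
    intro j hj σ hσ hI
    exact ⟨hσ, (post j _ _ _ hI).1 hj⟩
  | succ k ih =>
    intro j hj σ hσ hI
    simp only [iterate]
    split_ifs with h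
    · have hw := step j (by omega) _ _ _ hI h
      rw [exec_eq_shift S]
      refine ih (j + 1) (by omega) _ ?_ ?_
      · simp only [State.shift, State.charge, Finset.union_subset_iff]
        exact ⟨⟨hσ, hc _ _ _ _ hI⟩, hw.1⟩
      · have := hw.2
        simp only [State.shift, State.charge]
        rwa [add_right_comm]
    · refine ⟨?_, (post j _ _ _ hI).2 (by simpa using h)⟩
      simp only [State.charge, Finset.union_subset_iff]
      exact ⟨hσ, hc _ _ _ _ hI⟩

/-- The rule for loops: `I j t` holds after `j` iterations and `t` steps. -/
theorem wp_loop {p : WExpr} {c : Cond} (I : ℕ → ℕ → Words → Weights → Prop)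
    (hp : p.cells f ⊆ M) (h0 : I 0 1 f g)
    (hc : ∀ j t f' g', Frame S f g f' g' → I j t f' g' → c.cells f' ⊆ M)
    (step : ∀ j < p.eval f, ∀ t f' g', Frame S f g f' g' → I j t f' g' → c.holds f' →
      WP M S f' g' fun t' f'' g'' => I (j + 1) (t + t' + 1) f'' g'')
    (post : ∀ j t f' g', Frame S f g f' g' → I j t f' g' →
      (j = p.eval f → Q t f' g') ∧ (¬ c.holds f' → Q (t + 1) f' g')) :
    WP M (.loop p c S) f g Q := by
  refine wp_iterate (fun j t f' g' => Frame S f g f' g' ∧ I j t f' g')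
    (fun j t f' g' h => hc j t f' g' h.1 h.2) ?_ (fun j t f' g' h => post j t f' g' h.1 h.2)
    (p.eval f) 0 (zero_add _) _ ?_ ?_
  · intro j hj t f' g' h hh
    exact (step j hj t f' g' h.1 h.2 hh).frame.mono fun _ _ _ h' => ⟨h.1.trans h'.1, h'.2⟩
  · simpa [State.charge] using hp
  · exact ⟨.refl _ _ _, h0⟩

/-- The rule for `forUp`: `I j t` holds after `j` iterations, in which `t` steps were made. -/
theorem wp_forUp {x y : W} {L F n k : ℕ} (I : ℕ → ℕ → Words → Weights → Prop)
    (hx : S.writes x = false) (hxy : y ≠ x) (hk : f (y, 0, 0) = k) (h0 : I 0 0 f g)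
    (hI : ∀ j t f' g' v, I j t f' g' → I j t (Function.update f' (x, 0, 0) v) g')
    (step : ∀ j < k, ∀ t f' g', Frame (forUp x (val y) S) f g f' g' → f' (x, 0, 0) = j →
      I j t f' g' → WP (allowed L F n) S f' g' fun t' f'' g'' => I (j + 1) (t + t' + 3) f'' g'')
    (post : ∀ t f' g', Frame (forUp x (val y) S) f g f' g' → I k t f' g' → Q (t + 3) f' g') :
    WP (allowed L F n) (forUp x (val y) S) f g Q := by
  let f0 := Function.update f (x, 0, 0) 0
  have hf0 : Frame (forUp x (val y) S) f g f0 g := by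
    refine ⟨fun z hz i j => Function.update_of_ne (fun h => ?_) _ _, fun _ _ _ _ => rfl⟩
    have : x = z := (congrArg Prod.fst h).symm
    simp [forUp, block, Stmt.writes, Ref.name, this] at hz
  have hmono : ∀ f' g', Frame (block [S, incr x]) f0 g f' g' →
      Frame (forUp x (val y) S) f g f' g' := by
    intro f' g' h
    refine hf0.trans (h.mono ?_ ?_) <;>
      simp +contextual [forUp, block, Stmt.writes, Stmt.writesA]
  have hk0 : (val y).eval f0 = k := by simp [f0, hxy, hk]
  rw [forUp, wp_block_cons, wp_setW]
  refine ⟨by simp, ?_⟩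
  rw [wp_block_cons]
  refine wp_loop (fun j t f' g' => 1 ≤ t ∧ f' (x, 0, 0) = j ∧ I j (t - 1) f' g') (by simp)
    ⟨le_rfl, by simp, hI _ _ _ _ _ h0⟩ (by simp) ?_ ?_
  · rintro j hj t f' g' hfr ⟨ht, hj', hI'⟩ -
    rw [wp_block_cons]
    have hstep := (step j (by rwa [← hk0]) (t - 1) f' g' (hmono _ _ hfr) hj' hI').frame
    refine hstep.mono ?_
    rintro t' f'' g'' ⟨hfr', h''⟩
    simp only [wp_block_cons, wp_setW, wp_block_nil]
    refine ⟨by simp, by omega, by simp [hfr'.word x hx, hj'], ?_⟩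
    have e : t + (t' + (1 + 1)) + 1 - 1 = t - 1 + t' + 3 := by omega
    rw [e]
    exact hI _ _ _ _ _ h''
  · rintro j t f' g' hfr ⟨ht, -, hI'⟩
    refine ⟨fun hj => ?_, by simp⟩
    rw [wp_block_nil]
    have e : 1 + (t + 1) = t - 1 + 3 := by omega
    rw [e]
    exact post _ _ _ (hmono _ _ hfr) (hk0 ▸ hj ▸ hI')

/-- The rule for `forUp` with a body that runs in constant time. -/
theorem wp_forUp_const {x y : W} {L F n k : ℕ} (c : ℕ) (I : ℕ → Words → Weights → Prop)
    (hx : S.writes x = false) (hxy : y ≠ x) (hk : f (y, 0, 0) = k) (h0 : I 0 f g)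
    (hI : ∀ j f' g' v, I j f' g' → I j (Function.update f' (x, 0, 0) v) g')
    (step : ∀ j < k, ∀ f' g', Frame (forUp x (val y) S) f g f' g' → f' (x, 0, 0) = j →
      I j f' g' → WP (allowed L F n) S f' g' fun t' f'' g'' => t' ≤ c ∧ I (j + 1) f'' g'')
    (post : ∀ t f' g', Frame (forUp x (val y) S) f g f' g' → t ≤ k * (c + 3) + 3 → I k f' g' →
      Q t f' g') :
    WP (allowed L F n) (forUp x (val y) S) f g Q := by
  refine wp_forUp (k := k) (fun j t f' g' => t ≤ j * (c + 3) ∧ I j f' g') hx hxy hk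
    ⟨by simp, h0⟩ (fun j t f' g' v h => ⟨h.1, hI _ _ _ _ h.2⟩) ?_ ?_
  · rintro j hj t f' g' hfr hx' ⟨ht, hI'⟩
    refine (step j hj f' g' hfr hx' hI').mono ?_
    rintro t' f'' g'' ⟨ht', h⟩
    exact ⟨by rw [add_mul]; omega, h⟩
  · rintro t f' g' hfr ⟨ht, h⟩
    exact post _ _ _ hfr (by omega) h

/-- The first `k` entries of an array. -/
def arr (f : Words) (x : W) (k : ℕ) : List ℕ := (List.range k).map fun i => f (x, i, 0)

@[simp] theorem length_arr (f : Words) (x : W) (k : ℕ) : (arr f x k).length = k := by simp [arr]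

theorem arr_succ (f : Words) (x : W) (k : ℕ) : arr f x (k + 1) = arr f x k ++ [f (x, k, 0)] := by
  simp [arr, List.range_succ]

theorem arr_congr {f f' : Words} {x : W} {k : ℕ} (h : ∀ i < k, f' (x, i, 0) = f (x, i, 0)) :
    arr f' x k = arr f x k := by
  refine List.map_congr_left fun i hi => h i (List.mem_range.1 hi)

theorem arr_getElem {f : Words} {x : W} {k : ℕ} {l : List ℕ} (h : arr f x k = l) {i : ℕ}
    (hi : i < l.length) : f (x, i, 0) = l[i] := by
  subst h
  simp [arr]

/-- Following the links in the array `next` from `h`, one finds the list `l`. (What the last link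
contains is left open.) -/
def Linked (f : Words) (next : W) : ℕ → List ℕ → Prop
  | _, [] => True
  | h, e :: l => h = e ∧ Linked f next (f (next, e, 0)) l

theorem Linked.congr {f f' : Words} {next : W} {l : List ℕ} :
    ∀ {h : ℕ}, (∀ e ∈ l, f' (next, e, 0) = f (next, e, 0)) → Linked f next h l →
      Linked f' next h l := by
  induction l with
  | nil => intros; trivial
  | cons e l ih =>
    rintro h he ⟨h1, h2⟩
    exact ⟨h1, ih (fun x hx => he x (by simp [hx])) (by rwa [he e (by simp)])⟩

/-- The rule for `scan`: `I l₁` holds after the edges of the initial segment `l₁` of the list `l` of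
all edges at the current vertex. -/
theorem wp_scan {d : Dir} {L F n c : ℕ} {l : List ℕ} (I : List ℕ → Words → Weights → Prop)
    (hd : d = fwd ∨ d = bwd) (hcur : S.writes .cur = false) (hnext : S.writes d.next = false)
    (htip : S.writes d.tip = false) (hu : f (.u, 0, 0) ≤ L) (hl : ∀ e ∈ l, e ≤ L)
    (hdeg : f (d.deg, f (.u, 0, 0), 0) = l.length)
    (hlink : Linked f d.next (f (d.first, f (.u, 0, 0), 0)) l)
    (h0 : I [] f g)
    (hI : ∀ l' f' g' v, I l' f' g' → I l' (Function.update f' (.w, 0, 0) v) g' ∧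
      I l' (Function.update f' (.cur, 0, 0) v) g')
    (step : ∀ l₁ e l₂, l = l₁ ++ e :: l₂ → ∀ f' g', Frame (scan d S) f g f' g' →
      f' (.cur, 0, 0) = e → f' (.w, 0, 0) = f (d.tip, e, 0) → I l₁ f' g' →
      WP (allowed L F n) S f' g' fun t f'' g'' => t ≤ c ∧ I (l₁ ++ [e]) f'' g'')
    (post : ∀ t f' g', Frame (scan d S) f g f' g' → t ≤ l.length * (c + 4) + 3 → I l f' g' →
      Q t f' g') :
    WP (allowed L F n) (scan d S) f g Q := by
  have hne : d.next ≠ .cur ∧ d.next ≠ .w ∧ d.tip ≠ .cur ∧ d.tip ≠ .w ∧ d.deg ≠ .cur ∧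
      d.first ≠ .cur := by
    rcases hd with rfl | rfl <;> decide
  obtain ⟨hne1, hne2, hne3, hne4, hne5, hne6⟩ := hne
  let f0 := Function.update f (.cur, 0, 0) (f (d.first, f (.u, 0, 0), 0))
  let S' := block [assign .w (entry d.tip .cur), S, assign .cur (entry d.next .cur)]
  have hf0 : Frame (scan d S) f g f0 g := by
    refine ⟨fun z hz i j => Function.update_of_ne (fun h => ?_) _ _, fun _ _ _ _ => rfl⟩
    have : W.cur = z := (congrArg Prod.fst h).symm
    simp [scan, block, Stmt.writes, Ref.name, this] at hz
  have hmono : ∀ f' g', Frame S' f0 g f' g' → Frame (scan d S) f g f' g' := by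
    intro f' g' h
    refine hf0.trans (h.mono ?_ ?_) <;>
      simp +contextual [S', scan, block, Stmt.writes, Stmt.writesA]
  have hk0 : (entry d.deg .u).eval f0 = l.length := by
    simp [f0, hne5, hdeg]
  rw [scan, wp_block_cons, wp_setW]
  refine ⟨by simpa using Or.inl hu, ?_⟩
  rw [wp_block_cons]
  refine wp_loop (fun j t f' g' => t ≤ j * (c + 4) + 1 ∧ I (l.take j) f' g' ∧
    Linked f0 d.next (f' (.cur, 0, 0)) (l.drop j)) ?_ ⟨by simp, ?_, ?_⟩ (by simp) ?_ ?_
  · simpa using Or.inl hu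
  · exact (hI _ _ _ _ h0).2
  · simp only [WExpr.eval, Ref.addr, Function.update_self, List.drop_zero]
    refine Linked.congr (fun e _ => ?_) hlink
    simp [f0, hne1]
  · rintro j hj t f' g' hfr ⟨ht, hI', hlk⟩ -
    have hj : j < l.length := by rw [← hk0]; exact hj
    rw [List.drop_eq_getElem_cons hj] at hlk
    obtain ⟨hcur', hlk⟩ := hlk
    have hel : l[j] ≤ L := hl _ (List.getElem_mem hj)
    have hS'n : S'.writes d.next = false := by
      simp [S', block, Stmt.writes, Ref.name, hnext, hne1.symm, hne2.symm]
    have hS't : S'.writes d.tip = false := by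
      simp [S', block, Stmt.writes, Ref.name, htip, hne3.symm, hne4.symm]
    rw [wp_block_cons, wp_setW]
    refine ⟨by simp [hcur', hel], ?_⟩
    simp only [WExpr.eval, Ref.addr, hcur']
    set f1 := Function.update f' (.w, 0, 0) (f' (d.tip, l[j], 0)) with hf1
    have hf1cur : f1 (.cur, 0, 0) = l[j] := by simp [hf1, hcur']
    have hfr1 : Frame S' f' g' f1 g' := by
      refine ⟨fun z hz i j => Function.update_of_ne (fun h => ?_) _ _, fun _ _ _ _ => rfl⟩
      have : W.w = z := (congrArg Prod.fst h).symm
      simp [S', block, Stmt.writes, Ref.name, this] at hz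
    have htipf : f' (d.tip, l[j], 0) = f (d.tip, l[j], 0) := by
      rw [hfr.word _ hS't]; simp [hne3]
    have hstep := (step (l.take j) l[j] (l.drop (j + 1)) (by simp) f1 g'
      (hmono _ _ (hfr.trans hfr1)) hf1cur (by simp [hf1, htipf]) (hI _ _ _ _ hI').1).frame
    rw [wp_block_cons]
    refine hstep.mono ?_
    rintro t' f'' g'' ⟨hfr', ht', hI''⟩
    have hcur'' : f'' (.cur, 0, 0) = l[j] := by rw [hfr'.word _ hcur, hf1cur]
    simp only [wp_block_cons, wp_setW, wp_block_nil]
    refine ⟨by simp [hcur'', hel], ?_, ?_, ?_⟩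
    · rw [add_mul]; omega
    · rw [List.take_succ_eq_append_getElem hj]
      exact (hI _ _ _ _ hI'').2
    · simp only [WExpr.eval, Ref.addr, hcur'', Function.update_self]
      rw [hfr'.word _ hnext, hf1, Function.update_of_ne (by simp [hne2]), hfr.word _ hS'n]
      exact hlk
  · rintro j t f' g' hfr ⟨ht, hI', -⟩
    refine ⟨fun hj => ?_, by simp⟩
    rw [wp_block_nil]
    have hj : j = l.length := hj.trans hk0
    subst hj
    rw [List.take_length] at hI'
    exact post _ _ _ (hmono _ _ hfr) (by omega) hI'

/-- The queue contains the list `Q`, of which `h` entries have been removed. -/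
structure IsQueue (f : Words) (h : ℕ) (Q : List ℕ) : Prop where
  head : f (.head, 0, 0) = h
  tail : f (.tail, 0, 0) = Q.length
  list : arr f .queue Q.length = Q

theorem IsQueue.congr {f f' : Words} {h : ℕ} {Q : List ℕ} (hQ : IsQueue f h Q)
    (h1 : f' (.head, 0, 0) = f (.head, 0, 0)) (h2 : f' (.tail, 0, 0) = f (.tail, 0, 0))
    (h3 : ∀ i, f' (.queue, i, 0) = f (.queue, i, 0)) : IsQueue f' h Q :=
  ⟨h1.trans hQ.head, h2.trans hQ.tail, (arr_congr fun i _ => h3 i).trans hQ.list⟩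

theorem wp_push {L F n h : ℕ} {Q' : List ℕ} {x : W} (hQ : IsQueue f h Q') (hL : Q'.length ≤ L)
    {R : ℕ → Words → Weights → Prop}
    (hR : ∀ f', (∀ y i j, y ≠ .queue → y ≠ .tail → f' (y, i, j) = f (y, i, j)) →
      IsQueue f' h (Q' ++ [f (x, 0, 0)]) → R 3 f' g) :
    WP (allowed L F n) (push x) f g R := by
  simp only [push, wp_block_cons, wp_setW, wp_block_nil]
  refine ⟨by simp [hQ.tail, hL], by simp, ?_⟩
  refine hR _ (fun y i j h1 h2 => by simp [h1, h2]) ⟨?_, ?_, ?_⟩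
  · simp [hQ.head]
  · simp [hQ.tail]
  · rw [List.length_append, List.length_singleton, arr_succ]
    congr 1
    · refine (arr_congr fun i hi => ?_).trans hQ.list
      simp only [WExpr.eval, Ref.addr, Function.update_apply, hQ.tail]
      simp [hi.ne]
    · simp [hQ.tail]

/-- The rule for `serve`: `J h Q` holds when the vertices in the list `Q` have been put into the
queue, and the first `h` of them have been removed and processed. The time spent on a vertex `u` is
at most `wt u`. -/
theorem wp_serve {L F n h₀ : ℕ} {Q₀ : List ℕ} (wt : ℕ → ℕ)
    (J : ℕ → List ℕ → Words → Weights → Prop)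
    (hn : f (.n, 0, 0) = n) (hnL : n ≤ L)
    (hQ₀ : IsQueue f h₀ Q₀) (hh₀ : h₀ ≤ Q₀.length) (h0 : J h₀ Q₀ f g)
    (hlen : ∀ h Q f' g', J h Q f' g' → Q.length ≤ n)
    (hJ : ∀ h Q f' g' v, J h Q f' g' → J h Q (Function.update f' (.u, 0, 0) v) g' ∧
      J h Q (Function.update f' (.head, 0, 0) v) g')
    (step : ∀ h Q, ∀ hh : h < Q.length, ∀ f' g', Frame (serve S) f g f' g' → IsQueue f' (h + 1) Q →
      f' (.u, 0, 0) = Q[h] → J h Q f' g' → WP (allowed L F n) S f' g' fun t f'' g'' =>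
        t ≤ wt Q[h] ∧ ∃ Q', Q <+: Q' ∧ IsQueue f'' (h + 1) Q' ∧ J (h + 1) Q' f'' g'')
    (post : ∀ t f' g' Q', Frame (serve S) f g f' g' → Q₀ <+: Q' → IsQueue f' Q'.length Q' →
      J Q'.length Q' f' g' →
      t + ((Q₀.take h₀).map fun u => wt u + 4).sum ≤ (Q'.map fun u => wt u + 4).sum + 2 →
      Q t f' g') :
    WP (allowed L F n) (serve S) f g Q := by
  refine wp_loop (fun j t f' g' => ∃ Q' : List ℕ, h₀ + j ≤ Q'.length ∧ IsQueue f' (h₀ + j) Q' ∧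
      J (h₀ + j) Q' f' g' ∧ Q₀ <+: Q' ∧
      t + ((Q₀.take h₀).map fun u => wt u + 4).sum ≤
        ((Q'.take (h₀ + j)).map fun u => wt u + 4).sum + 1) (by simp)
    ⟨Q₀, hh₀, hQ₀, h0, List.prefix_rfl, by simp [add_comm]⟩ (by simp) ?_ ?_
  · rintro j - t f' g' hfr ⟨Q', hle, hQ', hJ', hpre, ht⟩ hc
    have hlt : h₀ + j < Q'.length := by
      simpa [hQ'.head, hQ'.tail] using hc
    have hle' := hlen _ _ _ _ hJ'
    have hget := arr_getElem hQ'.list hlt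
    rw [wp_block_cons, wp_setW]
    refine ⟨by simp [hQ'.head]; omega, ?_⟩
    rw [wp_block_cons, wp_setW]
    refine ⟨by simp, ?_⟩
    simp only [WExpr.eval, Ref.addr, hQ'.head, hget]
    rw [Function.update_of_ne (by simp), hQ'.head]
    set f2 := Function.update (Function.update f' (.u, 0, 0) Q'[h₀ + j]) (.head, 0, 0) (h₀ + j + 1)
      with hf2
    have hfr2 : Frame (serve S) f g f2 g' := by
      refine Frame.trans (hfr.mono (fun _ h => h) fun _ h => h)
        ⟨fun z hz i j => ?_, fun _ _ _ _ => rfl⟩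
      have h1 : z ≠ .u := by
        rintro rfl; simp [serve, block, Stmt.writes, Ref.name] at hz
      have h2 : z ≠ .head := by
        rintro rfl; simp [serve, block, Stmt.writes, Ref.name] at hz
      simp [hf2, h1, h2]
    have hQ2 : IsQueue f2 (h₀ + j + 1) Q' :=
      ⟨by simp [hf2], by simp [hf2, hQ'.tail],
        (arr_congr fun i _ => by simp [hf2]).trans hQ'.list⟩
    have hJ2 : J (h₀ + j) Q' f2 g' := (hJ _ _ _ _ _ (hJ _ _ _ _ _ hJ').1).2
    rw [wp_block_cons]
    refine (step _ _ hlt f2 g' hfr2 hQ2 (by simp [hf2]) hJ2).mono ?_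
    rintro t' f'' g'' ⟨ht', Q'', hpre', hQ'', hJ''⟩
    rw [wp_block_nil]
    refine ⟨Q'', ?_, hQ'', hJ'', hpre.trans hpre', ?_⟩
    · have := hpre'.length_le; omega
    · have hlt' : h₀ + j < Q''.length := hlt.trans_le hpre'.length_le
      have e1 : Q''.take (h₀ + (j + 1)) = Q'.take (h₀ + j) ++ [Q'[h₀ + j]] := by
        rw [← add_assoc, ← List.take_succ_eq_append_getElem hlt]
        obtain ⟨R, rfl⟩ := hpre'
        rw [List.take_append_of_le_length (by omega)]
      rw [e1, List.map_append, List.sum_append]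
      simp only [List.map_cons, List.map_nil, List.sum_cons, List.sum_nil]
      omega
  · rintro j t f' g' hfr ⟨Q', hle, hQ', hJ', hpre, ht⟩
    have hle' := hlen _ _ _ _ hJ'
    have key : h₀ + j = Q'.length → ∀ t' ≤ t + 1, Q t' f' g' := by
      intro h t' ht'
      rw [h] at hQ' hJ' ht
      rw [List.take_length] at ht
      exact post _ _ _ Q' (hfr.mono (fun _ h => h) fun _ h => h) hpre hQ' hJ' (by omega)
    refine ⟨fun hj => key ?_ _ (by omega), fun hc => key ?_ _ le_rfl⟩
    · have hj : j = n := hj.trans hn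
      omega
    · simp only [Cond.holds, WExpr.eval, Ref.addr, hQ'.head, hQ'.tail, decide_eq_true_eq,
        not_lt] at hc
      omega

/-- Vertex arrays are initialized with a constant in linear time. -/
theorem wp_fill {x : W} {L F n c : ℕ} (hn : f (.n, 0, 0) = n) (hnL : n ≤ L) (hx : x ≠ .v)
    (post : ∀ t f' g', Frame (fill x c) f g f' g' → t ≤ 4 * n + 3 →
      (∀ i < n, f' (x, i, 0) = c) → Q t f' g') : WP (allowed L F n) (fill x c) f g Q := by
  refine wp_forUp_const (k := n) 1 (fun j f' _ => ∀ i < j, f' (x, i, 0) = c) ?_ (by simp) hn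
    (by simp) ?_ ?_ ?_
  · simp [Stmt.writes, Ref.name, hx]
  · intro j f' g' v h i hi
    simp [hx, h i hi]
  · intro j hj f' g' _ hv hI
    simp only [wp_setW, hv, Ref.addr, WExpr.eval]
    refine ⟨by simp [hv]; omega, le_rfl, fun i hi => ?_⟩
    rw [Function.update_apply]
    split_ifs with h
    · rfl
    · refine hI i (Nat.lt_of_le_of_ne (Nat.lt_succ_iff.1 hi) ?_)
      rintro rfl
      exact h rfl
  · intro t f' g' hfr ht h
    exact post _ _ _ hfr (by omega) h

/-- Vertex arrays are copied in linear time. -/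
theorem wp_copy {x y : W} {L F n : ℕ} (hn : f (.n, 0, 0) = n) (hnL : n ≤ L) (hx : x ≠ .v)
    (hy : y ≠ .v) (hxy : x ≠ y)
    (post : ∀ t f' g', Frame (copy x y) f g f' g' → t ≤ 4 * n + 3 →
      (∀ i < n, f' (x, i, 0) = f (y, i, 0)) → Q t f' g') :
    WP (allowed L F n) (copy x y) f g Q := by
  refine wp_forUp_const (k := n) 1 (fun j f' _ => ∀ i < j, f' (x, i, 0) = f (y, i, 0)) ?_ (by simp)
    hn (by simp) ?_ ?_ ?_
  · simp [Stmt.writes, Ref.name, hx]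
  · intro j f' g' v h i hi
    simp [hx, h i hi]
  · intro j hj f' g' hfr hv hI
    simp only [wp_setW, hv, Ref.addr, WExpr.eval]
    refine ⟨by simp [hv]; omega, le_rfl, fun i hi => ?_⟩
    rw [Function.update_apply]
    split_ifs with h
    · obtain rfl : i = j := by simpa using h
      refine hfr.word y ?_ _ _
      simp [forUp, block, Stmt.writes, Ref.name, hxy, hy.symm]
    · refine hI i (Nat.lt_of_le_of_ne (Nat.lt_succ_iff.1 hi) ?_)
      rintro rfl
      exact h rfl
  · intro t f' g' hfr ht h
    exact post _ _ _ hfr (by omega) h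

end Loops

end DescendantCounting

namespace DescendantCounting

open Relation

/-! ### Digraphs in the memory, and searches -/

/-- The input of the program: numbers of vertices and edges, sources and targets of the edges. -/
structure Input where
  n : ℕ
  m : ℕ
  src : ℕ → ℕ
  dst : ℕ → ℕ
  src_lt : ∀ e < m, src e < n
  dst_lt : ∀ e < m, dst e < n

/-- The names of the words that hold the input and the adjacency lists of the current digraph. -/
def graphNames : List W :=
  [.n, .m, .src, .dst, .hOut, .nxtOut, .degOut, .hIn, .nxtIn, .degIn]

/-- The adjacency lists in direction `d` contain the edges in `S`. Edges are listed in the order of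
`S`, which starts with the last edge that was inserted. -/
def IsAdjList (d : Dir) (near : ℕ → ℕ) (n : ℕ) (f : Words) (S : List ℕ) : Prop :=
  ∀ u < n, f (d.deg, u, 0) = (S.filter (near · = u)).length ∧
    Linked f d.next (f (d.first, u, 0)) (S.filter (near · = u))

namespace Input

variable (X : Input)

/-- The adjacency relation of the digraph with the edges in `S`. -/
def Adj (S : List ℕ) : ℕ → ℕ → Prop := EdgeRel S.toFinset X.src X.dst

/-- The reachability relation of the digraph with the edges in `S`. -/
def Reach (S : List ℕ) : ℕ → ℕ → Prop := ReflTransGen (X.Adj S)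

/-- The words with the input are intact. -/
structure Base (f : Words) : Prop where
  n : f (.n, 0, 0) = X.n
  m : f (.m, 0, 0) = X.m
  src : ∀ e, f (.src, e, 0) = X.src e
  dst : ∀ e, f (.dst, e, 0) = X.dst e

/-- The current digraph is the one with the edges in `S`. -/
structure Rep (f : Words) (S : List ℕ) : Prop extends X.Base f where
  out : IsAdjList fwd X.src X.n f S
  inn : IsAdjList bwd X.dst X.n f S
  lt : ∀ e ∈ S, e < X.m
  nodup : S.Nodup

/-- In direction `d`, edges lead from `near` to `tip`. -/
def IsDir (d : Dir) (near tip : ℕ → ℕ) : Prop :=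
  d = fwd ∧ near = X.src ∧ tip = X.dst ∨ d = bwd ∧ near = X.dst ∧ tip = X.src

variable {X}

theorem Base.congr {f f' : Words} (h : X.Base f)
    (hf : ∀ y ∈ graphNames, ∀ i j, f' (y, i, j) = f (y, i, j)) : X.Base f' := by
  obtain ⟨h1, h2, h3, h4⟩ := h
  simp only [graphNames, List.forall_mem_cons] at hf
  obtain ⟨a1, a2, a3, a4, -⟩ := hf
  exact ⟨by rw [a1, h1], by rw [a2, h2], fun e => by rw [a3, h3], fun e => by rw [a4, h4]⟩

theorem Base.frame {St : Stmt} {f f' : Words} {g g' : Weights} (h : X.Base f)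
    (hf : Frame St f g f' g') (hS : ∀ y ∈ [W.n, .m, .src, .dst], St.writes y = false) :
    X.Base f' := by
  obtain ⟨h1, h2, h3, h4⟩ := h
  simp only [List.forall_mem_cons] at hS
  obtain ⟨a1, a2, a3, a4, -⟩ := hS
  exact ⟨by rw [hf.word _ a1, h1], by rw [hf.word _ a2, h2], fun e => by rw [hf.word _ a3, h3],
    fun e => by rw [hf.word _ a4, h4]⟩

theorem Rep.congr {f f' : Words} {S : List ℕ} (h : X.Rep f S)
    (hf : ∀ y ∈ graphNames, ∀ i j, f' (y, i, j) = f (y, i, j)) : X.Rep f' S := by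
  obtain ⟨hb, ho, hi, h5, h6⟩ := h
  refine ⟨hb.congr hf, ?_, ?_, h5, h6⟩
  all_goals
    simp only [graphNames, List.forall_mem_cons] at hf
    obtain ⟨a1, a2, a3, a4, a5, a6, a7, a8, a9, a10, -⟩ := hf
  · intro u hu
    refine ⟨(a7 _ _).trans (ho u hu).1, ?_⟩
    have := (ho u hu).2
    exact Linked.congr (fun e _ => a6 _ _) (by rw [show fwd.first = .hOut from rfl, a5]; exact this)
  · intro u hu
    refine ⟨(a10 _ _).trans (hi u hu).1, ?_⟩
    have := (hi u hu).2
    exact Linked.congr (fun e _ => a9 _ _) (by rw [show bwd.first = .hIn from rfl, a8]; exact this)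

theorem Rep.frame {St : Stmt} {f f' : Words} {g g' : Weights} {S : List ℕ} (h : X.Rep f S)
    (hf : Frame St f g f' g') (hS : ∀ y ∈ graphNames, St.writes y = false) : X.Rep f' S :=
  h.congr fun y hy => hf.word y (hS y hy)

theorem Rep.adjList {f : Words} {S : List ℕ} (h : X.Rep f S) {d : Dir} {near tip : ℕ → ℕ}
    (hd : X.IsDir d near tip) : IsAdjList d near X.n f S := by
  rcases hd with ⟨rfl, rfl, rfl⟩ | ⟨rfl, rfl, rfl⟩
  · exact h.out
  · exact h.inn

theorem Rep.tip {f : Words} {S : List ℕ} (h : X.Rep f S) {d : Dir} {near tip : ℕ → ℕ}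
    (hd : X.IsDir d near tip) (e : ℕ) : f (d.tip, e, 0) = tip e := by
  rcases hd with ⟨rfl, rfl, rfl⟩ | ⟨rfl, rfl, rfl⟩
  · exact h.dst e
  · exact h.src e

theorem IsDir.tip_lt {d : Dir} {near tip : ℕ → ℕ} (hd : X.IsDir d near tip) {e : ℕ} (he : e < X.m) :
    tip e < X.n := by
  rcases hd with ⟨rfl, rfl, rfl⟩ | ⟨rfl, rfl, rfl⟩
  · exact X.dst_lt e he
  · exact X.src_lt e he

theorem isDir_fwd : X.IsDir fwd X.src X.dst := Or.inl ⟨rfl, rfl, rfl⟩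

theorem isDir_bwd : X.IsDir bwd X.dst X.src := Or.inr ⟨rfl, rfl, rfl⟩

theorem adj_iff {S : List ℕ} {u v : ℕ} :
    X.Adj S u v ↔ ∃ e ∈ S, X.src e = u ∧ X.dst e = v := by
  simp [Adj, EdgeRel]

theorem reach_bwd {S : List ℕ} {u v : ℕ} :
    ReflTransGen (EdgeRel S.toFinset X.dst X.src) u v ↔ X.Reach S v u := by
  rw [Reach, ← reflTransGen_swap]
  have : EdgeRel S.toFinset X.dst X.src = Function.swap (X.Adj S) := by
    funext u v
    simp [Function.swap, Adj, EdgeRel, and_comm]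
  rw [this]

/-- The rule for scanning the edges at the vertex `u`. -/
theorem Rep.wp_scan {d : Dir} {near tip : ℕ → ℕ} {St : Stmt} {L F c u : ℕ} {S : List ℕ}
    {f : Words} {g : Weights} {Q : ℕ → Words → Weights → Prop}
    (hR : X.Rep f S) (hd : X.IsDir d near tip) (hL : X.n ≤ L ∧ X.m ≤ L)
    (hS : ∀ y ∈ W.cur :: graphNames, St.writes y = false)
    (hu : f (.u, 0, 0) = u) (hun : u < X.n) (I : List ℕ → Words → Weights → Prop)
    (h0 : I [] f g)
    (hI : ∀ l' f' g' v, I l' f' g' → I l' (Function.update f' (.w, 0, 0) v) g' ∧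
      I l' (Function.update f' (.cur, 0, 0) v) g')
    (step : ∀ l₁ e l₂, S.filter (near · = u) = l₁ ++ e :: l₂ → e ∈ S → near e = u → tip e < X.n →
      ∀ f' g', Frame (scan d St) f g f' g' → f' (.cur, 0, 0) = e → f' (.w, 0, 0) = tip e →
      I l₁ f' g' →
      WP (allowed L F X.n) St f' g' fun t f'' g'' => t ≤ c ∧ I (l₁ ++ [e]) f'' g'')
    (post : ∀ t f' g', Frame (scan d St) f g f' g' →
      t ≤ (S.filter (near · = u)).length * (c + 4) + 3 → I (S.filter (near · = u)) f' g' →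
      Q t f' g') :
    WP (allowed L F X.n) (scan d St) f g Q := by
  simp only [graphNames, List.forall_mem_cons] at hS
  obtain ⟨a0, a1, a2, a3, a4, a5, a6, a7, a8, a9, a10, -⟩ := hS
  have hadj := hR.adjList hd u hun
  refine DescendantCounting.wp_scan (c := c) (l := S.filter (near · = u)) I ?_ a0 ?_ ?_ (by omega)
    ?_ (by rw [hu]; exact hadj.1) (by rw [hu]; exact hadj.2) h0 hI ?_ post
  · rcases hd with ⟨rfl, -⟩ | ⟨rfl, -⟩
    · exact Or.inl rfl
    · exact Or.inr rfl
  · rcases hd with ⟨rfl, -⟩ | ⟨rfl, -⟩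
    · exact a6
    · exact a9
  · rcases hd with ⟨rfl, -⟩ | ⟨rfl, -⟩
    · exact a4
    · exact a3
  · intro e he
    have := hR.lt e (List.mem_filter.1 he).1
    omega
  · intro l₁ e l₂ hl f' g' hfr h1 h2 h3
    have he : e ∈ S.filter (near · = u) := by rw [hl]; simp
    have he' := List.mem_filter.1 he
    refine step l₁ e l₂ hl he'.1 (by simpa using he'.2) (hd.tip_lt (hR.lt e he'.1)) f' g' hfr h1
      ?_ h3
    rw [h2, hR.tip hd]

/-- Distinct vertices together have at most as many edges as the digraph. -/
theorem sum_length_filter_le (near : ℕ → ℕ) (S : List ℕ) {Q : List ℕ} (hQ : Q.Nodup) :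
    (Q.map fun u => (S.filter (near · = u)).length).sum ≤ S.length := by
  induction S with
  | nil => simp
  | cons e S ih =>
    have : (Q.map fun u => ((e :: S).filter (near · = u)).length).sum =
        (Q.map fun u => (S.filter (near · = u)).length).sum + Q.count (near e) := by
      clear hQ ih
      induction Q with
      | nil => simp
      | cons q Q ih =>
        simp only [List.map_cons, List.sum_cons, ih, List.count_cons]
        by_cases h : near e = q
        · simp [h]; omega
        · simp [h, Ne.symm h]; omega
    have h2 := List.nodup_iff_count_le_one.1 hQ (near e)
    rw [this, List.length_cons]
    omega

/-- The time of a search that spends `a` steps on every edge and `b` steps on every vertex. -/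
theorem sum_weights_le (near : ℕ → ℕ) (S : List ℕ) {Q : List ℕ} (hQ : Q.Nodup) (a b : ℕ) :
    (Q.map fun u => (S.filter (near · = u)).length * a + b).sum ≤ S.length * a + Q.length * b := by
  have h1 : (Q.map fun u => (S.filter (near · = u)).length * a + b).sum =
      (Q.map fun u => (S.filter (near · = u)).length).sum * a + Q.length * b := by
    induction Q with
    | nil => simp
    | cons q Q ih =>
      rw [List.map_cons, List.sum_cons, ih (List.nodup_cons.1 hQ).2, List.map_cons, List.sum_cons,
        List.length_cons]
      ring
  rw [h1]
  gcongr
  exact sum_length_filter_le near S hQ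

theorem length_le_of_nodup {Q : List ℕ} {n : ℕ} (h : Q.Nodup) (h' : ∀ v ∈ Q, v < n) :
    Q.length ≤ n := by
  have : Q ⊆ List.range n := fun v hv => List.mem_range.2 (h' v hv)
  simpa using (h.subperm this).length_le

theorem wp_clearQueue {L F n : ℕ} {f : Words} {g : Weights} {Q : ℕ → Words → Weights → Prop}
    (post : ∀ f', Frame clearQueue f g f' g → IsQueue f' 0 [] → Q 3 f' g) :
    WP (allowed L F n) clearQueue f g Q := by
  have h : WP (allowed L F n) clearQueue f g fun t f' g' => t = 3 ∧ g' = g ∧ IsQueue f' 0 [] := by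
    simp only [clearQueue, wp_block_cons, wp_setW, wp_block_nil]
    exact ⟨by simp, by simp, trivial, trivial, by simp, by simp, rfl⟩
  refine h.frame.mono ?_
  rintro t f' g' ⟨h1, rfl, rfl, h2⟩
  exact post f' h1 h2

/-- The queue of a search contains distinct vertices that are reachable from `x₀`, and these are
marked as visited. -/
structure SearchInv (X : Input) (near tip : ℕ → ℕ) (S : List ℕ) (x₀ : ℕ) (f : Words) (Q : List ℕ) :
    Prop where
  nodup : Q.Nodup
  lt : ∀ v ∈ Q, v < X.n
  reach : ∀ v ∈ Q, ReflTransGen (EdgeRel S.toFinset near tip) x₀ v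
  vis : ∀ v < X.n, f (.vis, v, 0) = if v ∈ Q then 1 else 0

theorem SearchInv.congr {near tip : ℕ → ℕ} {S : List ℕ} {x₀ : ℕ} {f f' : Words} {Q : List ℕ}
    (h : SearchInv X near tip S x₀ f Q) (hf : ∀ v, f' (.vis, v, 0) = f (.vis, v, 0)) :
    SearchInv X near tip S x₀ f' Q :=
  ⟨h.nodup, h.lt, h.reach, fun v hv => (hf v).trans (h.vis v hv)⟩

/-- A breadth-first search finds exactly the vertices that can be reached from `x₀` in direction
`d`. -/
theorem Rep.wp_search {d : Dir} {near tip : ℕ → ℕ} {L F x₀ : ℕ} {S : List ℕ} {x : W}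
    {f : Words} {g : Weights} {Q : ℕ → Words → Weights → Prop}
    (hR : X.Rep f S) (hd : X.IsDir d near tip) (hL : X.n ≤ L ∧ X.m ≤ L)
    (hx : f (x, 0, 0) = x₀) (hxn : x₀ < X.n) (hx' : x ∉ [W.head, .tail, .vis, .v])
    (post : ∀ t f' g', Frame (search d x) f g f' g' → t ≤ 10 * S.length + 11 * X.n + 16 →
      (∀ v < X.n, (f' (.vis, v, 0) = 1 ↔ ReflTransGen (EdgeRel S.toFinset near tip) x₀ v) ∧
        (f' (.vis, v, 0) = 0 ∨ f' (.vis, v, 0) = 1)) → Q t f' g') :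
    WP (allowed L F X.n) (search d x) f g Q := by
  simp only [List.mem_cons, List.not_mem_nil, or_false, not_or] at hx'
  obtain ⟨hx1, hx2, hx3, hx4⟩ := hx'
  suffices H : WP (allowed L F X.n) (search d x) f g fun t f' g' =>
      t ≤ 10 * S.length + 11 * X.n + 16 ∧
      ∀ v < X.n, (f' (.vis, v, 0) = 1 ↔ ReflTransGen (EdgeRel S.toFinset near tip) x₀ v) ∧
        (f' (.vis, v, 0) = 0 ∨ f' (.vis, v, 0) = 1) by
    exact H.frame.mono fun t f' g' h => post t f' g' h.1 h.2.1 h.2.2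
  refine (wp_clearQueue (Q := fun t f' g' => IsQueue f' 0 [] ∧ t = 3)
    fun f' _ h => ⟨h, rfl⟩).cons ?_
  rintro t1 f1 g1 hf1 ⟨hq1, rfl⟩
  have hR1 := hR.frame hf1 (by decide)
  have hx1' : f1 (x, 0, 0) = x₀ := by
    rw [hf1.word x (by simp [clearQueue, block, Stmt.writes, Ref.name, Ne.symm hx1,
      Ne.symm hx2]), hx]
  refine (wp_fill (x := .vis) (c := 0) (Q := fun t f' g' => t ≤ 4 * X.n + 3 ∧
    ∀ i < X.n, f' (.vis, i, 0) = 0) hR1.n hL.1 (by decide)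
    fun t f' g' _ h1 h2 => ⟨h1, h2⟩).cons ?_
  rintro t2 f2 g2 hf2 ⟨ht2, hvis2⟩
  have hR2 := hR1.frame hf2 (by decide)
  have hx2' : f2 (x, 0, 0) = x₀ := by
    rw [hf2.word x (by simp [fill, forUp, block, Stmt.writes, Ref.name, Ne.symm hx3,
      Ne.symm hx4]), hx1']
  have hq2 : IsQueue f2 0 [] := hq1.congr (hf2.word _ (by decide) _ _) (hf2.word _ (by decide) _ _)
    fun _ => hf2.word _ (by decide) _ _
  rw [wp_block_cons, wp_setW]
  refine ⟨by simp [hx2']; omega, ?_⟩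
  simp only [Ref.addr, hx2', WExpr.eval]
  set f3 := Function.update f2 (.vis, x₀, 0) 1 with hf3
  have hx3' : f3 (x, 0, 0) = x₀ := by simp [f3, hx3, hx2']
  have hq3 : IsQueue f3 0 [] := hq2.congr (by simp [f3]) (by simp [f3]) (by simp [f3])
  have hR3 : X.Rep f3 S := hR2.congr (by simp [f3, graphNames])
  rw [wp_block_cons]
  refine wp_push hq3 (by simp) fun f4 hf4 hq4 => ?_
  rw [hx3', List.nil_append] at hq4
  have hR4 : X.Rep f4 S := hR3.congr fun y hy i j => hf4 y i j
    (by rintro rfl; simp [graphNames] at hy) (by rintro rfl; simp [graphNames] at hy)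
  have hinv4 : SearchInv X near tip S x₀ f4 [x₀] := by
    refine ⟨by simp, by simpa using hxn, by simpa using ReflTransGen.refl, fun v hv => ?_⟩
    rw [hf4 _ _ _ (by decide) (by decide)]
    by_cases h : v = x₀ <;> simp [f3, h, hvis2 v hv]
  rw [wp_block_cons]
  refine wp_serve (fun u => (S.filter (near · = u)).length * 10 + 3)
    (fun h Q' f' _ => [x₀] <+: Q' ∧ SearchInv X near tip S x₀ f' Q' ∧
      ∀ u ∈ Q'.take h, ∀ e ∈ S, near e = u → tip e ∈ Q')
    hR4.n hL.1 hq4 (by simp) ⟨List.prefix_rfl, hinv4, by simp⟩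
    (fun h Q' f' g' hJ => length_le_of_nodup hJ.2.1.nodup hJ.2.1.lt) ?_ ?_ ?_
  · rintro h Q' f' g' v ⟨h1, h2, h3⟩
    exact ⟨⟨h1, h2.congr (by simp), h3⟩, ⟨h1, h2.congr (by simp), h3⟩⟩
  · rintro h Q' hh f' g' hfr hq hu ⟨hpre, hinv, hcl⟩
    have hR' : X.Rep f' S := by
      refine hR4.frame hfr ?_
      rcases hd with ⟨rfl, -⟩ | ⟨rfl, -⟩ <;> decide
    refine hR'.wp_scan (c := 6) hd hL (by decide) hu (hinv.lt _ (List.getElem_mem hh))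
      (fun l f'' _ => ∃ Q'', Q' <+: Q'' ∧ IsQueue f'' (h + 1) Q'' ∧
        SearchInv X near tip S x₀ f'' Q'' ∧ ∀ e ∈ l, tip e ∈ Q'')
      ⟨Q', List.prefix_rfl, hq, hinv, by simp⟩ ?_ ?_ ?_
    · rintro l f'' g'' v ⟨Q'', h1, h2, h3, h4⟩
      exact ⟨⟨Q'', h1, h2.congr (by simp) (by simp) (by simp), h3.congr (by simp), h4⟩,
        ⟨Q'', h1, h2.congr (by simp) (by simp) (by simp), h3.congr (by simp), h4⟩⟩
    · rintro l₁ e l₂ hl he hne hte f'' g'' hfr'' hcur hw ⟨Q'', h1, h2, h3, h4⟩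
      rw [wp_ite]
      refine ⟨by simp [hw]; omega, ?_⟩
      simp only [Cond.holds, WExpr.eval, Ref.addr, hw, decide_eq_true_eq, h3.vis _ hte]
      by_cases hmem : tip e ∈ Q''
      · simp only [hmem, if_true, one_ne_zero, if_false, wp_skip]
        refine ⟨by omega, Q'', h1, h2, h3, fun e' he' => ?_⟩
        rcases List.mem_append.1 he' with he' | he'
        · exact h4 e' he'
        · rwa [List.mem_singleton.1 he']
      · simp only [hmem, if_false, if_true]
        rw [wp_block_cons, wp_setW]
        refine ⟨by simp [hw]; omega, ?_⟩
        simp only [Ref.addr, hw, WExpr.eval]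
        set f5 := Function.update f'' (.vis, tip e, 0) 1 with hf5
        have hq5 : IsQueue f5 (h + 1) Q'' := h2.congr (by simp [f5]) (by simp [f5]) (by simp [f5])
        have hlen := length_le_of_nodup h3.nodup h3.lt
        rw [wp_block_cons]
        refine wp_push hq5 (by omega) fun f6 hf6 hq6 => ?_
        have hw5 : f5 (.w, 0, 0) = tip e := by simp [f5, hw]
        rw [hw5] at hq6
        rw [wp_block_nil]
        refine ⟨by omega, Q'' ++ [tip e], h1.trans (List.prefix_append _ _), hq6,
          ⟨?_, ?_, ?_, ?_⟩, ?_⟩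
        · rw [← List.concat_eq_append, List.nodup_concat]
          exact ⟨hmem, h3.nodup⟩
        · intro v hv
          rcases List.mem_append.1 hv with hv | hv
          · exact h3.lt v hv
          · rwa [List.mem_singleton.1 hv]
        · intro v hv
          rcases List.mem_append.1 hv with hv | hv
          · exact h3.reach v hv
          · rw [List.mem_singleton.1 hv]
            refine (hinv.reach _ (List.getElem_mem hh)).tail ⟨e, by simpa using he, hne, rfl⟩
        · intro v hv
          rw [hf6 _ _ _ (by decide) (by decide)]
          have := h3.vis v hv
          by_cases h : v = tip e <;> simp [f5, h, this]
        · intro e' he'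
          rcases List.mem_append.1 he' with he' | he'
          · exact List.mem_append_left _ (h4 e' he')
          · simp [List.mem_singleton.1 he']
    · rintro t f'' g'' - ht ⟨Q'', h1, h2, h3, h4⟩
      refine ⟨ht, Q'', h1, h2, hpre.trans h1, h3, ?_⟩
      intro u hu' e he hne
      have htake : Q''.take (h + 1) = Q'.take h ++ [Q'[h]] := by
        rw [← List.take_succ_eq_append_getElem hh]
        obtain ⟨R, rfl⟩ := h1
        rw [List.take_append_of_le_length (by omega)]
      rw [htake] at hu'
      rcases List.mem_append.1 hu' with hu' | hu'
      · exact h1.subset (hcl u hu' e he hne)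
      · rw [List.mem_singleton] at hu'
        refine h4 e (List.mem_filter.2 ⟨he, by simp [hne, hu']⟩)
  · rintro t f' g' Q' - - - ⟨hpre, hinv, hcl⟩ ht
    rw [wp_block_nil]
    have hlen := length_le_of_nodup hinv.nodup hinv.lt
    have hsum := sum_weights_le near S hinv.nodup 10 7
    change t + 0 ≤ (Q'.map fun u => (S.filter (near · = u)).length * 10 + 7).sum + 2 at ht
    refine ⟨by omega, fun v hv => ?_⟩
    rw [hinv.vis v hv]
    have key : v ∈ Q' ↔ ReflTransGen (EdgeRel S.toFinset near tip) x₀ v := by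
      refine ⟨hinv.reach v, fun h => ?_⟩
      clear hv
      induction h with
      | refl => exact hpre.subset (by simp)
      | tail _ hyz ih =>
        obtain ⟨e, he, h1, h2⟩ := hyz
        rw [List.take_length] at hcl
        exact h2 ▸ hcl _ ih e (by simpa using he) h1
    by_cases h : v ∈ Q'
    · simp [h, ← key]
    · simp [h, ← key]

end Input

end DescendantCounting

namespace DescendantCounting

open Relation

namespace Input

variable {X : Input}

/-! ### Construction of adjacency lists -/

theorem _root_.DescendantCounting.IsAdjList.insert {d : Dir} {near : ℕ → ℕ} {n e : ℕ} {f f' : Words}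
    {S : List ℕ} (h : IsAdjList d near n f S) (he : e ∉ S)
    (hdeg : ∀ u, f' (d.deg, u, 0) = if u = near e then f (d.deg, u, 0) + 1 else f (d.deg, u, 0))
    (hfirst : ∀ u, f' (d.first, u, 0) = if u = near e then e else f (d.first, u, 0))
    (hnext : ∀ k, f' (d.next, k, 0) = if k = e then f (d.first, near e, 0) else f (d.next, k, 0)) :
    IsAdjList d near n f' (e :: S) := by
  intro u hu
  obtain ⟨h1, h2⟩ := h u hu
  have hcongr : ∀ k ∈ S.filter (near · = u), f' (d.next, k, 0) = f (d.next, k, 0) := by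
    intro k hk
    rw [hnext, if_neg]
    rintro rfl
    exact he (List.mem_filter.1 hk).1
  by_cases hue : u = near e
  · subst hue
    rw [hdeg, hfirst, if_pos rfl, if_pos rfl, h1]
    simp only [List.filter_cons, decide_true, if_true, List.length_cons, true_and]
    refine ⟨rfl, ?_⟩
    rw [hnext, if_pos rfl]
    exact h2.congr hcongr
  · rw [hdeg, hfirst, if_neg hue, if_neg hue, List.filter_cons_of_neg (by simp [Ne.symm hue])]
    exact ⟨h1, h2.congr hcongr⟩

theorem Rep.wp_insertEdge {L F e : ℕ} {S : List ℕ} {f : Words} {g : Weights}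
    {Q : ℕ → Words → Weights → Prop} (hR : X.Rep f S) (hL : X.n ≤ L ∧ X.m ≤ L)
    (he : f (.e, 0, 0) = e) (hem : e < X.m) (heS : e ∉ S)
    (post : ∀ f', Frame insertEdge f g f' g → X.Rep f' (e :: S) → Q 9 f' g) :
    WP (allowed L F X.n) insertEdge f g Q := by
  have hs := X.src_lt e hem
  have hd := X.dst_lt e hem
  suffices H : WP (allowed L F X.n) insertEdge f g fun t f' g' =>
      t = 9 ∧ g' = g ∧ X.Rep f' (e :: S) by
    refine H.frame.mono ?_
    rintro t f' g' ⟨h1, rfl, rfl, h2⟩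
    exact post f' h1 h2
  simp only [insertEdge, wp_block_cons, wp_setW, wp_block_nil]
  simp only [Ref.addr, WExpr.eval, he, hR.src, hR.dst, Function.update_self, ne_eq, Prod.mk.injEq,
    reduceCtorEq, false_and, not_false_eq_true, Function.update_of_ne, Ref.wordCells,
    Ref.indexCells, WExpr.cells, Finset.union_subset_iff, Finset.insert_subset_iff,
    Finset.singleton_subset_iff, Finset.empty_subset, inl_mem_allowed, and_true, true_and,
    or_false, Nat.zero_le]
  refine ⟨by omega, by omega, by omega, by omega, by omega, by omega, by omega, by omega, ?_⟩
  refine ⟨⟨by simp [hR.n], by simp [hR.m], by simp [hR.src], by simp [hR.dst]⟩, ?_, ?_, ?_, ?_⟩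
  · refine hR.out.insert heS ?_ ?_ ?_ <;>
      (intro u; simp [fwd, Function.update_apply] <;> split_ifs <;> simp_all)
  · refine hR.inn.insert heS ?_ ?_ ?_ <;>
      (intro u; simp [bwd, Function.update_apply] <;> split_ifs <;> simp_all)
  · simpa using ⟨hem, hR.lt⟩
  · simpa using ⟨heS, hR.nodup⟩

theorem Base.wp_clearEdges {L F : ℕ} {f : Words} {g : Weights}
    {Q : ℕ → Words → Weights → Prop} (hB : X.Base f) (hL : X.n ≤ L)
    (post : ∀ t f' g', Frame clearEdges f g f' g' → t ≤ 8 * X.n + 7 → X.Rep f' [] → Q t f' g') :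
    WP (allowed L F X.n) clearEdges f g Q := by
  suffices H : WP (allowed L F X.n) clearEdges f g fun t f' g' =>
      t ≤ 8 * X.n + 7 ∧ X.Rep f' [] by
    exact H.frame.mono fun t f' g' h => post t f' g' h.1 h.2.1 h.2.2
  refine (wp_fill (x := .degOut) (c := 0) (Q := fun t f' g' => t ≤ 4 * X.n + 3 ∧
    ∀ i < X.n, f' (.degOut, i, 0) = 0) hB.n hL (by decide) fun t f' g' _ h1 h2 => ⟨h1, h2⟩).cons ?_
  rintro t1 f1 g1 hf1 ⟨ht1, h1⟩
  have hB1 := hB.frame hf1 (by decide)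
  refine (wp_fill (x := .degIn) (c := 0) (Q := fun t f' g' => t ≤ 4 * X.n + 3 ∧
    ∀ i < X.n, f' (.degIn, i, 0) = 0) hB1.n hL (by decide) fun t f' g' _ h1 h2 => ⟨h1, h2⟩).cons ?_
  rintro t2 f2 g2 hf2 ⟨ht2, h2⟩
  have hB2 := hB1.frame hf2 (by decide)
  rw [wp_block_nil]
  refine ⟨by omega, hB2, fun u hu => ⟨?_, trivial⟩, fun u hu => ⟨?_, trivial⟩, by simp, by simp⟩
  · rw [show fwd.deg = .degOut from rfl, hf2.word _ (by decide), h1 u hu]; rfl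
  · rw [show bwd.deg = .degIn from rfl, h2 u hu]; rfl

/-! ### The boundary -/

/-- The queue of the search for boundaries contains distinct vertices outside `U` that reach the set
`D`; the boundaries found so far are distinct vertices in `U` with an edge to the queue; and all of
these are marked as visited. -/
structure BoundaryInv (X : Input) (S : List ℕ) (U D : ℕ → Prop) (f : Words) (Q B : List ℕ) :
    Prop where
  nodup : Q.Nodup
  nodup' : B.Nodup
  mem : ∀ v ∈ Q, v < X.n ∧ ¬ U v ∧ ∃ c, D c ∧ X.Reach S v c
  mem' : ∀ b ∈ B, b < X.n ∧ U b ∧ ∃ w ∈ Q, X.Adj S b w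
  vis : ∀ v < X.n, f (.vis, v, 0) = if v ∈ Q ∨ v ∈ B then 1 else 0
  nB : f (.nB, 0, 0) = B.length
  bd : arr f .bd B.length = B

theorem BoundaryInv.congr {S : List ℕ} {U D : ℕ → Prop} {f f' : Words} {Q B : List ℕ}
    (h : BoundaryInv X S U D f Q B) (h1 : ∀ v, f' (.vis, v, 0) = f (.vis, v, 0))
    (h2 : f' (.nB, 0, 0) = f (.nB, 0, 0)) (h3 : ∀ v, f' (.bd, v, 0) = f (.bd, v, 0)) :
    BoundaryInv X S U D f' Q B :=
  ⟨h.nodup, h.nodup', h.mem, h.mem', fun v hv => (h1 v).trans (h.vis v hv), h2.trans h.nB,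
    (arr_congr fun i _ => h3 i).trans h.bd⟩

/-- The list of boundaries: vertices of `U` with an edge to a vertex outside `U` that reaches
`D`. -/
structure IsBoundaryList (X : Input) (S : List ℕ) (U D : ℕ → Prop) (f : Words) (B : List ℕ) :
    Prop where
  nodup : B.Nodup
  nB : f (.nB, 0, 0) = B.length
  bd : arr f .bd B.length = B
  mem : ∀ b, b ∈ B ↔ b < X.n ∧ U b ∧ ∃ w, ¬ U w ∧ X.Adj S b w ∧ ∃ c, D c ∧ X.Reach S w c

theorem IsBoundaryList.length_le {S : List ℕ} {U D : ℕ → Prop} {f : Words} {B : List ℕ}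
    (h : IsBoundaryList X S U D f B) : B.length ≤ X.n :=
  length_le_of_nodup h.nodup fun v hv => ((h.mem v).1 hv).1

theorem IsBoundaryList.frame {S : List ℕ} {U D : ℕ → Prop} {f f' : Words} {g g' : Weights}
    {B : List ℕ} {St : Stmt} (h : IsBoundaryList X S U D f B) (hf : Frame St f g f' g')
    (h1 : St.writes .nB = false) (h2 : St.writes .bd = false) : IsBoundaryList X S U D f' B :=
  ⟨h.nodup, (hf.word _ h1 _ _).trans h.nB, (arr_congr fun _ _ => hf.word _ h2 _ _).trans h.bd,
    h.mem⟩

/-- The search backwards from `D` finds all vertices outside `U` that reach `D`, since `U` is closed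
under predecessors. -/
theorem Rep.wp_boundary {L F : ℕ} {S : List ℕ} {U D : ℕ → Prop}
    {f : Words} {g : Weights} {Q : ℕ → Words → Weights → Prop}
    (hR : X.Rep f S) (hL : X.n ≤ L ∧ X.m ≤ L)
    (hU : ∀ v < X.n, f (.setU, v, 0) = 1 ↔ U v) (hD : ∀ v < X.n, f (.setD, v, 0) = 1 ↔ D v)
    (hDn : ∀ v, D v → v < X.n) (hDU : ∀ v, D v → ¬ U v)
    (hcl : ∀ v w, X.Adj S v w → U w → U v)
    (post : ∀ t f' g' B, Frame boundary f g f' g' → t ≤ 11 * S.length + 20 * X.n + 20 →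
      IsBoundaryList X S U D f' B → Q t f' g') :
    WP (allowed L F X.n) boundary f g Q := by
  suffices H : WP (allowed L F X.n) boundary f g fun t f' g' =>
      t ≤ 11 * S.length + 20 * X.n + 20 ∧ ∃ B, IsBoundaryList X S U D f' B by
    exact H.frame.mono fun t f' g' ⟨h1, h2, B, h3⟩ => post t f' g' B h1 h2 h3
  refine (wp_clearQueue (Q := fun t f' g' => IsQueue f' 0 [] ∧ t = 3)
    fun f' _ h => ⟨h, rfl⟩).cons ?_
  rintro t1 f1 g1 hf1 ⟨hq1, rfl⟩
  have hR1 := hR.frame hf1 (by decide)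
  refine (wp_fill (x := .vis) (c := 0) (Q := fun t f' g' => t ≤ 4 * X.n + 3 ∧
    ∀ i < X.n, f' (.vis, i, 0) = 0) hR1.n hL.1 (by decide)
    fun t f' g' _ h1 h2 => ⟨h1, h2⟩).cons ?_
  rintro t2 f2 g2 hf2 ⟨ht2, hvis2⟩
  have hR2 := hR1.frame hf2 (by decide)
  have hq2 : IsQueue f2 0 [] := hq1.congr (hf2.word _ (by decide) _ _) (hf2.word _ (by decide) _ _)
    fun _ => hf2.word _ (by decide) _ _
  have hU2 : ∀ v < X.n, f2 (.setU, v, 0) = 1 ↔ U v := fun v hv => by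
    rw [hf2.word _ (by decide), hf1.word _ (by decide), hU v hv]
  have hD2 : ∀ v < X.n, f2 (.setD, v, 0) = 1 ↔ D v := fun v hv => by
    rw [hf2.word _ (by decide), hf1.word _ (by decide), hD v hv]
  rw [wp_block_cons, wp_setW]
  refine ⟨by simp, ?_⟩
  simp only [Ref.addr, WExpr.eval]
  set f3 := Function.update f2 (.nB, 0, 0) 0 with hf3
  have hq3 : IsQueue f3 0 [] := hq2.congr (by simp [f3]) (by simp [f3]) (by simp [f3])
  have hR3 : X.Rep f3 S := hR2.congr (by simp [f3, graphNames])
  -- the queue is initialized with `D`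
  have hinit : WP (allowed L F X.n) (forUp .v (val .n) (when (.eq (entry .setD .v) (.lit 1)) (block
      [put .vis .v (.lit 1), push .v]))) f3 g2 fun t f' g' => t ≤ X.n * (6 + 3) + 3 ∧
        ∃ Q, IsQueue f' 0 Q ∧ (∀ v, v ∈ Q ↔ v < X.n ∧ D v) ∧ BoundaryInv X S U D f' Q [] := by
    refine wp_forUp_const (k := X.n) 6 (fun j f' _ => f' (.nB, 0, 0) = 0 ∧
      ∃ Q, IsQueue f' 0 Q ∧ Q.Nodup ∧ (∀ v, v ∈ Q ↔ v < j ∧ D v) ∧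
        ∀ v < X.n, f' (.vis, v, 0) = if v ∈ Q then 1 else 0) (by decide) (by decide) hR3.n
      ⟨by simp [f3], [], hq3, by simp, by simp, fun v hv => by simp [f3, hvis2 v hv]⟩ ?_ ?_ ?_
    · rintro j f' g' v ⟨h0, Q, h1, h2, h3, h4⟩
      exact ⟨by simpa using h0, Q, h1.congr (by simp) (by simp) (by simp), h2, h3,
        fun v hv => by simpa using h4 v hv⟩
    · rintro j hj f' g' hfr hv ⟨h0, Q, h1, h2, h3, h4⟩
      have hDf : f' (.setD, j, 0) = 1 ↔ D j := by
        rw [hfr.word _ (by decide), ← hD2 j hj]; simp [f3]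
      have hQlen : Q.length ≤ X.n :=
        length_le_of_nodup h2 fun v hv => ((h3 v).1 hv).1.trans hj
      rw [wp_ite]
      refine ⟨by simp [hv]; omega, ?_⟩
      by_cases hDj : D j
      · rw [if_pos (by simp [hv, hDf, hDj]), wp_block_cons, wp_setW]
        refine ⟨by simp [hv]; omega, ?_⟩
        simp only [Ref.addr, hv, WExpr.eval]
        set f5 := Function.update f' (.vis, j, 0) 1 with hf5
        have hq5 : IsQueue f5 0 Q := h1.congr (by simp [f5]) (by simp [f5]) (by simp [f5])
        rw [wp_block_cons]
        refine wp_push hq5 (by omega) fun f6 hf6 hq6 => ?_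
        have hv5 : f5 (.v, 0, 0) = j := by simp [f5, hv]
        rw [hv5] at hq6
        rw [wp_block_nil]
        refine ⟨by omega, ?_, Q ++ [j], hq6, ?_, ?_, ?_⟩
        · rw [hf6 _ _ _ (by decide) (by decide)]; simpa [f5] using h0
        · rw [← List.concat_eq_append, List.nodup_concat]
          exact ⟨fun h => lt_irrefl _ ((h3 j).1 h).1, h2⟩
        · intro v
          rw [List.mem_append, List.mem_singleton, h3]
          constructor
          · rintro (h | rfl)
            · exact ⟨by omega, h.2⟩
            · exact ⟨by omega, hDj⟩
          · rintro ⟨ha, hb⟩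
            by_cases hvj : v = j
            · exact Or.inr hvj
            · exact Or.inl ⟨by omega, hb⟩
        · intro v hv
          rw [hf6 _ _ _ (by decide) (by decide)]
          have := h4 v hv
          by_cases h : v = j <;> simp [f5, h, this]
      · rw [if_neg (by simp [hv, hDf, hDj]), wp_skip]
        refine ⟨by omega, h0, Q, h1, h2, fun v => ?_, h4⟩
        rw [h3]
        constructor
        · exact fun h => ⟨by omega, h.2⟩
        · rintro ⟨ha, hb⟩
          refine ⟨Nat.lt_of_le_of_ne (by omega) ?_, hb⟩
          rintro rfl
          exact hDj hb
    · rintro t f' g' hfr ht ⟨h0, Q, h1, h2, h3, h4⟩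
      refine ⟨ht, Q, h1, h3, h2, by simp, ?_, by simp, by simpa using h4, by simpa using h0, rfl⟩
      intro v hv
      have := (h3 v).1 hv
      exact ⟨this.1, hDU v this.2, v, this.2, .refl⟩
  refine hinit.cons ?_
  rintro t4 f4 g4 hf4 ⟨ht4, Q₀, hq4, hQ₀, hinv4⟩
  have hR4 : X.Rep f4 S := hR3.frame hf4 (by decide)
  have hU4 : ∀ v < X.n, f4 (.setU, v, 0) = 1 ↔ U v := fun v hv => by
    rw [hf4.word _ (by decide), ← hU2 v hv]; simp [f3]
  rw [wp_block_cons]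
  refine wp_serve (fun u => (S.filter (X.dst · = u)).length * 11 + 3)
    (fun h Q' f' _ => Q₀ <+: Q' ∧ ∃ B, BoundaryInv X S U D f' Q' B ∧
      ∀ u ∈ Q'.take h, ∀ e ∈ S, X.dst e = u → X.src e ∈ Q' ∨ X.src e ∈ B)
    hR4.n hL.1 hq4 (by simp) ⟨List.prefix_rfl, [], hinv4, by simp⟩
    (fun h Q' f' g' ⟨_, B, hJ, _⟩ => length_le_of_nodup hJ.nodup fun v hv => (hJ.mem v hv).1)
    ?_ ?_ ?_
  · rintro h Q' f' g' v ⟨h1, B, h2, h3⟩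
    exact ⟨⟨h1, B, h2.congr (by simp) (by simp) (by simp), h3⟩,
      ⟨h1, B, h2.congr (by simp) (by simp) (by simp), h3⟩⟩
  · rintro h Q' hh f' g' hfr hq hu ⟨hpre, B, hinv, hcl'⟩
    have hR' : X.Rep f' S := hR4.frame hfr (by decide)
    have hQ'h := hinv.mem _ (List.getElem_mem hh)
    refine hR'.wp_scan (c := 7) isDir_bwd hL (by decide) hu hQ'h.1
      (fun l f'' _ => ∃ Q'' B'', Q' <+: Q'' ∧ B ⊆ B'' ∧ IsQueue f'' (h + 1) Q'' ∧
        BoundaryInv X S U D f'' Q'' B'' ∧ ∀ e ∈ l, X.src e ∈ Q'' ∨ X.src e ∈ B'')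
      ⟨Q', B, List.prefix_rfl, fun _ h => h, hq, hinv, by simp⟩ ?_ ?_ ?_
    · rintro l f'' g'' v ⟨Q'', B'', h1, h1', h2, h3, h4⟩
      exact ⟨⟨Q'', B'', h1, h1', h2.congr (by simp) (by simp) (by simp),
        h3.congr (by simp) (by simp) (by simp), h4⟩,
        ⟨Q'', B'', h1, h1', h2.congr (by simp) (by simp) (by simp),
          h3.congr (by simp) (by simp) (by simp), h4⟩⟩
    · rintro l₁ e l₂ hl he hne hte f'' g'' hfr'' hcur hw ⟨Q'', B'', h1, h1', h2, h3, h4⟩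
      have hadj : X.Adj S (X.src e) Q'[h] := adj_iff.2 ⟨e, he, rfl, hne⟩
      have hmemQ : Q'[h] ∈ Q'' := h1.subset (List.getElem_mem hh)
      rw [wp_ite]
      refine ⟨by simp [hw]; omega, ?_⟩
      simp only [Cond.holds, WExpr.eval, Ref.addr, hw, decide_eq_true_eq, h3.vis _ hte]
      by_cases hmem : X.src e ∈ Q'' ∨ X.src e ∈ B''
      · simp only [hmem, if_true, one_ne_zero, if_false, wp_skip]
        refine ⟨by omega, Q'', B'', h1, h1', h2, h3, fun e' he' => ?_⟩
        rcases List.mem_append.1 he' with he' | he'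
        · exact h4 e' he'
        · rwa [List.mem_singleton.1 he']
      · simp only [hmem, if_false, if_true]
        rw [wp_block_cons, wp_setW]
        refine ⟨by simp [hw]; omega, ?_⟩
        simp only [Ref.addr, hw, WExpr.eval]
        set f5 := Function.update f'' (.vis, X.src e, 0) 1 with hf5
        have hq5 : IsQueue f5 (h + 1) Q'' := h2.congr (by simp [f5]) (by simp [f5]) (by simp [f5])
        have hlen := length_le_of_nodup h3.nodup fun v hv => (h3.mem v hv).1
        have hlen' := length_le_of_nodup h3.nodup' fun v hv => (h3.mem' v hv).1
        have hw5 : f5 (.w, 0, 0) = X.src e := by simp [f5, hw]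
        have hU5 : f5 (.setU, X.src e, 0) = 1 ↔ U (X.src e) := by
          rw [← hU4 _ hte, ← hfr.word _ (by decide), ← hfr''.word .setU (by decide)]; simp [f5]
        have hnB5 : f5 (.nB, 0, 0) = B''.length := by simp [f5, h3.nB]
        rw [not_or] at hmem
        rw [wp_block_cons, wp_ite]
        refine ⟨by simp [hw5]; omega, ?_⟩
        by_cases hUe : U (X.src e)
        · rw [if_pos (by simp [hw5, hU5, hUe])]
          simp only [wp_block_cons, wp_block_nil, wp_setW]
          refine ⟨by simp [hnB5]; omega, by simp, by omega, Q'', B'' ++ [X.src e], h1,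
            List.Subset.trans h1' (List.subset_append_left _ _),
            hq5.congr (by simp) (by simp) (by simp), ⟨h3.nodup, ?_, h3.mem, ?_, ?_, ?_, ?_⟩, ?_⟩
          · rw [← List.concat_eq_append, List.nodup_concat]
            exact ⟨hmem.2, h3.nodup'⟩
          · intro b hb
            rcases List.mem_append.1 hb with hb | hb
            · exact h3.mem' b hb
            · rw [List.mem_singleton.1 hb]
              exact ⟨hte, hUe, _, hmemQ, hadj⟩
          · intro v hv
            have := h3.vis v hv
            by_cases h : v = X.src e
            · simp [f5, h]
            · simp [f5, h, this]
          · simp [hnB5]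
          · rw [List.length_append, List.length_singleton, arr_succ]
            congr 1
            · refine (arr_congr fun i hi => ?_).trans h3.bd
              simp [f5, h3.nB, hi.ne]
            · simp [hnB5, hw5]
          · intro e' he'
            rcases List.mem_append.1 he' with he' | he'
            · exact (h4 e' he').imp_right (List.mem_append_left _)
            · simp [List.mem_singleton.1 he']
        · rw [if_neg (by simp [hw5, hU5, hUe])]
          refine wp_push hq5 (by omega) fun f6 hf6 hq6 => ?_
          rw [hw5] at hq6
          rw [wp_block_nil]
          refine ⟨by omega, Q'' ++ [X.src e], B'', h1.trans (List.prefix_append _ _), h1', hq6,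
            ⟨?_, h3.nodup', ?_, ?_, ?_, ?_, ?_⟩, ?_⟩
          · rw [← List.concat_eq_append, List.nodup_concat]
            exact ⟨hmem.1, h3.nodup⟩
          · intro v hv
            rcases List.mem_append.1 hv with hv | hv
            · exact h3.mem v hv
            · rw [List.mem_singleton.1 hv]
              obtain ⟨-, -, c, hc, hr⟩ := hQ'h
              exact ⟨hte, hUe, c, hc, .head hadj hr⟩
          · intro b hb
            obtain ⟨ha, hb, w, hw, hbw⟩ := h3.mem' b hb
            exact ⟨ha, hb, w, List.mem_append_left _ hw, hbw⟩
          · intro v hv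
            rw [hf6 _ _ _ (by decide) (by decide)]
            have := h3.vis v hv
            by_cases h : v = X.src e
            · simp [f5, h]
            · simp [f5, h, this]
          · rw [hf6 _ _ _ (by decide) (by decide), hnB5]
          · refine (arr_congr fun i hi => ?_).trans h3.bd
            rw [hf6 _ _ _ (by decide) (by decide)]
            simp [f5]
          · intro e' he'
            rcases List.mem_append.1 he' with he' | he'
            · exact (h4 e' he').imp_left (List.mem_append_left _)
            · simp [List.mem_singleton.1 he']
    · rintro t f'' g'' - ht ⟨Q'', B'', h1, h1', h2, h3, h4⟩
      refine ⟨ht, Q'', h1, h2, hpre.trans h1, B'', h3, ?_⟩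
      intro u hu' e he hne
      have htake : Q''.take (h + 1) = Q'.take h ++ [Q'[h]] := by
        rw [← List.take_succ_eq_append_getElem hh]
        obtain ⟨R, rfl⟩ := h1
        rw [List.take_append_of_le_length (by omega)]
      rw [htake] at hu'
      rcases List.mem_append.1 hu' with hu' | hu'
      · exact (hcl' u hu' e he hne).imp (fun h => h1.subset h) (fun h => h1' h)
      · rw [List.mem_singleton] at hu'
        refine h4 e (List.mem_filter.2 ⟨he, by simp [hne, hu']⟩)
  · rintro t f' g' Q' - - - ⟨hpre, B, hinv, hcl'⟩ ht
    rw [wp_block_nil]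
    have hlen := length_le_of_nodup hinv.nodup fun v hv => (hinv.mem v hv).1
    have hsum := sum_weights_le X.dst S hinv.nodup 11 7
    change t + 0 ≤ (Q'.map fun u => (S.filter (X.dst · = u)).length * 11 + 7).sum + 2 at ht
    refine ⟨by omega, B, hinv.nodup', hinv.nB, hinv.bd, fun b => ?_⟩
    rw [List.take_length] at hcl'
    have key : ∀ w c, X.Reach S w c → D c → ¬ U w → w ∈ Q' := by
      intro w c hwc hc
      induction hwc using ReflTransGen.head_induction_on with
      | refl => exact fun _ => hpre.subset ((hQ₀ c).2 ⟨hDn c hc, hc⟩)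
      | @head w w' hww' _ ih =>
        intro hUw
        have hw' := ih fun h => hUw (hcl _ _ hww' h)
        obtain ⟨e, he, h1, h2⟩ := adj_iff.1 hww'
        rcases hcl' w' hw' e he h2 with h | h
        · exact h1 ▸ h
        · exact absurd (h1 ▸ (hinv.mem' _ h).2.1) hUw
    constructor
    · intro hb
      obtain ⟨h1, h2, w, hw, hbw⟩ := hinv.mem' b hb
      exact ⟨h1, h2, w, (hinv.mem w hw).2.1, hbw, (hinv.mem w hw).2.2⟩
    · rintro ⟨h1, h2, w, hw, hbw, c, hc, hwc⟩
      obtain ⟨e, he, h3, h4⟩ := adj_iff.1 hbw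
      rcases hcl' w (key w c hwc hc hw) e he h4 with h | h
      · exact absurd (h3 ▸ h2) (hinv.mem _ h).2.1
      · exact h3 ▸ h

/-! ### Marks -/

theorem wp_copyRow {x : W} {L F j : ℕ} {f : Words} {g : Weights} {Q : ℕ → Words → Weights → Prop}
    (hn : f (.n, 0, 0) = X.n) (hnL : X.n ≤ L) (hx : x = .markOf ∨ x = .reachOf)
    (hj : f (.j, 0, 0) = j) (hjF : j < F)
    (post : ∀ t f' g', Frame (forUp .v (val .n) (.setW (.mat x .j .v) (entry .vis .v))) f g f' g' →
      t ≤ 4 * X.n + 3 → (∀ v < X.n, f' (x, j, v) = f (.vis, v, 0)) →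
      (∀ i v, i ≠ j → f' (x, i, v) = f (x, i, v)) → Q t f' g') :
    WP (allowed L F X.n) (forUp .v (val .n) (.setW (.mat x .j .v) (entry .vis .v))) f g Q := by
  have hxv : x ≠ .v := by rcases hx with rfl | rfl <;> decide
  have hxvis : x ≠ .vis := by rcases hx with rfl | rfl <;> decide
  have hxj : x ≠ .j := by rcases hx with rfl | rfl <;> decide
  refine wp_forUp_const (k := X.n) 1 (fun k f' _ => (∀ v < k, f' (x, j, v) = f (.vis, v, 0)) ∧
    ∀ i v, i ≠ j → f' (x, i, v) = f (x, i, v)) ?_ (by decide) hn (by simp) ?_ ?_ ?_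
  · simp [Stmt.writes, Ref.name, hxv]
  · rintro k f' g' v ⟨h1, h2⟩
    exact ⟨fun i hi => by simp [hxv, h1 i hi],
      fun i v hi => by simp [hxv, h2 i v hi]⟩
  · rintro k hk f' g' hfr hv ⟨h1, h2⟩
    have hj' : f' (.j, 0, 0) = j := by
      rw [hfr.word .j (by simp [forUp, block, Stmt.writes, Ref.name, hxj]), hj]
    have hvis : f' (.vis, k, 0) = f (.vis, k, 0) :=
      hfr.word .vis (by simp [forUp, block, Stmt.writes, Ref.name, hxvis]) _ _
    rw [wp_setW]
    simp only [Ref.addr, WExpr.eval, hv, hj', hvis]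
    refine ⟨by simp [hv, hj', hjF, hk, hx]; omega, le_rfl, fun v hv => ?_, fun i v hi => ?_⟩
    · rw [Function.update_apply]
      split_ifs with h
      · simp only [Prod.mk.injEq, true_and] at h
        rw [h]
      · exact h1 v (Nat.lt_of_le_of_ne (Nat.lt_succ_iff.1 hv) fun h' => h (by rw [h']))
    · rw [Function.update_of_ne (by simp [hi]), h2 i v hi]
  · rintro t f' g' hfr ht ⟨h1, h2⟩
    exact post _ _ _ hfr (by omega) h1 h2

/-- The matrices of marks and of descendants of the boundaries in the list `B`. -/
structure IsMarks (X : Input) (S B : List ℕ) (f : Words) : Prop where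
  mark : ∀ j, ∀ hj : j < B.length, ∀ v < X.n, (f (.markOf, j, v) = 1 ↔ X.Reach S v B[j]) ∧
    (f (.markOf, j, v) = 0 ∨ f (.markOf, j, v) = 1)
  reach : ∀ j, ∀ hj : j < B.length, ∀ v < X.n, f (.reachOf, j, v) = 1 ↔ X.Reach S B[j] v

/-- Every boundary costs two searches, one in each direction. -/
theorem Rep.wp_marks {L F : ℕ} {S : List ℕ} {U D : ℕ → Prop} {B : List ℕ}
    {f : Words} {g : Weights} {Q : ℕ → Words → Weights → Prop}
    (hR : X.Rep f S) (hL : X.n ≤ L ∧ X.m ≤ L) (hB : IsBoundaryList X S U D f B)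
    (hF : B.length ≤ F)
    (post : ∀ t f' g', Frame marks f g f' g' →
      t ≤ B.length * (20 * S.length + 30 * X.n + 43) + 3 → IsMarks X S B f' → Q t f' g') :
    WP (allowed L F X.n) marks f g Q := by
  have hBn := hB.length_le
  refine wp_forUp_const (k := B.length) (20 * S.length + 30 * X.n + 40)
    (fun j f' _ => ∀ i < j, ∀ hi : i < B.length, ∀ v < X.n,
      ((f' (.markOf, i, v) = 1 ↔ X.Reach S v B[i]) ∧
      (f' (.markOf, i, v) = 0 ∨ f' (.markOf, i, v) = 1)) ∧
      (f' (.reachOf, i, v) = 1 ↔ X.Reach S B[i] v)) (by decide) (by decide) hB.nB (by simp) ?_ ?_ ?_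
  · rintro j f' g' v h i hi hi' v' hv'
    simpa using h i hi hi' v' hv'
  · rintro j hj f' g' hfr hj' hI
    have hR0 : X.Rep f' S := hR.frame hfr (by decide)
    have hB0 : IsBoundaryList X S U D f' B := hB.frame hfr (by decide) (by decide)
    have hbj : f' (.bd, j, 0) = B[j] := arr_getElem hB0.bd hj
    have hbn : B[j] < X.n := ((hB.mem _).1 (List.getElem_mem hj)).1
    rw [wp_block_cons, wp_setW]
    refine ⟨by simp [hj']; omega, ?_⟩
    simp only [Ref.addr, WExpr.eval, hj', hbj]
    set f1 := Function.update f' (.b, 0, 0) B[j] with hf1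
    have hR1 : X.Rep f1 S := hR0.congr (by simp [f1, graphNames])
    refine WP.cons (hR1.wp_search (x := .b) isDir_bwd hL (by simp [f1]) hbn (by decide)
      (Q := fun t f' _ => t ≤ 10 * S.length + 11 * X.n + 16 ∧ ∀ v < X.n,
        (f' (.vis, v, 0) = 1 ↔ X.Reach S v B[j]) ∧ (f' (.vis, v, 0) = 0 ∨ f' (.vis, v, 0) = 1))
      fun t f' g' _ ht h => ⟨ht, fun v hv => by simpa only [reach_bwd] using h v hv⟩) ?_
    rintro t2 f2 g2 hf2 ⟨ht2, hv2⟩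
    have hR2 := hR1.frame hf2 (by decide)
    have hj2 : f2 (.j, 0, 0) = j := by rw [hf2.word _ (by decide)]; simp [f1, hj']
    have hb2 : f2 (.b, 0, 0) = B[j] := by rw [hf2.word _ (by decide)]; simp [f1]
    refine WP.cons (wp_copyRow (x := .markOf) (Q := fun t f' _ => t ≤ 4 * X.n + 3 ∧
      (∀ v < X.n, f' (.markOf, j, v) = f2 (.vis, v, 0)) ∧
      (∀ i v, i ≠ j → f' (.markOf, i, v) = f2 (.markOf, i, v)))
      hR2.n hL.1 (Or.inl rfl) hj2 (by omega) fun t f' g' _ h1 h2 h3 => ⟨h1, h2, h3⟩) ?_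
    rintro t3 f3 g3 hf3 ⟨ht3, hm3, hm3'⟩
    have hR3 := hR2.frame hf3 (by decide)
    have hj3 : f3 (.j, 0, 0) = j := by rw [hf3.word _ (by decide), hj2]
    have hb3 : f3 (.b, 0, 0) = B[j] := by rw [hf3.word _ (by decide), hb2]
    refine WP.cons (hR3.wp_search (x := .b) isDir_fwd hL hb3 hbn (by decide)
      (Q := fun t f' _ => t ≤ 10 * S.length + 11 * X.n + 16 ∧ ∀ v < X.n,
        (f' (.vis, v, 0) = 1 ↔ X.Reach S B[j] v))
      fun t f' g' _ ht h => ⟨ht, fun v hv => (h v hv).1⟩) ?_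
    rintro t4 f4 g4 hf4 ⟨ht4, hv4⟩
    have hR4 := hR3.frame hf4 (by decide)
    have hj4 : f4 (.j, 0, 0) = j := by rw [hf4.word _ (by decide), hj3]
    refine WP.cons (wp_copyRow (x := .reachOf) (Q := fun t f' _ => t ≤ 4 * X.n + 3 ∧
      (∀ v < X.n, f' (.reachOf, j, v) = f4 (.vis, v, 0)) ∧
      (∀ i v, i ≠ j → f' (.reachOf, i, v) = f4 (.reachOf, i, v)))
      hR4.n hL.1 (Or.inr rfl) hj4 (by omega) fun t f' g' _ h1 h2 h3 => ⟨h1, h2, h3⟩) ?_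
    rintro t5 f5 g5 hf5 ⟨ht5, hm5, hm5'⟩
    rw [wp_block_nil]
    refine ⟨by omega, fun i hi hi' v hv => ?_⟩
    by_cases hij : i = j
    · subst hij
      rw [hf5.word .markOf (by decide), hf4.word .markOf (by decide), hm3 v hv, hm5 v hv]
      exact ⟨hv2 v hv, hv4 v hv⟩
    · rw [hf5.word .markOf (by decide), hf4.word .markOf (by decide), hm3' i v hij, hm5' i v hij,
        hf4.word .reachOf (by decide), hf3.word .reachOf (by decide), hf2.word .reachOf (by decide),
        hf2.word .markOf (by decide)]
      simpa [f1] using hI i (by omega) hi' v hv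
  · rintro t f' g' hfr ht h
    exact post t f' g' hfr ht ⟨fun j hj v hv => (h j hj hj v hv).1,
      fun j hj v hv => (h j hj hj v hv).2⟩

end Input

end DescendantCounting

namespace DescendantCounting

/-! ### The trie -/

/-- The data from which the trie is built: `k` boundaries with the matrices of their marks and
descendants, the two vertex sets and the vertex weights. -/
structure GainData where
  n : ℕ
  k : ℕ
  mark : ℕ → ℕ → ℕ
  desc : ℕ → ℕ → ℕ
  su : ℕ → ℕ
  sd : ℕ → ℕ
  al : ℕ → ℝ
  mark_lt : ∀ j < k, ∀ v < n, mark j v < 2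

namespace GainData

variable (Y : GainData)

/-- The memory contains the data. -/
structure Holds (f : Words) (g : Weights) : Prop where
  n : f (.n, 0, 0) = Y.n
  k : f (.nB, 0, 0) = Y.k
  mark : ∀ j v, f (.markOf, j, v) = Y.mark j v
  desc : ∀ j v, f (.reachOf, j, v) = Y.desc j v
  su : ∀ v, f (.setU, v, 0) = Y.su v
  sd : ∀ v, f (.setD, v, 0) = Y.sd v
  al : ∀ v, g (.a, v, 0) = Y.al v

/-- The key of a vertex: the list of its marks. -/
def key (v : ℕ) : List ℕ := (List.range Y.k).map fun j => Y.mark j v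

open Classical in
/-- The value that belongs to a key. -/
noncomputable def value (κ : List ℕ) : ℝ :=
  ∑ x ∈ Finset.range Y.n with Y.sd x = 1 ∧ ¬ ∃ j < Y.k, κ.getD j 0 = 1 ∧ Y.desc j x = 1, Y.al x

variable {Y}

theorem Holds.frame {f f' : Words} {g g' : Weights} {St : Stmt} (h : Y.Holds f g)
    (hf : Frame St f g f' g')
    (h1 : ∀ y ∈ [W.n, .nB, .markOf, .reachOf, .setU, .setD], St.writes y = false)
    (h2 : St.writesA .a = false) : Y.Holds f' g' := by
  simp only [List.forall_mem_cons] at h1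
  obtain ⟨a1, a2, a3, a4, a5, a6, -⟩ := h1
  exact ⟨(hf.word _ a1 _ _).trans h.n, (hf.word _ a2 _ _).trans h.k,
    fun j v => (hf.word _ a3 _ _).trans (h.mark j v),
    fun j v => (hf.word _ a4 _ _).trans (h.desc j v),
    fun v => (hf.word _ a5 _ _).trans (h.su v), fun v => (hf.word _ a6 _ _).trans (h.sd v),
    fun v => (hf.weight _ h2 _ _).trans (h.al v)⟩

theorem length_key (v : ℕ) : (Y.key v).length = Y.k := by simp [key]

theorem getD_key {v j : ℕ} (hj : j < Y.k) : (Y.key v).getD j 0 = Y.mark j v := by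
  simp [key, hj]

open Classical in
theorem Holds.wp_computeGain {L F p v : ℕ} {f : Words} {g : Weights}
    {Q : ℕ → Words → Weights → Prop} (hY : Y.Holds f g) (hL : Y.n ≤ L) (hF : Y.k ≤ F)
    (hp : f (.node, 0, 0) = p) (hpL : p ≤ L) (hv : f (.v, 0, 0) = v) (hvn : v < Y.n)
    (post : ∀ t f' g', Frame computeGain f g f' g' → t ≤ Y.n * (6 * Y.k + 13) + 5 →
      g' (.gval, p, 0) = Y.value (Y.key v) →
      (∀ q, q ≠ p → g' (.gval, q, 0) = g (.gval, q, 0)) → Q t f' g') :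
    WP (allowed L F Y.n) computeGain f g Q := by
  suffices H : WP (allowed L F Y.n) computeGain f g fun t f' g' =>
      t ≤ Y.n * (6 * Y.k + 13) + 5 ∧ g' (.gval, p, 0) = Y.value (Y.key v) ∧
      ∀ q, q ≠ p → g' (.gval, q, 0) = g (.gval, q, 0) by
    exact H.frame.mono fun t f' g' ⟨h1, h2, h3, h4⟩ => post t f' g' h1 h2 h3 h4
  let P : ℕ → Prop := fun x => Y.sd x = 1 ∧ ¬ ∃ j < Y.k, (Y.key v).getD j 0 = 1 ∧ Y.desc j x = 1
  rw [computeGain, wp_block_cons, wp_setA]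
  refine ⟨by simp [hp, hpL], ?_⟩
  simp only [Ref.addr, AExpr.eval, hp]
  set g0 := Function.update g (.gval, p, 0) 0 with hg0
  have hY0 : Y.Holds f g0 := ⟨hY.n, hY.k, hY.mark, hY.desc, hY.su, hY.sd,
    fun v => by simpa [g0] using hY.al v⟩
  rw [wp_block_cons]
  refine wp_forUp_const (k := Y.n) (6 * Y.k + 10) (fun k f' g' =>
    g' (.gval, p, 0) = ∑ x ∈ Finset.range k with P x, Y.al x ∧
      ∀ q, q ≠ p → g' (.gval, q, 0) = g (.gval, q, 0)) (by decide) (by decide) hY.n ?_ ?_ ?_ ?_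
  · refine ⟨by simp [g0], fun q hq => by simp [g0, hq]⟩
  · exact fun k f' g' v h => h
  · rintro k hk f' g' hfr hx ⟨h1, h2⟩
    have hY' : Y.Holds f' g' := hY0.frame hfr (by decide) (by decide)
    have hp' : f' (.node, 0, 0) = p := by rw [hfr.word _ (by decide), hp]
    have hv' : f' (.v, 0, 0) = v := by rw [hfr.word _ (by decide), hv]
    have hsum : ∑ x ∈ Finset.range (k + 1) with P x, Y.al x =
        (∑ x ∈ Finset.range k with P x, Y.al x) + if P k then Y.al k else 0 := by
      rw [Finset.range_add_one, Finset.filter_insert]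
      split_ifs with h
      · rw [Finset.sum_insert (by simp), add_comm]
      · simp
    have hskip : ¬ P k → g' (.gval, p, 0) = ∑ x ∈ Finset.range (k + 1) with P x, Y.al x ∧
        ∀ q, q ≠ p → g' (.gval, q, 0) = g (.gval, q, 0) := by
      intro h
      rw [hsum, if_neg h, add_zero]
      exact ⟨h1, h2⟩
    rw [wp_ite]
    refine ⟨by simp [hx]; omega, ?_⟩
    by_cases hsd : Y.sd k = 1
    swap
    · rw [if_neg (by simp [hx, hY'.sd, hsd]), wp_skip]
      exact ⟨by omega, hskip fun h => hsd h.1⟩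
    rw [if_pos (by simp [hx, hY'.sd, hsd]), wp_block_cons, wp_setW]
    refine ⟨by simp, ?_⟩
    simp only [Ref.addr, WExpr.eval]
    set f1 := Function.update f' (.cov, 0, 0) 0 with hf1
    have hY1 : Y.Holds f1 g' := ⟨by simpa [f1] using hY'.n, by simpa [f1] using hY'.k,
      fun j v => by simpa [f1] using hY'.mark j v, fun j v => by simpa [f1] using hY'.desc j v,
      fun v => by simpa [f1] using hY'.su v, fun v => by simpa [f1] using hY'.sd v, hY'.al⟩
    have hcov : WP (allowed L F Y.n) (forUp .j (val .nB)
        (when (.eq (.get (.mat .markOf .j .v)) (.lit 1))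
          (when (.eq (.get (.mat .reachOf .j .x)) (.lit 1)) (assign .cov (.lit 1))))) f1 g'
        fun t f'' g'' => t ≤ Y.k * (3 + 3) + 3 ∧ g'' = g' ∧ f'' (.cov, 0, 0) =
          if ∃ j < Y.k, (Y.key v).getD j 0 = 1 ∧ Y.desc j k = 1 then 1 else 0 := by
      refine wp_forUp_const (k := Y.k) 3 (fun j f'' g'' => g'' = g' ∧ f'' (.cov, 0, 0) =
          if ∃ i < j, (Y.key v).getD i 0 = 1 ∧ Y.desc i k = 1 then 1 else 0)
          (by decide) (by decide) hY1.k ?_ ?_ ?_ ?_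
      · exact ⟨rfl, by simp [f1]⟩
      · rintro j f'' g'' v ⟨h1, h2⟩
        refine ⟨h1, ?_⟩
        rw [Function.update_of_ne (by decide)]
        exact h2
      · rintro j hj f'' g'' hfr2 hj' ⟨rfl, h⟩
        have hY2 : Y.Holds f'' g'' := hY1.frame hfr2
          (by simp [forUp, block, Stmt.writes, Ref.name]) (by decide)
        have hv2 : f'' (.v, 0, 0) = v := by rw [hfr2.word _ (by decide)]; simp [f1, hv']
        have hx2 : f'' (.x, 0, 0) = k := by rw [hfr2.word _ (by decide)]; simp [f1, hx]
        have hstep : (∃ i < j + 1, (Y.key v).getD i 0 = 1 ∧ Y.desc i k = 1) ↔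
            (∃ i < j, (Y.key v).getD i 0 = 1 ∧ Y.desc i k = 1) ∨
              Y.mark j v = 1 ∧ Y.desc j k = 1 := by
          rw [← getD_key (v := v) hj]
          constructor
          · rintro ⟨i, hi, hi'⟩
            rcases Nat.lt_succ_iff_lt_or_eq.1 hi with hi | rfl
            · exact Or.inl ⟨i, hi, hi'⟩
            · exact Or.inr hi'
          · rintro (⟨i, hi, hi'⟩ | hi')
            · exact ⟨i, by omega, hi'⟩
            · exact ⟨j, by omega, hi'⟩
        rw [wp_ite]
        refine ⟨by simp [hj', hv2, hvn]; omega, ?_⟩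
        by_cases hm : Y.mark j v = 1
        swap
        · rw [if_neg (by simp [hj', hv2, hY2.mark, hm]), wp_skip]
          refine ⟨by omega, rfl, ?_⟩
          rw [h]
          exact if_congr (by rw [hstep]; simp [hm]) rfl rfl
        rw [if_pos (by simp [hj', hv2, hY2.mark, hm]), wp_ite]
        refine ⟨by simp [hj', hx2, hk]; omega, ?_⟩
        by_cases hr : Y.desc j k = 1
        swap
        · rw [if_neg (by simp [hj', hx2, hY2.desc, hr]), wp_skip]
          refine ⟨by omega, rfl, ?_⟩
          rw [h]
          exact if_congr (by rw [hstep]; simp [hr]) rfl rfl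
        rw [if_pos (by simp [hj', hx2, hY2.desc, hr]), wp_setW]
        refine ⟨by simp, by omega, rfl, ?_⟩
        rw [if_pos (hstep.2 (Or.inr ⟨hm, hr⟩))]
        simp
      · rintro t f'' g'' - ht h
        exact ⟨ht, h⟩
    refine hcov.cons ?_
    rintro t f2 g2 hf2 ⟨ht, rfl, hc⟩
    have hp2 : f2 (.node, 0, 0) = p := by rw [hf2.word _ (by decide)]; simp [f1, hp']
    have hx2 : f2 (.x, 0, 0) = k := by rw [hf2.word _ (by decide)]; simp [f1, hx]
    rw [wp_block_cons, wp_ite]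
    refine ⟨by simp, ?_⟩
    by_cases hex : ∃ j < Y.k, (Y.key v).getD j 0 = 1 ∧ Y.desc j k = 1
    · rw [if_pos hex] at hc
      rw [if_neg (by simp [hc]), wp_skip, wp_block_nil]
      exact ⟨by omega, hskip fun h => h.2 hex⟩
    · rw [if_neg hex] at hc
      rw [if_pos (by simp [hc]), wp_setA, wp_block_nil]
      refine ⟨by simp [hp2, hx2, hpL]; omega, by omega, ?_, ?_⟩
      · simp only [Ref.addr, AExpr.eval, hp2, hx2, Function.update_self]
        rw [hsum, if_pos ⟨hsd, hex⟩, h1, hY'.al]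
      · intro q hq
        simp only [Ref.addr, hp2]
        rw [Function.update_of_ne (by simp [hq]), h2 q hq]
  · rintro t f' g' - ht ⟨h1, h2⟩
    rw [wp_block_nil]
    refine ⟨?_, h1, h2⟩
    have e : Y.n * (6 * Y.k + 10 + 3) = Y.n * (6 * Y.k + 13) := rfl
    omega

open Classical in
/-- The trie has nodes `0, …, N - 1`, where the node `p` is found from the root along the edges with
the labels in the list `ℓ p`. The nodes with labels in `K` contain values. -/
structure Trie (Y : GainData) (f : Words) (g : Weights) (N : ℕ) (ℓ : ℕ → List ℕ)
    (K : Finset (List ℕ)) : Prop where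
  nNode : f (.nNode, 0, 0) = N
  pos : 0 < N
  root : ℓ 0 = []
  child : ∀ p < N, ∀ b < 2, f (.child, b, p) ≠ 0 →
    f (.child, b, p) < N ∧ ℓ (f (.child, b, p)) = ℓ p ++ [b]
  parent : ∀ c < N, c ≠ 0 → ∃ p < N, ∃ b < 2, f (.child, b, p) = c
  inj : ∀ c < N, ∀ c' < N, ℓ c = ℓ c' → c = c'
  has : ∀ p < N, f (.has, p, 0) = if ℓ p ∈ K then 1 else 0
  keys : ∀ κ ∈ K, ∃ p < N, ℓ p = κ
  gval : ∀ p < N, ℓ p ∈ K → g (.gval, p, 0) = Y.value (ℓ p)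

theorem Trie.congr {f f' : Words} {g g' : Weights} {N : ℕ} {ℓ : ℕ → List ℕ} {K : Finset (List ℕ)}
    (h : Trie Y f g N ℓ K) (h1 : f' (.nNode, 0, 0) = f (.nNode, 0, 0))
    (h2 : ∀ b p, f' (.child, b, p) = f (.child, b, p))
    (h3 : ∀ p, f' (.has, p, 0) = f (.has, p, 0))
    (h4 : ∀ p, g' (.gval, p, 0) = g (.gval, p, 0)) : Trie Y f' g' N ℓ K := by
  refine ⟨h1.trans h.nNode, h.pos, h.root, ?_, ?_, h.inj, ?_, h.keys, ?_⟩
  · simpa only [h2] using h.child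
  · simpa only [h2] using h.parent
  · simpa only [h3] using h.has
  · simpa only [h4] using h.gval

/-- A missing child is not found elsewhere in the trie. -/
theorem Trie.label_ne {f : Words} {g : Weights} {N : ℕ} {ℓ : ℕ → List ℕ} {K : Finset (List ℕ)}
    (h : Trie Y f g N ℓ K) {p b : ℕ} (hp : p < N) (hpb : f (.child, b, p) = 0) {c : ℕ}
    (hc : c < N) :
    ℓ c ≠ ℓ p ++ [b] := by
  intro hcl
  by_cases hc0 : c = 0
  · rw [hc0, h.root] at hcl
    simp at hcl
  · obtain ⟨p', hp', b', hb', hch⟩ := h.parent c hc hc0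
    have h1 := (h.child p' hp' b' hb' (by rw [hch]; exact hc0)).2
    rw [hch, hcl] at h1
    obtain ⟨h2, h3⟩ := List.append_inj' h1 rfl
    have h4 := h.inj p hp p' hp' h2
    have h5 : b = b' := by simpa using h3
    subst h4 h5
    exact hc0 (hch ▸ hpb)

/-- The new node `N` becomes the child of `p` with label `b`. -/
theorem Trie.insert {f f' : Words} {g : Weights} {N : ℕ} {ℓ : ℕ → List ℕ} {K : Finset (List ℕ)}
    (h : Trie Y f g N ℓ K) {p b : ℕ} (hp : p < N) (hb : b < 2) (hpb : f (.child, b, p) = 0)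
    (h1 : f' (.nNode, 0, 0) = N + 1)
    (h2 : ∀ i < 2, ∀ q, f' (.child, i, q) =
      if q = N then 0 else if q = p ∧ i = b then N else f (.child, i, q))
    (h3 : ∀ q, f' (.has, q, 0) = if q = N then 0 else f (.has, q, 0)) :
    Trie Y f' g (N + 1) (Function.update ℓ N (ℓ p ++ [b])) K := by
  have hℓ : ∀ q < N, Function.update ℓ N (ℓ p ++ [b]) q = ℓ q := fun q hq =>
    Function.update_of_ne hq.ne _ _
  have hK : ℓ p ++ [b] ∉ K := by
    intro hmem
    obtain ⟨c, hc, hcl⟩ := h.keys _ hmem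
    exact h.label_ne hp hpb hc hcl
  have hN : ∀ q, q < N + 1 → q ≠ N → q < N := fun q h1 h2 => by omega
  have hpos := h.pos
  refine ⟨h1, by omega, by rw [hℓ 0 h.pos, h.root], ?_, ?_, ?_, ?_, ?_, ?_⟩
  · intro q hq i hi
    rw [h2 i hi]
    split_ifs with e1 e2
    · simp
    · intro _
      rw [e2.1, e2.2, Function.update_self, hℓ p hp]
      exact ⟨by omega, rfl⟩
    · intro hne
      obtain ⟨a1, a2⟩ := h.child q (hN q hq e1) i hi hne
      rw [hℓ _ a1, hℓ _ (hN q hq e1)]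
      exact ⟨by omega, a2⟩
  · intro c hc hc0
    by_cases hcN : c = N
    · refine ⟨p, by omega, b, hb, ?_⟩
      rw [h2 b hb, if_neg (by omega), if_pos ⟨rfl, rfl⟩, hcN]
    · obtain ⟨q, hq, i, hi, hch⟩ := h.parent c (hN c hc hcN) hc0
      refine ⟨q, by omega, i, hi, ?_⟩
      rw [h2 i hi, if_neg (by omega), if_neg, hch]
      rintro ⟨rfl, rfl⟩
      exact hc0 (hch ▸ hpb)
  · intro c hc c' hc' hcc
    by_cases hcN : c = N <;> by_cases hcN' : c' = N
    · rw [hcN, hcN']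
    · rw [hcN, Function.update_self, hℓ c' (hN _ hc' hcN')] at hcc
      exact absurd hcc.symm (h.label_ne hp hpb (hN _ hc' hcN'))
    · rw [hcN', Function.update_self, hℓ c (hN _ hc hcN)] at hcc
      exact absurd hcc (h.label_ne hp hpb (hN _ hc hcN))
    · rw [hℓ c (hN _ hc hcN), hℓ c' (hN _ hc' hcN')] at hcc
      exact h.inj c (hN _ hc hcN) c' (hN _ hc' hcN') hcc
  · intro q hq
    rw [h3]
    by_cases hqN : q = N
    · rw [if_pos hqN, hqN, Function.update_self, if_neg hK]
    · rw [if_neg hqN, hℓ q (hN q hq hqN), h.has q (hN q hq hqN)]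
  · intro κ hκ
    obtain ⟨q, hq, hql⟩ := h.keys κ hκ
    exact ⟨q, by omega, by rw [hℓ q hq, hql]⟩
  · intro q hq hqK
    by_cases hqN : q = N
    · rw [hqN, Function.update_self] at hqK
      exact absurd hqK hK
    · rw [hℓ q (hN q hq hqN)] at hqK ⊢
      exact h.gval q (hN q hq hqN) hqK

open Classical in
/-- A value is stored in the node `p`. -/
theorem Trie.setValue {f f' : Words} {g g' : Weights} {N : ℕ} {ℓ : ℕ → List ℕ}
    {K : Finset (List ℕ)} (h : Trie Y f g N ℓ K) {p : ℕ} (hp : p < N)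
    (h1 : f' (.nNode, 0, 0) = f (.nNode, 0, 0)) (h2 : ∀ b p, f' (.child, b, p) = f (.child, b, p))
    (h3 : ∀ q, f' (.has, q, 0) = if q = p then 1 else f (.has, q, 0))
    (h4 : g' (.gval, p, 0) = Y.value (ℓ p))
    (h5 : ∀ q, q ≠ p → g' (.gval, q, 0) = g (.gval, q, 0)) :
    Trie Y f' g' N ℓ (Insert.insert (ℓ p) K) := by
  refine ⟨h1.trans h.nNode, h.pos, h.root, ?_, ?_, h.inj, ?_, ?_, ?_⟩
  · simpa only [h2] using h.child
  · simpa only [h2] using h.parent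
  · intro q hq
    rw [h3]
    by_cases hqp : q = p
    · simp [hqp]
    · rw [if_neg hqp, h.has q hq]
      refine if_congr ?_ rfl rfl
      rw [Finset.mem_insert, or_iff_right]
      exact fun hl => hqp (h.inj q hq p hp hl)
  · intro κ hκ
    rcases Finset.mem_insert.1 hκ with rfl | hκ
    · exact ⟨p, hp, rfl⟩
    · exact h.keys κ hκ
  · intro q hq hqK
    by_cases hqp : q = p
    · rw [hqp, h4]
    · rw [h5 q hqp]
      refine h.gval q hq ((Finset.mem_insert.1 hqK).resolve_left fun hl => hqp (h.inj q hq p hp hl))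

/-- The loop that descends in the trie along the key of `v`, where it adds missing nodes. -/
def descend : Stmt := forUp .j (val .nB) (block
  [ assign .bit (.get (.mat .markOf .j .v)),
    when (.eq (.get (.mat .child .bit .node)) (.lit 0)) (block
      [ .setW (.mat .child .bit .node) (val .nNode), newNode ]),
    assign .node (.get (.mat .child .bit .node)) ])

/-- The descent ends in the node whose label is the key of `v`, and it adds at most one node for
every bit of the key. -/
theorem Holds.wp_descend {L F v N : ℕ} {ℓ : ℕ → List ℕ} {K : Finset (List ℕ)} {f : Words}
    {g : Weights} {Q : ℕ → Words → Weights → Prop} (hY : Y.Holds f g) (hF : Y.k ≤ F)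
    (hnode : f (.node, 0, 0) = 0) (hv : f (.v, 0, 0) = v) (hvn : v < Y.n)
    (hzero : f (.zero, 0, 0) = 0) (hone : f (.one, 0, 0) = 1)
    (hT : Trie Y f g N ℓ K) (hNL : N + Y.k ≤ L + 1)
    (post : ∀ t f' N' ℓ', Frame descend f g f' g → t ≤ 14 * Y.k + 3 → Trie Y f' g N' ℓ' K →
      N' ≤ N + Y.k → N ≤ N' → (∀ q < N, ℓ' q = ℓ q) → f' (.node, 0, 0) < N' →
      ℓ' (f' (.node, 0, 0)) = Y.key v → Q t f' g) :
    WP (allowed L F Y.n) descend f g Q := by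
  refine wp_forUp_const (k := Y.k) 11 (fun j f' g' => g' = g ∧ ∃ N' ℓ', Trie Y f' g N' ℓ' K ∧
    N' ≤ N + j ∧ N ≤ N' ∧ (∀ q < N, ℓ' q = ℓ q) ∧ f' (.node, 0, 0) < N' ∧
    ℓ' (f' (.node, 0, 0)) = (Y.key v).take j) (by decide) (by decide) hY.k ?_ ?_ ?_ ?_
  · exact ⟨rfl, N, ℓ, hT, le_rfl, le_rfl, fun _ _ => rfl, by rw [hnode]; exact hT.pos,
      by rw [hnode, hT.root]; simp⟩
  · rintro j f' g' x ⟨rfl, N', ℓ', h1, h2, h3, h4, h5, h6⟩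
    exact ⟨rfl, N', ℓ', h1.congr (by simp) (by simp) (by simp) (by simp), h2, h3, h4,
      by simpa using h5, by simpa using h6⟩
  · rintro j hj f' g' hfr hj' ⟨rfl, N', ℓ', h1, h2, h3, h4, h5, h6⟩
    have hY' : Y.Holds f' g' := hY.frame hfr (by decide) (by decide)
    have hv' : f' (.v, 0, 0) = v := by rw [hfr.word _ (by decide), hv]
    have hz' : f' (.zero, 0, 0) = 0 := by rw [hfr.word _ (by decide), hzero]
    have ho' : f' (.one, 0, 0) = 1 := by rw [hfr.word _ (by decide), hone]
    have hb := Y.mark_lt j hj v hvn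
    have htake : (Y.key v).take (j + 1) = (Y.key v).take j ++ [Y.mark j v] := by
      rw [List.take_succ_eq_append_getElem (by rw [length_key]; exact hj)]
      simp [key]
    generalize hp : f' (.node, 0, 0) = p at h5 h6
    generalize hbit : Y.mark j v = b at hb htake
    rw [wp_block_cons, wp_setW]
    refine ⟨by simp [hj', hv', hvn]; omega, ?_⟩
    simp only [Ref.addr, WExpr.eval, hj', hv', hY'.mark, hbit]
    set f1 := Function.update f' (.bit, 0, 0) b with hf1
    have hp1 : f1 (.node, 0, 0) = p := by simp [f1, hp]
    have hb1 : f1 (.bit, 0, 0) = b := by simp [f1]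
    have hT1 : Trie Y f1 g' N' ℓ' K := h1.congr (by simp [f1]) (by simp [f1]) (by simp [f1])
      (by simp)
    rw [wp_block_cons, wp_ite]
    refine ⟨by simp [hp1, hb1]; omega, ?_⟩
    by_cases hch : f1 (.child, b, p) = 0
    · rw [if_pos (by simp [hp1, hb1, hch])]
      simp only [newNode, wp_block_cons, wp_setW, wp_block_nil]
      simp only [Ref.addr, WExpr.eval, hp1, hb1, hT1.nNode, Function.update_self, ne_eq,
        Prod.mk.injEq, reduceCtorEq, false_and, not_false_eq_true, Function.update_of_ne,
        Ref.wordCells, Ref.indexCells, WExpr.cells, Finset.union_subset_iff,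
        Finset.insert_subset_iff, Finset.singleton_subset_iff, Finset.empty_subset,
        inl_mem_allowed, and_true, true_and, or_false, false_or, Nat.zero_le]
      have hz1 : f1 (.zero, 0, 0) = 0 := by simp [f1, hz']
      have ho1 : f1 (.one, 0, 0) = 1 := by simp [f1, ho']
      simp only [hz1, ho1]
      have hcl : Function.update (Function.update (Function.update f1 (.child, b, p) N')
          (.child, 0, N') 0) (.child, 1, N') 0 (.child, b, p) = N' := by
        have hpN : p ≠ N' := by omega
        simp [hpN]
      refine ⟨by omega, by omega, by omega, by omega, by omega, by omega, ?_⟩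
      have hins := hT1.insert h5 hb hch (f' := Function.update (Function.update (Function.update
        (Function.update (Function.update (Function.update f1 (.child, b, p) N') (.child, 0, N') 0)
          (.child, 1, N') 0) (.has, N', 0) 0) (.nNode, 0, 0) (N' + 1)) (.node, 0, 0) N')
          (by simp) ?_ ?_
      · rw [hcl]
        refine ⟨N' + 1, _, hins, by omega, by omega, ?_, by omega, ?_⟩
        · intro q hq
          rw [Function.update_of_ne (by omega), h4 q hq]
        · simp [htake, h6]
      · intro i hi q
        have hi : i = 0 ∨ i = 1 := by omega
        rcases hi with rfl | rfl <;> by_cases hqN : q = N' <;>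
          simp [Function.update_apply, hqN, and_comm]
      · intro q
        by_cases hqN : q = N' <;> simp [hqN]
    · rw [if_neg (by simp [hp1, hb1, hch])]
      simp only [wp_skip, wp_block_cons, wp_block_nil, wp_setW]
      obtain ⟨hc1, hc2⟩ := hT1.child p h5 b hb hch
      refine ⟨by simp [hp1, hb1]; omega, by omega, by simp, N', ℓ',
        hT1.congr (by simp) (by simp) (by simp) (by simp), by omega, h3, h4, ?_, ?_⟩
      · simpa [hp1, hb1] using hc1
      · simp only [Ref.addr, WExpr.eval, hp1, hb1, Function.update_self]
        rw [hc2, htake, h6]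
  · rintro t f' g' hfr ht ⟨rfl, N', ℓ', h1, h2, h3, h4, h5, h6⟩
    rw [List.take_of_length_le (by rw [length_key])] at h6
    exact post t f' N' ℓ' hfr (by omega) h1 h2 h3 h4 h5 h6

open Classical in
/-- The values are computed only once for every key, and for all other vertices of `setU` the trie
is only searched. -/
theorem Holds.wp_gains {L F : ℕ} {f : Words} {g : Weights} {Q : ℕ → Words → Weights → Prop}
    (hY : Y.Holds f g) (hL : Y.n ≤ L) (hF : Y.k ≤ F) (hNL : Y.n * Y.k ≤ L)
    (post : ∀ t f' g', Frame gains f g f' g' →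
      t ≤ Y.n * (14 * Y.k + 20) + (({v ∈ Finset.range Y.n | Y.su v = 1}).image Y.key).card *
        (Y.n * (6 * Y.k + 13) + 10) + 20 →
      (∀ v < Y.n, Y.su v = 1 → f' (.leaf, v, 0) ≤ L ∧
        g' (.gval, f' (.leaf, v, 0), 0) = Y.value (Y.key v)) → Q t f' g') :
    WP (allowed L F Y.n) gains f g Q := by
  suffices H : WP (allowed L F Y.n) gains f g fun t f' g' =>
      t ≤ Y.n * (14 * Y.k + 20) + (({v ∈ Finset.range Y.n | Y.su v = 1}).image Y.key).card *
        (Y.n * (6 * Y.k + 13) + 10) + 20 ∧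
      ∀ v < Y.n, Y.su v = 1 → f' (.leaf, v, 0) ≤ L ∧
        g' (.gval, f' (.leaf, v, 0), 0) = Y.value (Y.key v) by
    exact H.frame.mono fun t f' g' ⟨h1, h2, h3⟩ => post t f' g' h1 h2 h3
  let keys : ℕ → Finset (List ℕ) := fun j => ({v ∈ Finset.range j | Y.su v = 1}).image Y.key
  have hkeys : ∀ j, keys (j + 1) =
      if Y.su j = 1 then Insert.insert (Y.key j) (keys j) else keys j := by
    intro j
    simp only [keys, Finset.range_add_one, Finset.filter_insert]
    split_ifs
    · rw [Finset.image_insert]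
    · rfl
  simp only [gains, wp_block_cons, wp_setW, Ref.addr, WExpr.eval]
  refine ⟨by simp, by simp, by simp, ?_⟩
  set f0 := Function.update (Function.update (Function.update f (.zero, 0, 0) 0) (.one, 0, 0) 1)
    (.nNode, 0, 0) 0 with hf0
  have hinit : WP (allowed L F Y.n) newNode f0 g fun t f' g' => t = 5 ∧ g' = g ∧
      Trie Y f' g' 1 (fun _ => []) ∅ := by
    simp only [newNode, wp_block_cons, wp_setW, wp_block_nil]
    refine ⟨by simp [f0], by simp [f0], by simp [f0], by simp, trivial, trivial, by simp [f0],
      by omega, rfl, ?_, by omega, fun c hc c' hc' _ => by omega, ?_, by simp, by simp⟩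
    · intro p hp b hb h
      obtain rfl : p = 0 := by omega
      have : b = 0 ∨ b = 1 := by omega
      rcases this with rfl | rfl <;> simp [f0] at h
    · intro p hp
      obtain rfl : p = 0 := by omega
      simp [f0]
  have hY0 : Y.Holds f0 g := ⟨by simpa [f0] using hY.n, by simpa [f0] using hY.k,
    fun j v => by simpa [f0] using hY.mark j v, fun j v => by simpa [f0] using hY.desc j v,
    fun v => by simpa [f0] using hY.su v, fun v => by simpa [f0] using hY.sd v, hY.al⟩
  refine hinit.frame.mono ?_
  rintro t1 f1 g1 ⟨hf1, rfl, rfl, hT1⟩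
  have hY1 : Y.Holds f1 g1 := hY0.frame hf1 (by decide) (by decide)
  have hz1 : f1 (.zero, 0, 0) = 0 := by rw [hf1.word _ (by decide)]; simp [f0]
  have ho1 : f1 (.one, 0, 0) = 1 := by rw [hf1.word _ (by decide)]; simp [f0]
  refine wp_forUp (k := Y.n) (fun j t f' g' => t ≤ j * (14 * Y.k + 20) +
    (keys j).card * (Y.n * (6 * Y.k + 13) + 10) ∧ ∃ N ℓ, Trie Y f' g' N ℓ (keys j) ∧
    N ≤ 1 + j * Y.k ∧ ∀ v < j, Y.su v = 1 → f' (.leaf, v, 0) < N ∧ ℓ (f' (.leaf, v, 0)) = Y.key v)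
    (by decide) (by decide) hY1.n ⟨by simp, 1, _, hT1, by simp, by simp⟩ ?_ ?_ ?_
  · rintro j t f' g' v ⟨h1, N, ℓ, h2, h3, h4⟩
    exact ⟨h1, N, ℓ, h2.congr (by simp) (by simp) (by simp) (by simp), h3, by simpa using h4⟩
  · rintro j hj t f' g' hfr hv ⟨ht, N, ℓ, hT, hN, hleaf⟩
    have hY' : Y.Holds f' g' := hY1.frame hfr (by decide) (by decide)
    have hz' : f' (.zero, 0, 0) = 0 := by rw [hfr.word _ (by decide), hz1]
    have ho' : f' (.one, 0, 0) = 1 := by rw [hfr.word _ (by decide), ho1]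
    have hmul : j * Y.k + Y.k ≤ Y.n * Y.k := by
      rw [← Nat.succ_mul]; exact Nat.mul_le_mul_right _ hj
    have hjs : (j + 1) * (14 * Y.k + 20) = j * (14 * Y.k + 20) + (14 * Y.k + 20) := Nat.succ_mul _ _
    have hjs' : (j + 1) * Y.k = j * Y.k + Y.k := Nat.succ_mul _ _
    rw [wp_ite]
    refine ⟨by simp [hv]; omega, ?_⟩
    by_cases hsu : Y.su j = 1
    swap
    · rw [if_neg (by simp [hv, hY'.su, hsu]), wp_skip, hkeys, if_neg hsu]
      refine ⟨by omega, N, ℓ, hT, by omega, fun v hv' hsv => ?_⟩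
      refine hleaf v (Nat.lt_of_le_of_ne (Nat.lt_succ_iff.1 hv') ?_) hsv
      rintro rfl
      exact hsu hsv
    rw [if_pos (by simp [hv, hY'.su, hsu]), wp_block_cons, wp_setW]
    refine ⟨by simp, ?_⟩
    simp only [Ref.addr, WExpr.eval]
    set f2 := Function.update f' (.node, 0, 0) 0 with hf2
    have hY2 : Y.Holds f2 g' := ⟨by simpa [f2] using hY'.n, by simpa [f2] using hY'.k,
      fun j v => by simpa [f2] using hY'.mark j v, fun j v => by simpa [f2] using hY'.desc j v,
      fun v => by simpa [f2] using hY'.su v, fun v => by simpa [f2] using hY'.sd v, hY'.al⟩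
    have hT2 : Trie Y f2 g' N ℓ (keys j) := hT.congr (by simp [f2]) (by simp [f2]) (by simp [f2])
      (by simp)
    refine WP.cons (S := descend) (hY2.wp_descend (L := L) (Q := fun t f'' g'' => g'' = g' ∧
      t ≤ 14 * Y.k + 3 ∧ ∃ N' ℓ', Trie Y f'' g' N' ℓ' (keys j) ∧ N' ≤ N + Y.k ∧ N ≤ N' ∧
      (∀ q < N, ℓ' q = ℓ q) ∧ f'' (.node, 0, 0) < N' ∧ ℓ' (f'' (.node, 0, 0)) = Y.key j) hF
      (by simp [f2]) (by simpa [f2] using hv) hj (by simpa [f2] using hz') (by simpa [f2] using ho')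
      hT2 (by omega)
      fun t f' N' ℓ' _ h1 h2 h3 h4 h5 h6 h7 => ⟨rfl, h1, N', ℓ', h2, h3, h4, h5, h6, h7⟩) ?_
    rintro t3 f3 g3 hf3 ⟨rfl, ht3, N', ℓ', hT3, hN', hNN', hℓ', hnode, hnodeℓ⟩
    have hY3 : Y.Holds f3 g3 := hY2.frame hf3 (by decide) (by decide)
    have hv3 : f3 (.v, 0, 0) = j := by rw [hf3.word _ (by decide)]; simp [f2, hv]
    have hleaf3 : ∀ v, f3 (.leaf, v, 0) = f' (.leaf, v, 0) := fun v => by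
      rw [hf3.word _ (by decide)]; simp [f2]
    generalize hp : f3 (.node, 0, 0) = p at hnode hnodeℓ
    have hhas := hT3.has p hnode
    rw [hnodeℓ] at hhas
    -- the conclusion, after the value for the key of `v` has been provided
    have hend : ∀ (t4 : ℕ) (f4 : Words) (g4 : Weights), Trie Y f4 g4 N' ℓ' (keys (j + 1)) →
        f4 (.v, 0, 0) = j → f4 (.node, 0, 0) = p →
        (∀ v, f4 (.leaf, v, 0) = f3 (.leaf, v, 0)) →
        t4 + t + 14 * Y.k + 11 ≤ (j + 1) * (14 * Y.k + 20) +
          (keys (j + 1)).card * (Y.n * (6 * Y.k + 13) + 10) →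
        WP (allowed L F Y.n) (block [put .leaf .v (val .node)]) f4 g4 fun t' f'' g'' =>
          t + (1 + (1 + (t3 + (t4 + t')))) + 3 ≤ (j + 1) * (14 * Y.k + 20) +
            (keys (j + 1)).card * (Y.n * (6 * Y.k + 13) + 10) ∧
          ∃ N ℓ, Trie Y f'' g'' N ℓ (keys (j + 1)) ∧ N ≤ 1 + (j + 1) * Y.k ∧
            ∀ v < j + 1, Y.su v = 1 → f'' (.leaf, v, 0) < N ∧ ℓ (f'' (.leaf, v, 0)) = Y.key v := by
      intro t4 f4 g4 hT4 hv4 hp4 hleaf4 ht4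
      simp only [wp_block_cons, wp_setW, wp_block_nil]
      refine ⟨by simp [hv4]; omega, by omega, N', ℓ', hT4.congr (by simp) (by simp) (by simp)
        (by simp), by omega, fun v hv' hsv => ?_⟩
      simp only [Ref.addr, WExpr.eval, hv4, hp4]
      by_cases hvj : v = j
      · rw [hvj, Function.update_self]
        exact ⟨hnode, hnodeℓ⟩
      · rw [Function.update_of_ne (by simp [hvj]), hleaf4, hleaf3]
        obtain ⟨h1, h2⟩ := hleaf v (by omega) hsv
        exact ⟨by omega, by rw [hℓ' _ h1, h2]⟩
    rw [wp_block_cons, wp_ite]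
    refine ⟨by simp [hp]; omega, ?_⟩
    by_cases hmem : Y.key j ∈ keys j
    · have hk : keys (j + 1) = keys j := by rw [hkeys, if_pos hsu, Finset.insert_eq_of_mem hmem]
      rw [if_pos hmem] at hhas
      rw [if_neg (by simp [hp, hhas]), wp_skip]
      exact hend _ f3 g3 (hk ▸ hT3) hv3 hp (fun _ => rfl) (by rw [hk]; omega)
    · have hk : keys (j + 1) = Insert.insert (Y.key j) (keys j) := by rw [hkeys, if_pos hsu]
      have hcard : (keys (j + 1)).card * (Y.n * (6 * Y.k + 13) + 10) =
          (keys j).card * (Y.n * (6 * Y.k + 13) + 10) + (Y.n * (6 * Y.k + 13) + 10) := by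
        rw [hk, Finset.card_insert_of_notMem hmem, Nat.succ_mul]
      rw [if_neg hmem] at hhas
      rw [if_pos (by simp [hp, hhas]), wp_block_cons, wp_setW]
      refine ⟨by simp [hp]; omega, ?_⟩
      simp only [Ref.addr, WExpr.eval, hp]
      set f4 := Function.update f3 (.has, p, 0) 1 with hf4
      have hY4 : Y.Holds f4 g3 := ⟨by simpa [f4] using hY3.n, by simpa [f4] using hY3.k,
        fun j v => by simpa [f4] using hY3.mark j v, fun j v => by simpa [f4] using hY3.desc j v,
        fun v => by simpa [f4] using hY3.su v, fun v => by simpa [f4] using hY3.sd v, hY3.al⟩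
      refine WP.cons (hY4.wp_computeGain (L := L) (p := p) (v := j) (Q := fun t f' g' =>
        t ≤ Y.n * (6 * Y.k + 13) + 5 ∧ g' (.gval, p, 0) = Y.value (Y.key j) ∧
        ∀ q, q ≠ p → g' (.gval, q, 0) = g3 (.gval, q, 0)) hL hF (by simp [f4, hp]) (by omega)
        (by simp [f4, hv3]) hj fun t f' g' _ h1 h2 h3 => ⟨h1, h2, h3⟩) ?_
      rintro t5 f5 g5 hf5 ⟨ht5, hval, hother⟩
      rw [wp_block_nil]
      refine hend _ f5 g5 ?_ ?_ ?_ ?_ (by rw [hcard]; omega)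
      · rw [hk, ← hnodeℓ]
        refine hT3.setValue hnode ?_ ?_ ?_ (by rw [hval, hnodeℓ]) hother
        · rw [hf5.word _ (by decide)]; simp [f4]
        · intro b q; rw [hf5.word _ (by decide)]; simp [f4]
        · intro q; rw [hf5.word _ (by decide)]; simp [f4, Function.update_apply]
      · rw [hf5.word _ (by decide)]; simp [f4, hv3]
      · rw [hf5.word _ (by decide)]; simp [f4, hp]
      · intro v; rw [hf5.word _ (by decide)]; simp [f4]
  · rintro t f' g' - ⟨ht, N, ℓ, hT, hN, hleaf⟩
    rw [wp_block_nil]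
    refine ⟨?_, fun v hv hsv => ?_⟩
    · change t ≤ _ + (keys Y.n).card * _ at ht
      change _ ≤ _ + (keys Y.n).card * _ + _
      omega
    · obtain ⟨h1, h2⟩ := hleaf v hv hsv
      refine ⟨by omega, ?_⟩
      rw [hT.gval _ h1, h2]
      rw [h2]
      exact Finset.mem_image_of_mem _ (by simp [hv, hsv])

end GainData

end DescendantCounting

namespace DescendantCounting

open Relation

namespace Input

variable {X : Input}

/-! ### The spanning polyforest -/

/-- The edges that are marked in the array `inT`. -/
def forest (X : Input) (f : Words) : Finset ℕ := {e ∈ Finset.range X.m | f (.inT, e, 0) = 1}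

theorem forest_congr {f f' : Words} (h : ∀ e, f' (.inT, e, 0) = f (.inT, e, 0)) :
    X.forest f' = X.forest f := by
  simp only [forest, h]

/-- The vertices found so far form the list `Q`, and the marked edges form a forest on `Q`. The
numbers `c₀` and `c₁` express that every vertex that was found after the root of the current tree
contributes one edge. -/
structure ForestInv (X : Input) (c₀ c₁ : ℕ) (f : Words) (Q : List ℕ) : Prop where
  nodup : Q.Nodup
  lt : ∀ v ∈ Q, v < X.n
  vis : ∀ v < X.n, f (.vis, v, 0) = if v ∈ Q then 1 else 0
  sparse : Sparse 0 (X.forest f) X.src X.dst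
  ends : ∀ e ∈ X.forest f, X.src e ∈ Q ∧ X.dst e ∈ Q
  card : (X.forest f).card + c₁ = Q.length + c₀

theorem ForestInv.congr {c₀ c₁ : ℕ} {f f' : Words} {Q : List ℕ} (h : ForestInv X c₀ c₁ f Q)
    (h1 : ∀ v, f' (.vis, v, 0) = f (.vis, v, 0)) (h2 : ∀ e, f' (.inT, e, 0) = f (.inT, e, 0)) :
    ForestInv X c₀ c₁ f' Q := by
  have := forest_congr (X := X) h2
  exact ⟨h.nodup, h.lt, fun v hv => (h1 v).trans (h.vis v hv), this ▸ h.sparse, this ▸ h.ends,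
    this ▸ h.card⟩

/-- A vertex that has not been found before is attached to the forest by the edge `e`. -/
theorem ForestInv.push {c₀ c₁ : ℕ} {f f' : Words} {Q : List ℕ} (h : ForestInv X c₀ c₁ f Q)
    {d : Dir} {near tip : ℕ → ℕ} (hd : X.IsDir d near tip) {e : ℕ} (he : e < X.m)
    (hnear : near e ∈ Q) (htip : tip e ∉ Q)
    (h1 : ∀ v, f' (.vis, v, 0) = if v = tip e then 1 else f (.vis, v, 0))
    (h2 : ∀ k, f' (.inT, k, 0) = if k = e then 1 else f (.inT, k, 0)) :
    ForestInv X c₀ c₁ f' (Q ++ [tip e]) := by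
  have hforest : X.forest f' = insert e (X.forest f) := by
    ext k
    simp only [forest, Finset.mem_filter, Finset.mem_range, h2, Finset.mem_insert]
    by_cases hk : k = e <;> simp [hk, he]
  have hcases : X.src e = tip e ∧ X.dst e ∈ Q ∨ X.dst e = tip e ∧ X.src e ∈ Q := by
    rcases hd with ⟨-, rfl, rfl⟩ | ⟨-, rfl, rfl⟩
    · exact Or.inr ⟨rfl, hnear⟩
    · exact Or.inl ⟨rfl, hnear⟩
  have heT : e ∉ X.forest f := by
    intro h'
    obtain ⟨a1, a2⟩ := h.ends e h'
    rcases hcases with ⟨hc, -⟩ | ⟨hc, -⟩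
    · exact htip (hc ▸ a1)
    · exact htip (hc ▸ a2)
  refine ⟨?_, ?_, ?_, ?_, ?_, ?_⟩
  · rw [← List.concat_eq_append, List.nodup_concat]
    exact ⟨htip, h.nodup⟩
  · intro v hv
    rcases List.mem_append.1 hv with hv | hv
    · exact h.lt v hv
    · rw [List.mem_singleton.1 hv]; exact hd.tip_lt he
  · intro v hv
    rw [h1, h.vis v hv]
    by_cases hve : v = tip e <;> simp [hve]
  · have := h.sparse.insert_leaf (Q := Q.toFinset) (v := tip e) (e := e)
      (by simpa using h.ends) (by simpa using htip) (by simpa using hcases)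
    rw [hforest]
    convert this
  · intro k hk
    rw [hforest, Finset.mem_insert] at hk
    simp only [List.mem_append, List.mem_singleton]
    rcases hk with rfl | hk
    · tauto
    · exact ⟨Or.inl (h.ends k hk).1, Or.inl (h.ends k hk).2⟩
  · rw [hforest, Finset.card_insert_of_notMem heT, List.length_append, List.length_singleton]
    have := h.card
    omega

/-- What is done for an edge during the search for a spanning polyforest. -/
def visit : Stmt := when (.eq (entry .vis .w) (.lit 0)) (block
  [ put .vis .w (.lit 1), put .inT .cur (.lit 1), push .w ])

theorem wp_scanVisit {d : Dir} {near tip : ℕ → ℕ} {L F c₀ c₁ h u : ℕ} {S Q' : List ℕ}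
    {f : Words} {g : Weights} {R : ℕ → Words → Weights → Prop}
    (hR : X.Rep f S) (hd : X.IsDir d near tip) (hL : X.n ≤ L ∧ X.m ≤ L)
    (hu : f (.u, 0, 0) = u) (huQ : u ∈ Q') (hq : IsQueue f h Q') (hinv : ForestInv X c₀ c₁ f Q')
    (post : ∀ t f' g' Q'', Frame (scan d visit) f g f' g' →
      t ≤ (S.filter (near · = u)).length * 11 + 3 → Q' <+: Q'' → IsQueue f' h Q'' →
      ForestInv X c₀ c₁ f' Q'' → (∀ e ∈ S, near e = u → tip e ∈ Q'') → R t f' g') :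
    WP (allowed L F X.n) (scan d visit) f g R := by
  refine hR.wp_scan (c := 7) hd hL (by decide) hu (hinv.lt _ huQ)
    (fun l f'' _ => ∃ Q'', Q' <+: Q'' ∧ IsQueue f'' h Q'' ∧
      ForestInv X c₀ c₁ f'' Q'' ∧ ∀ e ∈ l, tip e ∈ Q'')
    ⟨Q', List.prefix_rfl, hq, hinv, by simp⟩ ?_ ?_ ?_
  · rintro l f'' g'' v ⟨Q'', h1, h2, h3, h4⟩
    exact ⟨⟨Q'', h1, h2.congr (by simp) (by simp) (by simp), h3.congr (by simp) (by simp), h4⟩,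
      ⟨Q'', h1, h2.congr (by simp) (by simp) (by simp), h3.congr (by simp) (by simp), h4⟩⟩
  · rintro l₁ e l₂ hl he hne hte f'' g'' hfr'' hcur hw ⟨Q'', h1, h2, h3, h4⟩
    have hem := hR.lt e he
    rw [visit, wp_ite]
    refine ⟨by simp [hw]; omega, ?_⟩
    by_cases hmem : tip e ∈ Q''
    · rw [if_neg (by simp [hw, h3.vis _ hte, hmem]), wp_skip]
      refine ⟨by omega, Q'', h1, h2, h3, fun e' he' => ?_⟩
      rcases List.mem_append.1 he' with he' | he'
      · exact h4 e' he'
      · rwa [List.mem_singleton.1 he']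
    · rw [if_pos (by simp [hw, h3.vis _ hte, hmem])]
      rw [wp_block_cons, wp_setW]
      refine ⟨by simp [hw]; omega, ?_⟩
      rw [wp_block_cons, wp_setW]
      refine ⟨by simp [hcur]; omega, ?_⟩
      simp only [Ref.addr, hw, WExpr.eval]
      rw [Function.update_of_ne (by simp), hcur]
      set f5 := Function.update (Function.update f'' (.vis, tip e, 0) 1) (.inT, e, 0) 1 with hf5
      have hq5 : IsQueue f5 h Q'' := h2.congr (by simp [f5]) (by simp [f5]) (by simp [f5])
      have hlen := length_le_of_nodup h3.nodup h3.lt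
      rw [wp_block_cons]
      refine wp_push hq5 (by omega) fun f6 hf6 hq6 => ?_
      have hw5 : f5 (.w, 0, 0) = tip e := by simp [f5, hw]
      rw [hw5] at hq6
      rw [wp_block_nil]
      refine ⟨by omega, Q'' ++ [tip e], h1.trans (List.prefix_append _ _), hq6,
        h3.push hd hem (by rw [hne]; exact h1.subset huQ) hmem ?_ ?_, ?_⟩
      · intro v
        rw [hf6 _ _ _ (by decide) (by decide)]
        simp [f5, Function.update_apply]
      · intro v
        rw [hf6 _ _ _ (by decide) (by decide)]
        simp [f5, Function.update_apply]
      · intro e' he'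
        rcases List.mem_append.1 he' with he' | he'
        · exact List.mem_append_left _ (h4 e' he')
        · simp [List.mem_singleton.1 he']
  · rintro t f'' g'' hfr ht ⟨Q'', h1, h2, h3, h4⟩
    exact post t f'' g'' Q'' hfr ht h1 h2 h3 fun e he hne =>
      h4 e (List.mem_filter.2 ⟨he, by simp [hne]⟩)

/-- Bound for the time spent on the vertex `u` during the search for a spanning polyforest. -/
def visitTime (X : Input) (S : List ℕ) (u : ℕ) : ℕ :=
  (S.filter (X.src · = u)).length * 11 + (S.filter (X.dst · = u)).length * 11 + 7

theorem sum_visitTime_le (S : List ℕ) {Q : List ℕ} (hQ : Q.Nodup) :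
    (Q.map fun u => X.visitTime S u + 4).sum ≤ 22 * S.length + 11 * Q.length := by
  have h1 := sum_weights_le X.src S hQ 11 11
  have h2 := sum_weights_le X.dst S hQ 11 0
  have h3 : (Q.map fun u => X.visitTime S u + 4).sum =
      (Q.map fun u => (S.filter (X.src · = u)).length * 11 + 11).sum +
      (Q.map fun u => (S.filter (X.dst · = u)).length * 11 + 0).sum := by
    rw [← List.sum_map_add]
    congr 1
    refine List.map_congr_left fun u _ => ?_
    simp only [visitTime]
    omega
  omega

/-- The vertex set `Q` is a union of components, and no forest has more edges within `Q` than the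
one that has been found. -/
structure ForestMax (X : Input) (f : Words) (Q : List ℕ) : Prop where
  closed : ∀ e < X.m, X.src e ∈ Q ↔ X.dst e ∈ Q
  max : ∀ T : Finset ℕ, (∀ e ∈ T, e < X.m) → Sparse 0 T X.src X.dst →
    (T.filter fun e => X.src e ∈ Q).card ≤ (X.forest f).card

/-- A component with vertex set `C` spans at most `|C| - 1` edges of a forest, and this is the
number of edges found by the search of `C`. -/
theorem ForestMax.extend {f f' : Words} {Q C : List ℕ} (h : ForestMax X f Q) (hC : C ≠ [])
    (hnd : (Q ++ C).Nodup) (hcl : ∀ e < X.m, X.src e ∈ Q ++ C ↔ X.dst e ∈ Q ++ C)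
    (hcard : (X.forest f').card + 1 = (X.forest f).card + C.length) : ForestMax X f' (Q ++ C) := by
  refine ⟨hcl, fun T hT hS => ?_⟩
  have hsub : T.filter (fun e => X.src e ∈ Q ++ C) ⊆
      T.filter (fun e => X.src e ∈ Q) ∪ edgesWithin T X.src X.dst C.toFinset := by
    intro e he
    obtain ⟨heT, he⟩ := Finset.mem_filter.1 he
    have hd := (hcl e (hT e heT)).1 he
    have hq := h.closed e (hT e heT)
    simp only [Finset.mem_union, Finset.mem_filter, edgesWithin, List.mem_toFinset]
    rw [List.mem_append] at he hd
    by_cases hQ : X.src e ∈ Q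
    · exact Or.inl ⟨heT, hQ⟩
    · exact Or.inr ⟨heT, he.resolve_left hQ, hd.resolve_left fun h => hQ (hq.2 h)⟩
  have h1 := (Finset.card_le_card hsub).trans (Finset.card_union_le _ _)
  have h2 := h.max T hT hS
  obtain ⟨x, hx⟩ := List.exists_mem_of_ne_nil C hC
  have h3 := hS C.toFinset ⟨x, by simpa using hx⟩
  have h4 : C.toFinset.card = C.length :=
    List.toFinset_card_of_nodup (List.nodup_append.1 hnd).2.1
  omega

/-- The search, started again from every vertex that has not been found yet, finds a forest with as
many edges as possible. -/
theorem wp_components {L F : ℕ} {S : List ℕ} {f : Words} {g : Weights}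
    {R : ℕ → Words → Weights → Prop} (hR : X.Rep f S) (hL : X.n ≤ L ∧ X.m ≤ L)
    (hS : ∀ e, e ∈ S ↔ e < X.m) (hq : IsQueue f 0 []) (hvis : ∀ v < X.n, f (.vis, v, 0) = 0)
    (hinT : ∀ e < X.m, f (.inT, e, 0) = 0)
    (post : ∀ t f' g', Frame (forUp .x (val .n) (when (.eq (entry .vis .x) (.lit 0)) (block
        [ put .vis .x (.lit 1), push .x, serve (block [scan fwd visit, scan bwd visit]) ])))
        f g f' g' →
      t ≤ 22 * S.length + 23 * X.n + 3 → Sparse 0 (X.forest f') X.src X.dst →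
      (∀ T : Finset ℕ, (∀ e ∈ T, e < X.m) → Sparse 0 T X.src X.dst →
        T.card ≤ (X.forest f').card) → R t f' g') :
    WP (allowed L F X.n) (forUp .x (val .n) (when (.eq (entry .vis .x) (.lit 0)) (block
        [ put .vis .x (.lit 1), push .x, serve (block [scan fwd visit, scan bwd visit]) ])))
      f g R := by
  refine wp_forUp (k := X.n) (fun j t f' g' => ∃ Q : List ℕ, IsQueue f' Q.length Q ∧
    (∃ c₀ c₁, ForestInv X c₀ c₁ f' Q) ∧ ForestMax X f' Q ∧ (∀ v < j, v ∈ Q) ∧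
    t ≤ j * 12 + (Q.map fun u => X.visitTime S u + 4).sum) (by decide) (by decide) hR.n ?_ ?_ ?_ ?_
  · have hforest : X.forest f = ∅ := by
      simp only [forest, Finset.filter_eq_empty_iff, Finset.mem_range]
      intro e he
      rw [hinT e he]
      decide
    refine ⟨[], hq, ⟨0, 0, by simp, by simp, by simpa using hvis, ?_, ?_, ?_⟩, ⟨by simp, ?_⟩,
      by simp, by simp⟩
    · rw [hforest]
      intro Y hY
      simpa [edgesWithin] using hY
    · simp [hforest]
    · simp [hforest]
    · simp [hforest]
  · rintro j t f' g' v ⟨Q, h1, ⟨c₀, c₁, h2⟩, h3, h4, h5⟩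
    refine ⟨Q, h1.congr (by simp) (by simp) (by simp), ⟨c₀, c₁, h2.congr (by simp) (by simp)⟩,
      ⟨h3.closed, ?_⟩, h4, h5⟩
    rw [forest_congr (f := f') (by simp)]
    exact h3.max
  · rintro j hj t f' g' hfr hx ⟨Q, h1, ⟨c₀, c₁, h2⟩, h3, h4, h5⟩
    have hR' : X.Rep f' S := hR.frame hfr (by decide)
    rw [wp_ite]
    refine ⟨by simp [hx]; omega, ?_⟩
    by_cases hjQ : j ∈ Q
    · rw [if_neg (by simp [hx, h2.vis j hj, hjQ]), wp_skip]
      refine ⟨Q, h1, ⟨c₀, c₁, h2⟩, h3, fun v hv => ?_, by omega⟩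
      rcases Nat.lt_succ_iff_lt_or_eq.1 hv with hv | rfl
      · exact h4 v hv
      · exact hjQ
    rw [if_pos (by simp [hx, h2.vis j hj, hjQ]), wp_block_cons, wp_setW]
    refine ⟨by simp [hx]; omega, ?_⟩
    simp only [Ref.addr, WExpr.eval, hx]
    set f1 := Function.update f' (.vis, j, 0) 1 with hf1
    have hq1 : IsQueue f1 Q.length Q := h1.congr (by simp [f1]) (by simp [f1]) (by simp [f1])
    have hlen := length_le_of_nodup h2.nodup h2.lt
    rw [wp_block_cons]
    refine wp_push hq1 (by omega) fun f2 hf2 hq2 => ?_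
    have hx1 : f1 (.x, 0, 0) = j := by simp [f1, hx]
    rw [hx1] at hq2
    have hR2 : X.Rep f2 S := (hR'.congr (f' := f1) (by simp [f1, graphNames])).congr fun y hy i j =>
      hf2 y i j (by rintro rfl; simp [graphNames] at hy) (by rintro rfl; simp [graphNames] at hy)
    have hfor2 : X.forest f2 = X.forest f' := forest_congr fun e => by
      rw [hf2 _ _ _ (by decide) (by decide)]; simp [f1]
    -- the root `j` of a new tree contributes a vertex, but no edge
    have hinv2 : ForestInv X (X.forest f').card (Q.length + 1) f2 (Q ++ [j]) := by
      refine ⟨?_, ?_, ?_, hfor2 ▸ h2.sparse, ?_, ?_⟩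
      · rw [← List.concat_eq_append, List.nodup_concat]
        exact ⟨hjQ, h2.nodup⟩
      · intro v hv
        rcases List.mem_append.1 hv with hv | hv
        · exact h2.lt v hv
        · rwa [List.mem_singleton.1 hv]
      · intro v hv
        rw [hf2 _ _ _ (by decide) (by decide)]
        have := h2.vis v hv
        by_cases h : v = j <;> simp [f1, h, this]
      · rw [hfor2]
        exact fun e he => ⟨List.mem_append_left _ (h2.ends e he).1,
          List.mem_append_left _ (h2.ends e he).2⟩
      · rw [hfor2, List.length_append, List.length_singleton]
        omega
    rw [wp_block_cons]
    -- vertices of earlier components count as processed, since all their edges stay in `Q`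
    refine wp_serve (X.visitTime S)
      (fun h Q' f'' _ => Q ++ [j] <+: Q' ∧
        ForestInv X (X.forest f').card (Q.length + 1) f'' Q' ∧
        ∀ u ∈ Q'.take h, ∀ e ∈ S, (X.src e = u → X.dst e ∈ Q') ∧ (X.dst e = u → X.src e ∈ Q'))
      hR2.n hL.1 hq2 (by simp) ⟨List.prefix_rfl, hinv2, ?_⟩
      (fun h Q' f' g' hJ => length_le_of_nodup hJ.2.1.nodup hJ.2.1.lt) ?_ ?_ ?_
    · intro u hu e he
      rw [List.take_left] at hu
      have := h3.closed e ((hS e).1 he)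
      constructor
      · rintro rfl
        exact List.mem_append_left _ (this.1 hu)
      · rintro rfl
        exact List.mem_append_left _ (this.2 hu)
    · rintro h Q' f' g' v ⟨a1, a2, a3⟩
      exact ⟨⟨a1, a2.congr (by simp) (by simp), a3⟩, ⟨a1, a2.congr (by simp) (by simp), a3⟩⟩
    · rintro h Q' hh f3 g3 hfr3 hq3 hu3 ⟨hpre, hinv, hcl⟩
      have hR3 : X.Rep f3 S := hR2.frame hfr3 (by decide)
      have huQ : Q'[h] ∈ Q' := List.getElem_mem hh
      refine WP.cons (wp_scanVisit (Q' := Q') hR3 isDir_fwd hL hu3 huQ hq3 hinv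
        (R := fun t f'' _ => t ≤ (S.filter (X.src · = Q'[h])).length * 11 + 3 ∧ ∃ Q'', Q' <+: Q'' ∧
          IsQueue f'' (h + 1) Q'' ∧ ForestInv X (X.forest f').card (Q.length + 1) f'' Q'' ∧
          ∀ e ∈ S, X.src e = Q'[h] → X.dst e ∈ Q'')
        fun t f'' g'' Q'' _ b1 b2 b3 b4 b5 => ⟨b1, Q'', b2, b3, b4, b5⟩) ?_
      rintro t4 f4 g4 hf4 ⟨ht4, Q4, b2, b3, b4, b5⟩
      have hR4 : X.Rep f4 S := hR3.frame hf4 (by decide)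
      have hu4 : f4 (.u, 0, 0) = Q'[h] := by rw [hf4.word _ (by decide), hu3]
      rw [wp_block_cons]
      refine wp_scanVisit (Q' := Q4) hR4 isDir_bwd hL hu4 (b2.subset huQ) b3 b4
        fun t5 f5 g5 Q5 _ d1 d2 d3 d4 d5 => ?_
      rw [wp_block_nil]
      refine ⟨by simp only [visitTime]; omega, Q5, b2.trans d2, d3, (hpre.trans b2).trans d2, d4,
        ?_⟩
      intro u hu e he
      have htake : Q5.take (h + 1) = Q'.take h ++ [Q'[h]] := by
        rw [← List.take_succ_eq_append_getElem hh]
        obtain ⟨R, rfl⟩ := b2.trans d2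
        rw [List.take_append_of_le_length (by omega)]
      rw [htake] at hu
      rcases List.mem_append.1 hu with hu | hu
      · exact ⟨fun h' => (b2.trans d2).subset ((hcl u hu e he).1 h'),
          fun h' => (b2.trans d2).subset ((hcl u hu e he).2 h')⟩
      · rw [List.mem_singleton.1 hu]
        exact ⟨fun h' => d2.subset (b5 e he h'), d5 e he⟩
    · rintro t3 f3 g3 Q3 hfr3 - hq3 ⟨hpre, hinv, hcl⟩ ht3
      rw [List.take_left] at ht3
      rw [List.take_length] at hcl
      obtain ⟨C, rfl⟩ := hpre
      rw [List.append_assoc] at hq3 hinv hcl ht3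
      rw [wp_block_nil]
      refine ⟨Q ++ ([j] ++ C), hq3, ⟨_, _, hinv⟩, h3.extend (by simp) hinv.nodup ?_ ?_, ?_,
        by omega⟩
      · intro e he
        exact ⟨fun h => (hcl _ h e ((hS e).2 he)).1 rfl, fun h => (hcl _ h e ((hS e).2 he)).2 rfl⟩
      · have := hinv.card
        simp only [List.length_append] at this ⊢
        omega
      · intro v hv
        rcases Nat.lt_succ_iff_lt_or_eq.1 hv with hv | rfl
        · exact List.mem_append_left _ (h4 v hv)
        · simp
  · rintro t f' g' hfr ⟨Q, h1, ⟨c₀, c₁, h2⟩, h3, h4, h5⟩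
    have h6 := sum_visitTime_le (X := X) S h2.nodup
    have h7 := length_le_of_nodup h2.nodup h2.lt
    refine post _ _ _ hfr (by omega) h2.sparse fun T hT hTS => ?_
    refine le_trans (le_of_eq ?_) (h3.max T hT hTS)
    rw [Finset.filter_true_of_mem]
    exact fun e he => h4 _ (X.src_lt e (hT e he))

/-- The polyforest `T` is maximal, and `R` is the list of the other edges. -/
structure IsSplit (X : Input) (T R : List ℕ) (f : Words) : Prop where
  rep : X.Rep f T
  nRev : f (.nRev, 0, 0) = R.length
  rev : arr f .rev R.length = R
  nodup : R.Nodup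
  mem : ∀ e, e < X.m ↔ e ∈ T ∨ e ∈ R
  disj : ∀ e ∈ R, e ∉ T
  length : T.length + R.length = X.m
  sparse : Sparse 0 T.toFinset X.src X.dst
  max : ∀ T' : Finset ℕ, (∀ e ∈ T', e < X.m) → Sparse 0 T' X.src X.dst → T'.card ≤ T.length

/-- The construction of a maximal polyforest in linear time. -/
theorem Base.wp_spanningPolyforest {L F : ℕ} {f : Words} {g : Weights}
    {Q : ℕ → Words → Weights → Prop} (hB : X.Base f) (hL : X.n ≤ L ∧ X.m ≤ L)
    (post : ∀ t f' g' T R, Frame spanningPolyforest f g f' g' → t ≤ 60 * (X.n + X.m + 1) →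
      IsSplit X T R f' → Q t f' g') :
    WP (allowed L F X.n) spanningPolyforest f g Q := by
  suffices H : WP (allowed L F X.n) spanningPolyforest f g fun t f' g' =>
      t ≤ 60 * (X.n + X.m + 1) ∧ ∃ T R, IsSplit X T R f' by
    exact H.frame.mono fun t f' g' ⟨h1, h2, T, R, h3⟩ => post t f' g' T R h1 h2 h3
  refine WP.cons (hB.wp_clearEdges hL.1 (Q := fun t f' g' => t ≤ 8 * X.n + 7 ∧ X.Rep f' [])
    fun t f' g' _ h1 h2 => ⟨h1, h2⟩) ?_
  rintro t1 f1 g1 hf1 ⟨ht1, hR1⟩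
  -- all edges are inserted
  have hins : WP (allowed L F X.n) (forUp .e (val .m) (block [put .inT .e (.lit 0), insertEdge]))
      f1 g1 fun t f' g' => t ≤ X.m * (11 + 3) + 3 ∧ X.Rep f' (List.range X.m).reverse ∧
        ∀ e < X.m, f' (.inT, e, 0) = 0 := by
    refine wp_forUp_const (k := X.m) 11 (fun j f' _ => X.Rep f' (List.range j).reverse ∧
      ∀ e < j, f' (.inT, e, 0) = 0) (by decide) (by decide) hR1.m ⟨hR1, by simp⟩ ?_ ?_ ?_
    · rintro j f' g' v ⟨h1, h2⟩
      exact ⟨h1.congr (by simp [graphNames]), by simpa using h2⟩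
    · rintro j hj f' g' - he ⟨h1, h2⟩
      rw [wp_block_cons, wp_setW]
      refine ⟨by simp [he]; omega, ?_⟩
      simp only [Ref.addr, WExpr.eval, he]
      set f2 := Function.update f' (.inT, j, 0) 0 with hf2
      have hR2 : X.Rep f2 (List.range j).reverse := h1.congr (by simp [f2, graphNames])
      rw [wp_block_cons]
      refine hR2.wp_insertEdge (e := j) hL (by simp [f2, he]) hj (by simp) fun f3 hf3 hR3 => ?_
      rw [wp_block_nil]
      refine ⟨by omega, by simpa [List.range_succ] using hR3, fun e he' => ?_⟩
      rw [hf3.word _ (by decide)]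
      by_cases hej : e = j
      · simp [f2, hej]
      · simp [f2, hej, h2 e (by omega)]
    · rintro t f' g' - ht ⟨h1, h2⟩
      exact ⟨ht, h1, h2⟩
  refine WP.cons hins ?_
  rintro t2 f2 g2 hf2 ⟨ht2, hR2, hT2⟩
  refine (wp_fill (x := .vis) (c := 0) (Q := fun t f' g' => t ≤ 4 * X.n + 3 ∧
    ∀ i < X.n, f' (.vis, i, 0) = 0) hR2.n hL.1 (by decide)
    fun t f' g' _ h1 h2 => ⟨h1, h2⟩).cons ?_
  rintro t3 f3 g3 hf3 ⟨ht3, hvis3⟩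
  have hR3 := hR2.frame hf3 (by decide)
  refine (wp_clearQueue (Q := fun t f' g' => IsQueue f' 0 [] ∧ t = 3)
    fun f' _ h => ⟨h, rfl⟩).cons ?_
  rintro t4 f4 g4 hf4 ⟨hq4, rfl⟩
  have hR4 := hR3.frame hf4 (by decide)
  refine WP.cons (wp_components (R := fun t f' g' => t ≤ 22 * X.m + 23 * X.n + 3 ∧
    Sparse 0 (X.forest f') X.src X.dst ∧ ∀ T : Finset ℕ, (∀ e ∈ T, e < X.m) →
      Sparse 0 T X.src X.dst → T.card ≤ (X.forest f').card) hR4 hL (by simp) hq4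
    (fun v hv => by rw [hf4.word _ (by decide), hvis3 v hv])
    (fun e he => by rw [hf4.word _ (by decide), hf3.word _ (by decide), hT2 e he])
    fun t f' g' _ h1 h2 h3 => ⟨by simpa using h1, h2, h3⟩) ?_
  rintro t5 f5 g5 hf5 ⟨ht5, hsp, hmax⟩
  have hR5 := hR4.frame hf5 (by decide)
  refine WP.cons (hR5.toBase.wp_clearEdges hL.1 (Q := fun t f' g' => t ≤ 8 * X.n + 7 ∧ X.Rep f' [])
    fun t f' g' _ h1 h2 => ⟨h1, h2⟩) ?_
  rintro t6 f6 g6 hf6 ⟨ht6, hR6⟩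
  rw [wp_block_cons, wp_setW]
  refine ⟨by simp, ?_⟩
  simp only [Ref.addr, WExpr.eval]
  set f7 := Function.update f6 (.nRev, 0, 0) 0 with hf7
  have hR7 : X.Rep f7 [] := hR6.congr (by simp [f7, graphNames])
  have hT7 : ∀ e, f7 (.inT, e, 0) = f5 (.inT, e, 0) := fun e => by
    rw [← hf6.word .inT (by decide)]; simp [f7]
  -- the edges of the forest are inserted, and the others are listed
  let P : ℕ → Bool := fun e => f5 (.inT, e, 0) = 1
  have hsplit : WP (allowed L F X.n) (forUp .e (val .m) (.ite (.eq (entry .inT .e) (.lit 1))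
      insertEdge (block [put .rev .nRev (val .e), incr .nRev]))) f7 g6 fun t f' g' =>
        t ≤ X.m * (10 + 3) + 3 ∧ X.Rep f' ((List.range X.m).filter P).reverse ∧
        f' (.nRev, 0, 0) = ((List.range X.m).filter (! P ·)).length ∧
        arr f' .rev ((List.range X.m).filter (! P ·)).length = (List.range X.m).filter (! P ·) := by
    refine wp_forUp_const (k := X.m) 10 (fun j f' _ => X.Rep f' ((List.range j).filter P).reverse ∧
        f' (.nRev, 0, 0) = ((List.range j).filter (! P ·)).length ∧
        arr f' .rev ((List.range j).filter (! P ·)).length = (List.range j).filter (! P ·))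
      (by decide) (by decide) hR7.m ⟨hR7, by simp [f7], rfl⟩ ?_ ?_ ?_
    · rintro j f' g' v ⟨h1, h2, h3⟩
      exact ⟨h1.congr (by simp [graphNames]), by simpa using h2,
        (arr_congr (by simp)).trans h3⟩
    · rintro j hj f' g' hfr he ⟨h1, h2, h3⟩
      have hTj : f' (.inT, j, 0) = f5 (.inT, j, 0) := by rw [hfr.word _ (by decide), hT7]
      have hlen : ((List.range j).filter (! P ·)).length ≤ j := by
        simpa using List.length_filter_le (! P ·) (List.range j)
      rw [wp_ite]
      refine ⟨by simp [he]; omega, ?_⟩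
      by_cases hP : f5 (.inT, j, 0) = 1
      · rw [if_pos (by simp [he, hTj, hP])]
        refine h1.wp_insertEdge (e := j) hL he hj (by simp) fun f8 hf8 hR8 => ?_
        have e1 : (List.range (j + 1)).filter P = (List.range j).filter P ++ [j] := by
          rw [List.range_succ, List.filter_append]; simp [P, hP]
        have e2 : (List.range (j + 1)).filter (! P ·) = (List.range j).filter (! P ·) := by
          rw [List.range_succ, List.filter_append]; simp [P, hP]
        rw [e1, e2, List.reverse_append]
        refine ⟨by omega, hR8, by rw [hf8.word _ (by decide), h2], ?_⟩
        exact (arr_congr fun i _ => hf8.word _ (by decide) _ _).trans h3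
      · rw [if_neg (by simp [he, hTj, hP])]
        simp only [wp_block_cons, wp_setW, wp_block_nil, Ref.addr, WExpr.eval, h2, he]
        have e1 : (List.range (j + 1)).filter P = (List.range j).filter P := by
          rw [List.range_succ, List.filter_append]; simp [P, hP]
        have e2 : (List.range (j + 1)).filter (! P ·) = (List.range j).filter (! P ·) ++ [j] := by
          rw [List.range_succ, List.filter_append]; simp [P, hP]
        rw [e1, e2, List.length_append, List.length_singleton]
        refine ⟨by simp [h2]; omega, by simp, by omega, h1.congr (by simp [graphNames]),
          by simp [h2], ?_⟩
        rw [arr_succ]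
        congr 1
        · refine (arr_congr fun i hi => ?_).trans h3
          simp [hi.ne]
        · simp
    · rintro t f' g' - ht h
      exact ⟨ht, h⟩
  refine WP.cons hsplit ?_
  rintro t8 f8 g8 hf8 ⟨ht8, hR8, hn8, hr8⟩
  rw [wp_block_nil]
  have hforest : ((List.range X.m).filter P).reverse.toFinset = X.forest f5 := by
    ext e
    simp [forest, P]
  have hcard : ((List.range X.m).filter P).reverse.length = (X.forest f5).card := by
    rw [← hforest, List.toFinset_card_of_nodup]
    exact List.nodup_reverse.2 (List.nodup_range.filter _)
  refine ⟨by omega, _, _, hR8, hn8, hr8, List.nodup_range.filter _, ?_, ?_, ?_, ?_, ?_⟩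
  · intro e
    simp only [List.mem_reverse, List.mem_filter, List.mem_range]
    cases h : P e <;> simp
  · intro e he he'
    simp only [List.mem_reverse, List.mem_filter, List.mem_range] at he he'
    rw [he'.2] at he
    exact absurd he.2 (by decide)
  · have := List.length_eq_length_filter_add (l := List.range X.m) P
    rw [List.length_range] at this
    rw [List.length_reverse]
    exact this.symm
  · rw [hforest]; exact hsp
  · intro T' h1 h2
    rw [hcard]
    exact hmax T' h1 h2

end Input

end DescendantCounting

namespace DescendantCounting

open Relation

/-! ### Algorithm 1 -/

namespace Input

variable {X : Input}

/-- The queue `Q` contains the vertices all of whose out-edges are in the set `C` of counted edges,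
and it is a reverse topological order. -/
structure SortInv (X : Input) (S : List ℕ) (C : Finset ℕ) (Q : List ℕ) (f : Words) : Prop where
  nodup : Q.Nodup
  lt : ∀ v ∈ Q, v < X.n
  cnt : ∀ v < X.n, f (.cnt, v, 0) = {e ∈ S.toFinset | X.src e = v ∧ e ∈ C}.card
  mem : ∀ v < X.n, v ∈ Q ↔ ∀ e ∈ S, X.src e = v → e ∈ C
  order : ∀ i v, Q[i]? = some v → ∀ e ∈ S, X.src e = v → X.dst e ∈ Q.take i

theorem SortInv.congr {S : List ℕ} {C : Finset ℕ} {Q : List ℕ} {f f' : Words}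
    (h : SortInv X S C Q f) (hf : ∀ v, f' (.cnt, v, 0) = f (.cnt, v, 0)) : SortInv X S C Q f' :=
  ⟨h.nodup, h.lt, fun v hv => (hf v).trans (h.cnt v hv), h.mem, h.order⟩

/-- In an acyclic digraph, all vertices are put into the queue. -/
theorem SortInv.length_eq {S : List ℕ} {Q : List ℕ} {f : Words}
    (h : SortInv X S {e ∈ S.toFinset | X.dst e ∈ Q} Q f) (hS : ∀ e ∈ S, e < X.m)
    (hac : ∀ v, ¬ TransGen (X.Adj S) v v) : Q.length = X.n ∧ ∀ v < X.n, v ∈ Q := by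
  have key : ∀ v : Fin X.n, (v : ℕ) ∈ Q := by
    let r : Fin X.n → Fin X.n → Prop := fun u v => TransGen (X.Adj S) v u
    -- induction along the edges, from the sinks
    have : IsTrans (Fin X.n) r := ⟨fun u v w h1 h2 => h2.trans h1⟩
    have : Std.Irrefl r := ⟨fun v => hac v⟩
    intro v
    induction v using (Finite.wellFounded_of_trans_of_irrefl r).induction with
    | _ v ih =>
      rw [h.mem v v.2]
      intro e he hv
      refine Finset.mem_filter.2 ⟨by simpa using he, ?_⟩
      exact ih ⟨X.dst e, X.dst_lt e (hS e he)⟩ (.single (adj_iff.2 ⟨e, he, hv, rfl⟩))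
  have key' : ∀ v < X.n, v ∈ Q := fun v hv => key ⟨v, hv⟩
  refine ⟨le_antisymm (length_le_of_nodup h.nodup h.lt) ?_, key'⟩
  have : List.range X.n ⊆ Q := fun v hv => key' v (List.mem_range.1 hv)
  simpa using (List.nodup_range.subperm this).length_le

theorem Rep.degOut_eq {S : List ℕ} {f : Words} (hR : X.Rep f S) {v : ℕ} (hv : v < X.n) :
    f (.degOut, v, 0) = {e ∈ S.toFinset | X.src e = v}.card := by
  rw [show f (.degOut, v, 0) = _ from (hR.out v hv).1,
    ← List.toFinset_card_of_nodup (hR.nodup.filter _), List.toFinset_filter]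
  simp

/-- The computation of a reverse topological order, in the queue. -/
theorem Rep.wp_topologicalSort {L F : ℕ} {S : List ℕ} {f : Words} {g : Weights} {l : List Stmt}
    {Q : ℕ → Words → Weights → Prop} (hR : X.Rep f S) (hL : X.n ≤ L ∧ X.m ≤ L)
    (hac : ∀ v, ¬ TransGen (X.Adj S) v v)
    (post : ∀ t f' Q', X.Rep f' S → t ≤ 10 * S.length + 20 * X.n + 20 →
      arr f' .queue X.n = Q' → Q'.Nodup → (∀ v, v ∈ Q' ↔ v < X.n) →
      (∀ i v, Q'[i]? = some v → ∀ e ∈ S, X.src e = v → X.dst e ∈ Q'.take i) →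
      WP (allowed L F X.n) (block l) f' g fun t' => Q (t + t')) :
    WP (allowed L F X.n) (block (clearQueue :: fill .cnt 0 ::
      forUp .v (val .n) (when (.eq (entry .degOut .v) (.lit 0)) (push .v)) ::
      serve (scan bwd (block
        [incrAt .cnt .w, when (.eq (entry .cnt .w) (entry .degOut .w)) (push .w)])) :: l))
      f g Q := by
  refine (wp_clearQueue (Q := fun t f' g' => IsQueue f' 0 [] ∧ t = 3 ∧ g' = g)
    fun f' _ h => ⟨h, rfl, rfl⟩).cons ?_
  rintro t1 f1 g1 hf1 ⟨hq1, rfl, rfl⟩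
  have hR1 := hR.frame hf1 (by decide)
  refine (wp_fill (x := .cnt) (c := 0) (Q := fun t f' g' => t ≤ 4 * X.n + 3 ∧
    ∀ i < X.n, f' (.cnt, i, 0) = 0) hR1.n hL.1 (by decide)
    fun t f' g' _ h1 h2 => ⟨h1, h2⟩).cons ?_
  rintro t2 f2 g2 hf2 ⟨ht2, hcnt2⟩
  obtain rfl : g2 = g1 := funext fun ⟨y, i, j⟩ => hf2.weight y (by cases y <;> decide) i j
  have hR2 := hR1.frame hf2 (by decide)
  have hq2 : IsQueue f2 0 [] := hq1.congr (hf2.word _ (by decide) _ _) (hf2.word _ (by decide) _ _)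
    fun _ => hf2.word _ (by decide) _ _
  let Q₀ : ℕ → List ℕ := fun j => (List.range j).filter fun v => f2 (.degOut, v, 0) = 0
  have hsink : WP (allowed L F X.n)
      (forUp .v (val .n) (when (.eq (entry .degOut .v) (.lit 0)) (push .v))) f2 g2
      fun t f' g' => t ≤ X.n * (5 + 3) + 3 ∧ IsQueue f' 0 (Q₀ X.n) := by
    refine wp_forUp_const (k := X.n) 5 (fun j f' _ => IsQueue f' 0 (Q₀ j)) (by decide) (by decide)
      hR2.n hq2 (fun j f' g' v h => h.congr (by simp) (by simp) (by simp)) ?_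
      (fun t f' g' _ ht h => ⟨ht, h⟩)
    intro j hj f' g' hfr hv hq
    have hdeg : f' (.degOut, j, 0) = f2 (.degOut, j, 0) := hfr.word _ (by decide) _ _
    have hlen : (Q₀ j).length ≤ j := by
      simpa using List.length_filter_le (fun v => decide (f2 (.degOut, v, 0) = 0)) (List.range j)
    have e1 : Q₀ (j + 1) = Q₀ j ++ if f2 (.degOut, j, 0) = 0 then [j] else [] := by
      simp only [Q₀, List.range_succ, List.filter_append]
      congr 1
      split_ifs with h <;> simp [h]
    rw [wp_ite]
    refine ⟨by simp [hv]; omega, ?_⟩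
    rw [e1]
    by_cases h : f2 (.degOut, j, 0) = 0
    · rw [if_pos (by simp [hv, hdeg, h]), if_pos h]
      refine wp_push hq (by omega) fun f'' _ hq' => ⟨by omega, ?_⟩
      rwa [hv] at hq'
    · rw [if_neg (by simp [hv, hdeg, h]), if_neg h, List.append_nil]
      exact wp_skip.2 ⟨by omega, hq⟩
  refine hsink.cons ?_
  rintro t3 f3 g3 hf3 ⟨ht3, hq3⟩
  obtain rfl : g3 = g2 := funext fun ⟨y, i, j⟩ => hf3.weight y (by cases y <;> decide) i j
  have hR3 := hR2.frame hf3 (by decide)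
  have hmem0 : ∀ v, v ∈ Q₀ X.n ↔ v < X.n ∧ ∀ e ∈ S, X.src e ≠ v := by
    intro v
    simp only [Q₀, List.mem_filter, List.mem_range, decide_eq_true_eq]
    refine and_congr_right fun hv => ?_
    rw [hR2.degOut_eq hv, Finset.card_eq_zero, Finset.filter_eq_empty_iff]
    simp
  have hinv3 : SortInv X S {e ∈ S.toFinset | X.dst e ∈ (Q₀ X.n).take 0} (Q₀ X.n) f3 := by
    refine ⟨List.nodup_range.filter _, fun v hv => ((hmem0 v).1 hv).1, fun v hv => ?_,
      fun v hv => ?_, fun i v hv e he he' => ?_⟩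
    · rw [hf3.word _ (by decide), hcnt2 v hv]
      simp
    · rw [hmem0]
      simp [hv]
    · exact absurd he' (((hmem0 v).1 (List.mem_of_getElem? hv)).2 e he)
  -- when a vertex is processed, its in-edges are counted, at their sources
  suffices H : WP (allowed L F X.n) (serve (scan bwd (block
      [incrAt .cnt .w, when (.eq (entry .cnt .w) (entry .degOut .w)) (push .w)]))) f3 g3
      fun t f' _ => t ≤ 10 * S.length + 7 * X.n + 2 ∧ ∃ Q', arr f' .queue X.n = Q' ∧ Q'.Nodup ∧
        (∀ v, v ∈ Q' ↔ v < X.n) ∧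
        (∀ i v, Q'[i]? = some v → ∀ e ∈ S, X.src e = v → X.dst e ∈ Q'.take i) by
    refine H.cons ?_
    rintro t4 f4 g4 hf4 ⟨ht4, Q', h1, h2, h3, h4⟩
    obtain rfl : g4 = g3 := funext fun ⟨y, i, j⟩ => hf4.weight y (by cases y <;> decide) i j
    refine (post (3 + (t2 + (t3 + t4))) f4 Q' (hR3.frame hf4 (by decide)) (by omega)
      h1 h2 h3 h4).mono fun t f' g' h => ?_
    simpa only [add_assoc] using h
  refine wp_serve (fun u => (S.filter (X.dst · = u)).length * 10 + 3)
    (fun h Q' f' _ => SortInv X S {e ∈ S.toFinset | X.dst e ∈ Q'.take h} Q' f')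
    hR3.n hL.1 hq3 (by simp) hinv3
    (fun h Q' f' g' hJ => length_le_of_nodup hJ.nodup hJ.lt) ?_ ?_ ?_
  · rintro h Q' f' g' v h1
    exact ⟨h1.congr (by simp), h1.congr (by simp)⟩
  · rintro h Q' hh f' g' hfr hq hu hinv
    have hR' : X.Rep f' S := hR3.frame hfr (by decide)
    have hC : ∀ e ∈ S, X.dst e = Q'[h] → e ∉ {e ∈ S.toFinset | X.dst e ∈ Q'.take h} := by
      intro e _ he hmem
      have h1 := (Finset.mem_filter.1 hmem).2
      rw [he] at h1
      have h2 := hinv.nodup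
      rw [← List.take_append_drop h Q', List.nodup_append] at h2
      refine h2.2.2 _ h1 _ ?_ rfl
      rw [List.drop_eq_getElem_cons hh]
      exact List.mem_cons_self
    have htake : ∀ {Q'' : List ℕ}, Q' <+: Q'' → Q''.take (h + 1) = Q'.take h ++ [Q'[h]] := by
      rintro _ ⟨R, rfl⟩
      rw [← List.take_succ_eq_append_getElem hh, List.take_append_of_le_length (by omega)]
    refine hR'.wp_scan (c := 6) isDir_bwd hL (by decide) hu (hinv.lt _ (List.getElem_mem hh))
      (fun l f'' _ => ∃ Q'', Q' <+: Q'' ∧ IsQueue f'' (h + 1) Q'' ∧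
        SortInv X S ({e ∈ S.toFinset | X.dst e ∈ Q'.take h} ∪ l.toFinset) Q'' f'')
      ⟨Q', List.prefix_rfl, hq, by simpa using hinv⟩ ?_ ?_ ?_
    · rintro l f'' g'' v ⟨Q'', h1, h2, h3⟩
      exact ⟨⟨Q'', h1, h2.congr (by simp) (by simp) (by simp), h3.congr (by simp)⟩,
        ⟨Q'', h1, h2.congr (by simp) (by simp) (by simp), h3.congr (by simp)⟩⟩
    · rintro l₁ e l₂ hl he hne hte f'' g'' hfr'' hcur hw ⟨Q'', h1, h2, h3⟩
      have hR'' : X.Rep f'' S := hR'.frame hfr'' (by decide)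
      set C := {e ∈ S.toFinset | X.dst e ∈ Q'.take h} ∪ l₁.toFinset with hCdef
      have heC : e ∉ C := by
        have := hR.nodup.filter (X.dst · = Q'[h])
        rw [hl] at this
        simp only [C, Finset.mem_union, not_or]
        refine ⟨hC e he hne, ?_⟩
        rw [List.nodup_append] at this
        simpa using fun hmem => this.2.2 e hmem e (by simp) rfl
      have hC' : {e ∈ S.toFinset | X.dst e ∈ Q'.take h} ∪ (l₁ ++ [e]).toFinset = insert e C := by
        ext x
        simp only [C, List.toFinset_append, Finset.mem_union, Finset.mem_insert, List.mem_toFinset,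
          List.mem_singleton]
        tauto
      have hwQ : X.src e ∉ Q'' := fun hmem => heC ((h3.mem _ hte).1 hmem e he rfl)
      have hcard : ∀ v, {e' ∈ S.toFinset | X.src e' = v ∧ e' ∈ insert e C}.card =
          {e' ∈ S.toFinset | X.src e' = v ∧ e' ∈ C}.card + if v = X.src e then 1 else 0 := by
        intro v
        split_ifs with hv
        · rw [← Finset.card_insert_of_notMem (a := e) (by simp [heC])]
          congr 1
          ext x
          simp only [Finset.mem_filter, Finset.mem_insert, List.mem_toFinset]
          constructor
          · tauto
          · rintro (rfl | h)
            · exact ⟨he, hv.symm, Or.inl rfl⟩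
            · tauto
        · rw [add_zero]
          congr 1
          ext x
          simp only [Finset.mem_filter, Finset.mem_insert, List.mem_toFinset]
          constructor
          · rintro ⟨h1, h2, h3 | h3⟩
            · subst h3; exact absurd h2.symm hv
            · exact ⟨h1, h2, h3⟩
          · tauto
      have hmem' : ∀ v, v ≠ X.src e → ((∀ e' ∈ S, X.src e' = v → e' ∈ insert e C) ↔
          ∀ e' ∈ S, X.src e' = v → e' ∈ C) := by
        intro v hv
        refine forall₂_congr fun e' _ => forall_congr' fun h' => ?_
        rw [Finset.mem_insert, or_iff_right]
        rintro rfl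
        exact hv h'.symm
      have hdeg := hR''.degOut_eq hte
      have hall : {e' ∈ S.toFinset | X.src e' = X.src e ∧ e' ∈ insert e C}.card =
          {e' ∈ S.toFinset | X.src e' = X.src e}.card ↔
          ∀ e' ∈ S, X.src e' = X.src e → e' ∈ insert e C := by
        rw [← Finset.filter_filter, Finset.card_filter_eq_iff]
        simp
      rw [wp_block_cons, wp_setW]
      refine ⟨by simp [hw]; omega, ?_⟩
      simp only [Ref.addr, hw, WExpr.eval]
      set f5 := Function.update f'' (.cnt, X.src e, 0) (f'' (.cnt, X.src e, 0) + 1) with hf5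
      have hq5 : IsQueue f5 (h + 1) Q'' := h2.congr (by simp [f5]) (by simp [f5]) (by simp [f5])
      have hw5 : f5 (.w, 0, 0) = X.src e := by simp [f5, hw]
      have hdeg5 : f5 (.degOut, X.src e, 0) = {e' ∈ S.toFinset | X.src e' = X.src e}.card := by
        rw [← hdeg]; simp [f5]
      have hcnt5 : ∀ v < X.n, f5 (.cnt, v, 0) =
          {e' ∈ S.toFinset | X.src e' = v ∧ e' ∈ insert e C}.card := by
        intro v hv
        rw [hcard]
        by_cases hv' : v = X.src e
        · rw [if_pos hv', hv', ← h3.cnt _ hte]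
          simp [f5]
        · rw [if_neg hv', ← h3.cnt _ hv]
          simp [f5, hv']
      have hlen := length_le_of_nodup h3.nodup h3.lt
      rw [wp_block_cons, wp_ite]
      refine ⟨by simp [hw5]; omega, ?_⟩
      rw [hC']
      -- the source of `e` joins the queue when the last of its out-edges is counted
      by_cases hfull : ∀ e' ∈ S, X.src e' = X.src e → e' ∈ insert e C
      · rw [if_pos (by simp only [Cond.holds, WExpr.eval, Ref.addr, hw5, decide_eq_true_eq]
                       rw [hcnt5 _ hte, hdeg5, hall]; exact hfull)]
        refine wp_push hq5 (by omega) fun f6 hf6 hq6 => ?_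
        rw [hw5] at hq6
        rw [wp_block_nil]
        refine ⟨by omega, Q'' ++ [X.src e], h1.trans (List.prefix_append _ _), hq6,
          ⟨?_, ?_, ?_, ?_, ?_⟩⟩
        · rw [← List.concat_eq_append, List.nodup_concat]
          exact ⟨hwQ, h3.nodup⟩
        · intro v hv
          rcases List.mem_append.1 hv with hv | hv
          · exact h3.lt v hv
          · rwa [List.mem_singleton.1 hv]
        · intro v hv
          rw [hf6 _ _ _ (by decide) (by decide), hcnt5 v hv]
        · intro v hv
          by_cases hv' : v = X.src e
          · subst hv'
            simpa using hfull
          · rw [hmem' v hv', ← h3.mem v hv]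
            simp [hv']
        · intro i v hi e' he' hsrc
          rw [List.getElem?_append] at hi
          split_ifs at hi with hlt
          · rw [List.take_append_of_le_length hlt.le]
            exact h3.order i v hi e' he' hsrc
          · obtain ⟨h0, rfl⟩ : i - Q''.length = 0 ∧ X.src e = v := by
              cases hk : i - Q''.length with
              | zero => rw [hk] at hi; simpa using hi
              | succ k => rw [hk] at hi; simp at hi
            have hdone : X.dst e' ∈ Q'' := by
              refine (List.take_subset (h + 1) Q'') ?_
              rw [htake h1]
              have := hfull e' he' hsrc
              simp only [C, Finset.mem_insert, Finset.mem_union, Finset.mem_filter,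
                List.mem_toFinset] at this
              rcases this with rfl | h5 | h5
              · exact hne ▸ List.mem_append_right _ (List.mem_singleton_self _)
              · exact List.mem_append_left _ h5.2
              · have : e' ∈ S.filter (X.dst · = Q'[h]) := by rw [hl]; simp [h5]
                have := (List.mem_filter.1 this).2
                exact of_decide_eq_true this ▸ List.mem_append_right _ (List.mem_singleton_self _)
            rw [show i = Q''.length by omega, List.take_left]
            exact hdone
      · rw [if_neg (by simp only [Cond.holds, WExpr.eval, Ref.addr, hw5, decide_eq_true_eq]
                       rw [hcnt5 _ hte, hdeg5, hall]; exact hfull), wp_skip, wp_block_nil]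
        refine ⟨by omega, Q'', h1, hq5, ⟨h3.nodup, h3.lt, hcnt5, fun v hv => ?_, h3.order⟩⟩
        by_cases hv' : v = X.src e
        · subst hv'
          exact iff_of_false hwQ hfull
        · rw [hmem' v hv', ← h3.mem v hv]
    · rintro t f'' g'' - ht ⟨Q'', h1, h2, h3⟩
      refine ⟨ht, Q'', h1, h2, ?_⟩
      convert h3 using 1
      ext e
      rw [htake h1]
      simp only [Finset.mem_filter, List.mem_toFinset, List.mem_append, List.mem_singleton,
        Finset.mem_union, List.mem_filter, decide_eq_true_eq]
      tauto
  · rintro t f' g' Q' - - hq hinv ht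
    rw [List.take_length] at hinv
    obtain ⟨h1, h2⟩ := hinv.length_eq hR.lt hac
    have hsum := sum_weights_le X.dst S hinv.nodup 10 7
    change t + 0 ≤ (Q'.map fun u => (S.filter (X.dst · = u)).length * 10 + 7).sum + 2 at ht
    exact ⟨by omega, Q', h1 ▸ hq.list, hinv.nodup, fun v => ⟨hinv.lt v, h2 v⟩, hinv.order⟩

/-- Algorithm 1 solves the recursion `w(v) = a_v + ∑ w(x)`, where `x` ranges over the
out-neighbours of `v`, in linear time. -/
theorem Rep.wp_algorithm1 {L F : ℕ} {S : List ℕ} {f : Words} {g : Weights} {wt : ℕ → ℝ}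
    {Q : ℕ → Words → Weights → Prop} (hR : X.Rep f S) (hL : X.n ≤ L ∧ X.m ≤ L)
    (hac : ∀ v, ¬ TransGen (X.Adj S) v v)
    (hwt : ∀ v < X.n, wt v = g (.a, v, 0) +
      ((S.filter (X.src · = v)).map fun e => wt (X.dst e)).sum)
    (post : ∀ t f' g', Frame algorithm1 f g f' g' → t ≤ 15 * S.length + 30 * X.n + 30 →
      (∀ v < X.n, g' (.r, v, 0) = wt v) → Q t f' g') :
    WP (allowed L F X.n) algorithm1 f g Q := by
  suffices H : WP (allowed L F X.n) algorithm1 f g fun t f' g' =>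
      t ≤ 15 * S.length + 30 * X.n + 30 ∧ ∀ v < X.n, g' (.r, v, 0) = wt v by
    exact H.frame.mono fun t f' g' h => post t f' g' h.1 h.2.1 h.2.2
  refine hR.wp_topologicalSort hL hac ?_
  rintro t1 f1 Q' hR1 ht1 hq hnd hmem hord
  have hlen : Q'.length = X.n := by rw [← hq, length_arr]
  rw [wp_block_cons]
  refine wp_forUp (k := X.n) (fun j t f' g' =>
    t ≤ ((Q'.take j).map fun u => (S.filter (X.src · = u)).length * 5 + 9).sum ∧
    ∀ u ∈ Q'.take j, g' (.r, u, 0) = wt u) (by decide) (by decide) hR1.n (by simp)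
    (fun _ _ _ _ _ h => h) ?_ ?_
  · rintro j hj t f' g' hfr hk ⟨ht, hr⟩
    have hR' : X.Rep f' S := hR1.frame hfr (by decide)
    have hj' : j < Q'.length := by omega
    have hqj : f' (.queue, j, 0) = Q'[j] := by
      rw [hfr.word _ (by decide)]
      exact arr_getElem hq hj'
    set u := Q'[j] with hu
    have hun : u < X.n := (hmem u).1 (List.getElem_mem hj')
    rw [wp_block_cons, wp_setW]
    refine ⟨by simp [hk]; omega, ?_⟩
    simp only [Ref.addr, hk, WExpr.eval, hqj]
    set f2 := Function.update f' (.u, 0, 0) u with hf2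
    have hR2 : X.Rep f2 S := hR'.congr (by simp [f2, graphNames])
    have hu2 : f2 (.u, 0, 0) = u := by simp [f2]
    rw [wp_block_cons, wp_setA]
    refine ⟨by simp [hu2]; omega, ?_⟩
    simp only [Ref.addr, hu2, AExpr.eval]
    have ha : g' (.a, u, 0) = g (.a, u, 0) := hfr.weight _ (by decide) _ _
    rw [ha]
    set g2 := Function.update g' (.r, u, 0) (g (.a, u, 0)) with hg2
    rw [wp_block_cons]
    refine hR2.wp_scan (c := 1) isDir_fwd hL (by decide) hu2 hun
      (fun l f'' g'' => g'' (.r, u, 0) = g (.a, u, 0) + (l.map fun e => wt (X.dst e)).sum ∧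
        ∀ v ≠ u, g'' (.r, v, 0) = g' (.r, v, 0)) ⟨by simp [g2], fun v hv => by simp [g2, hv]⟩
      (fun _ _ _ _ h => ⟨h, h⟩) ?_ ?_
    · rintro l₁ e l₂ hl he hne hte f'' g'' hfr'' hcur hw ⟨h1, h2⟩
      have hu'' : f'' (.u, 0, 0) = u := (hfr''.word _ (by decide) _ _).trans hu2
      have hdst : X.dst e ∈ Q'.take j :=
        hord j u (by rw [List.getElem?_eq_getElem hj']) e he hne
      have hdu : X.dst e ≠ u := by
        intro h
        rw [h] at hdst
        have h2 := hnd
        rw [← List.take_append_drop j Q', List.nodup_append] at h2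
        refine h2.2.2 _ hdst _ ?_ rfl
        rw [List.drop_eq_getElem_cons hj']
        exact List.mem_cons_self
      rw [wp_setA]
      refine ⟨by simp [hu'', hw]; omega, le_rfl, ?_, fun v hv => ?_⟩
      · simp only [Ref.addr, AExpr.eval, hu'', hw, Function.update_self, List.map_append,
          List.sum_append, List.map_cons, List.map_nil, List.sum_cons, List.sum_nil, add_zero]
        rw [h1, h2 _ hdu, hr _ hdst, add_assoc]
      · simp only [Ref.addr, hu'']
        rw [Function.update_of_ne (by simp [hv]), h2 v hv]
    · rintro t' f'' g'' - ht' ⟨h1, h2⟩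
      rw [wp_block_nil]
      rw [List.take_succ_eq_append_getElem hj', List.map_append, List.sum_append]
      refine ⟨?_, ?_⟩
      · simp only [List.map_cons, List.map_nil, List.sum_cons, List.sum_nil]
        rw [← hu]
        omega
      · intro v hv
        by_cases hvu : v = u
        · rw [hvu, h1, ← hwt u hun]
        · rw [h2 v hvu]
          refine hr v ?_
          rcases List.mem_append.1 hv with hv | hv
          · exact hv
          · exact absurd (List.mem_singleton.1 hv) hvu
  · rintro t f' g' hfr ⟨ht, hr⟩
    rw [← hlen, List.take_length] at ht hr
    have hsum := sum_weights_le X.src S hnd 5 9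
    rw [wp_block_nil]
    exact ⟨by omega, fun v hv => hr v ((hmem v).2 hv)⟩

end Input

end DescendantCounting

namespace DescendantCounting

open Relation

/-! ### One round of Algorithm 2 -/

namespace Input

variable {X : Input}

theorem Reach.lt_left {S : List ℕ} {u v : ℕ} (h : X.Reach S u v) (hS : ∀ e ∈ S, e < X.m)
    (hv : v < X.n) : u < X.n := by
  rcases ReflTransGen.cases_head h with rfl | ⟨_, h', -⟩
  · exact hv
  · obtain ⟨e, he, rfl, -⟩ := adj_iff.1 h'
    exact X.src_lt e (hS e he)

theorem Reach.lt_right {S : List ℕ} {u v : ℕ} (h : X.Reach S u v) (hS : ∀ e ∈ S, e < X.m)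
    (hu : u < X.n) : v < X.n := by
  rcases ReflTransGen.cases_tail h with rfl | ⟨_, -, h'⟩
  · exact hu
  · obtain ⟨e, he, -, rfl⟩ := adj_iff.1 h'
    exact X.dst_lt e (hS e he)

variable (X)

/-- The digraph with the edges in `S`. -/
def toDigraph (S : List ℕ) : Digraph (Fin X.n) where
  Adj u v := X.Adj S u v

open Classical in
/-- The weighted reachability number of `v` in the digraph with the edges in `S`. -/
noncomputable def reachWeight (S : List ℕ) (al : ℕ → ℝ) (v : ℕ) : ℝ :=
  ∑ x ∈ Finset.range X.n with X.Reach S v x, al x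

variable {X}

theorem reach_toDigraph {S : List ℕ} (hS : ∀ e ∈ S, e < X.m) {u v : Fin X.n} :
    ReflTransGen (X.toDigraph S).Adj u v ↔ X.Reach S u v := by
  refine ⟨fun h => ReflTransGen.lift (fun v : Fin X.n => (v : ℕ)) (fun _ _ h => h) _ _ h,
    fun h => ?_⟩
  obtain ⟨v, hv⟩ := v
  change X.Reach S u v at h
  induction h with
  | refl => exact .refl
  | @tail b c hub hbc ih =>
    exact (ih (Reach.lt_right hub hS u.2)).tail hbc

theorem isAcyclic_toDigraph {S : List ℕ} (hac : ∀ v, ¬ TransGen (X.Adj S) v v) :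
    IsAcyclic (X.toDigraph S) :=
  fun v hv => hac v (TransGen.lift (fun v : Fin X.n => (v : ℕ)) (fun _ _ h => h) _ _ hv)

theorem weightedReach_toDigraph {S : List ℕ} (hS : ∀ e ∈ S, e < X.m) (al : ℕ → ℝ) (v : Fin X.n) :
    weightedReach (X.toDigraph S) (fun v => al v) v = X.reachWeight S al v := by
  classical
  rw [weightedReach, reachWeight, reachSet, Finset.sum_filter, Finset.sum_filter, Finset.sum_range]
  simp only [reach_toDigraph hS]

theorem toDigraph_cons {S : List ℕ} {e : ℕ} (he : e < X.m) :
    X.toDigraph (e :: S) =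
      addEdge (X.toDigraph S) (⟨X.src e, X.src_lt e he⟩, ⟨X.dst e, X.dst_lt e he⟩) := by
  ext u v
  simp only [toDigraph, addEdge, adj_iff, List.mem_cons, or_and_right, exists_or, exists_eq_left,
    Prod.mk.injEq, Fin.ext_iff]
  rw [or_comm, @eq_comm _ (u : ℕ), @eq_comm _ (v : ℕ)]

/-- The update of the weighted reachability numbers in a round. -/
theorem reachWeight_cons {S : List ℕ} {e : ℕ} (hS : ∀ e ∈ S, e < X.m) (he : e < X.m)
    (hac : ∀ v, ¬ TransGen (X.Adj (e :: S)) v v) {B : List ℕ}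
    (hB : ∀ b, b ∈ B ↔ b < X.n ∧ X.Reach S b (X.src e) ∧ ∃ w, ¬ X.Reach S w (X.src e) ∧
      X.Adj S b w ∧ ∃ c, X.Reach S (X.dst e) c ∧ X.Reach S w c) (al : ℕ → ℝ) {v : ℕ}
    (hv : v < X.n) [Decidable (X.Reach S v (X.src e))]
    [DecidablePred fun x => X.Reach S (X.dst e) x ∧ ¬ ∃ b ∈ B, X.Reach S v b ∧ X.Reach S b x] :
    X.reachWeight (e :: S) al v = if X.Reach S v (X.src e) then X.reachWeight S al v +
      ∑ x ∈ Finset.range X.n with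
        X.Reach S (X.dst e) x ∧ ¬ ∃ b ∈ B, X.Reach S v b ∧ X.Reach S b x, al x
      else X.reachWeight S al v := by
  classical
  have hS' : ∀ e' ∈ e :: S, e' < X.m := List.forall_mem_cons.2 ⟨he, hS⟩
  have hac' := isAcyclic_toDigraph hac
  rw [toDigraph_cons he] at hac'
  set s : Fin X.n := ⟨X.src e, X.src_lt e he⟩ with hs
  set t : Fin X.n := ⟨X.dst e, X.dst_lt e he⟩ with ht
  have hts : ¬ ReflTransGen (X.toDigraph S).Adj t s := fun h =>
    hac'.not_reach (Or.inr rfl) (ReflTransGen.mono (fun _ _ h => Or.inl h) _ _ h)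
  have hbd : ∀ b : Fin X.n, b ∈ boundarySet (X.toDigraph S) s t ↔ (b : ℕ) ∈ B := by
    intro b
    rw [mem_boundarySet hts, hB, reach_toDigraph hS]
    refine ⟨?_, ?_⟩
    · rintro ⟨h1, w, h2, h3, c, h4, h5⟩
      rw [reach_toDigraph hS] at h3 h4 h5
      exact ⟨b.2, h1, w, h3, h2, c, h4, h5⟩
    · rintro ⟨-, h1, w, h3, h2, c, h4, h5⟩
      have hc : c < X.n := Reach.lt_right h4 hS t.2
      have hw : w < X.n := Reach.lt_left h5 hS hc
      refine ⟨h1, ⟨w, hw⟩, h2, ?_, ⟨c, hc⟩, ?_, ?_⟩ <;> rwa [reach_toDigraph hS]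
  have h := congrFun (updateReach_weightedReach (fun v : Fin X.n => al v) hac') ⟨v, hv⟩
  rw [← toDigraph_cons he, weightedReach_toDigraph hS', updateReach,
    weightedReach_toDigraph hS] at h
  simp only [mem_coreachSet, reach_toDigraph hS] at h
  refine h.symm.trans ?_
  have hg : gain (X.toDigraph S) (fun v => al v) t (mark (X.toDigraph S) s t ⟨v, hv⟩) =
      ∑ x ∈ Finset.range X.n with
        X.Reach S (X.dst e) x ∧ ¬ ∃ b ∈ B, X.Reach S v b ∧ X.Reach S b x, al x := by
    rw [gain, Finset.sum_filter, Finset.sum_range, ← Finset.sum_filter]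
    refine Finset.sum_congr ?_ fun _ _ => rfl
    ext x
    simp only [Finset.mem_sdiff, mem_reachSet, Finset.mem_biUnion, mark, Finset.mem_filter, hbd,
      Finset.mem_univ, true_and, reach_toDigraph hS]
    refine and_congr_right fun _ => not_congr ⟨?_, ?_⟩
    · rintro ⟨b, ⟨h1, h2⟩, h3⟩
      exact ⟨b, h1, h2, h3⟩
    · rintro ⟨b, h1, h2, h3⟩
      exact ⟨⟨b, ((hB b).1 h1).1⟩, ⟨h1, h2⟩, h3⟩
  rw [hg]

open Classical in
/-- The weighted reachability numbers of a polyforest solve the recursion of Algorithm 1. -/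
theorem reachWeight_eq_add_sum {S : List ℕ} (hS : ∀ e ∈ S, e < X.m) (hnd : S.Nodup)
    (hac : ∀ v, ¬ TransGen (X.Adj S) v v) (hsp : Sparse 0 S.toFinset X.src X.dst) (al : ℕ → ℝ)
    {v : ℕ} (hv : v < X.n) : X.reachWeight S al v =
      al v + ((S.filter (X.src · = v)).map fun e => X.reachWeight S al (X.dst e)).sum := by
  have hinj : ∀ e ∈ S, ∀ e' ∈ S, X.src e = X.src e' → ∀ x, X.Reach S (X.dst e) x →
      X.Reach S (X.dst e') x → e = e' := fun e he e' he' h x hx hx' =>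
    hsp.eq_of_reach hac (by simpa using he) (by simpa using he') h hx hx'
  let N : Finset (Fin X.n) := {w | X.Adj S v w}
  rw [← weightedReach_toDigraph hS al ⟨v, hv⟩, weightedReach_eq_add_sum _
    (isAcyclic_toDigraph hac) ?_ _ N (by simp [N, toDigraph])]
  · congr 1
    rw [← List.sum_toFinset _ (hnd.filter _)]
    symm
    have hmem : ∀ e, e ∈ (S.filter (X.src · = v)).toFinset ↔ e ∈ S ∧ X.src e = v := by simp
    refine Finset.sum_bij (fun e he => ⟨X.dst e, X.dst_lt e (hS e ((hmem e).1 he).1)⟩) ?_ ?_ ?_ ?_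
    · intro e he
      rw [hmem] at he
      exact Finset.mem_filter.2 ⟨Finset.mem_univ _, adj_iff.2 ⟨e, he.1, he.2, rfl⟩⟩
    · intro e he e' he' h
      rw [hmem] at he he'
      have h' : X.dst e = X.dst e' := congrArg Fin.val h
      exact hinj e he.1 e' he'.1 (he.2.trans he'.2.symm) _ .refl (h' ▸ .refl)
    · intro w hw
      obtain ⟨e, he, h1, h2⟩ := adj_iff.1 (Finset.mem_filter.1 hw).2
      exact ⟨e, (hmem e).2 ⟨he, h1⟩, Fin.ext h2⟩
    · intro e he
      rw [weightedReach_toDigraph hS]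
  · intro u w w' x h1 h2 h3 h4
    rw [reach_toDigraph hS] at h3 h4
    obtain ⟨e, he, h5, h6⟩ := adj_iff.1 h1
    obtain ⟨e', he', h5', h6'⟩ := adj_iff.1 h2
    have := hinj e he e' he' (h5.trans h5'.symm) x (h6 ▸ h3) (h6' ▸ h4)
    subst this
    exact Fin.ext (h6.symm.trans h6')

end Input

end DescendantCounting

namespace DescendantCounting

open Relation

namespace Input

variable {X : Input}

open Classical in
/-- In a digraph of which every nonempty vertex set `V` spans at most `|V| - 1 + k` edges, there are
at most `k + 1` boundaries and `k + 2` sets of marks, so that a round takes time `O(k² n + k m)`. -/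
theorem Rep.wp_round {L F k i e : ℕ} {S : List ℕ} {f : Words} {g : Weights} {al : ℕ → ℝ}
    {Q : ℕ → Words → Weights → Prop} (hR : X.Rep f S) (hL : X.n ≤ L ∧ X.m ≤ L)
    (hnF : X.n * F ≤ L) (hi : f (.i, 0, 0) = i) (hiL : i ≤ L) (he : f (.rev, i, 0) = e)
    (hem : e < X.m) (heS : e ∉ S) (hac : ∀ v, ¬ TransGen (X.Adj (e :: S)) v v)
    (hsp : Sparse k S.toFinset X.src X.dst) (hk : k + 1 ≤ F)
    (hal : ∀ v, g (.a, v, 0) = al v) (hr : ∀ v < X.n, g (.r, v, 0) = X.reachWeight S al v)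
    (post : ∀ t f' g', Frame round f g f' g' → t ≤ 500 * (F ^ 2 * X.n + F * X.m) →
      X.Rep f' (e :: S) → (∀ v < X.n, g' (.r, v, 0) = X.reachWeight (e :: S) al v) → Q t f' g') :
    WP (allowed L F X.n) round f g Q := by
  suffices H : WP (allowed L F X.n) round f g fun t f' g' =>
      t ≤ 500 * (F ^ 2 * X.n + F * X.m) ∧ X.Rep f' (e :: S) ∧
        ∀ v < X.n, g' (.r, v, 0) = X.reachWeight (e :: S) al v by
    exact H.frame.mono fun t f' g' ⟨h1, h2, h3, h4⟩ => post t f' g' h1 h2 h3 h4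
  set s := X.src e with hs
  set t := X.dst e with ht
  have hsn : s < X.n := X.src_lt e hem
  have htn : t < X.n := X.dst_lt e hem
  have hacS : ∀ v, ¬ TransGen (X.Adj S) v v := fun v h => hac v (TransGen.mono
    (fun u w huw => by
      obtain ⟨e', he', h⟩ := adj_iff.1 huw
      exact adj_iff.2 ⟨e', List.mem_cons_of_mem _ he', h⟩) _ _ h)
  have hts : ¬ X.Reach S t s := fun h => by
    refine hac s (TransGen.head' (adj_iff.2 ⟨e, List.mem_cons_self, rfl, rfl⟩) ?_)
    refine ReflTransGen.mono (fun u w huw => ?_) _ _ h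
    obtain ⟨e', he', h⟩ := adj_iff.1 huw
    exact adj_iff.2 ⟨e', List.mem_cons_of_mem _ he', h⟩
  have hSm : S.length ≤ X.m := length_le_of_nodup hR.nodup hR.lt
  -- the edge and its ends
  rw [round, wp_block_cons, wp_setW]
  refine ⟨by simp [hi, hiL], ?_⟩
  simp only [Ref.addr, WExpr.eval, hi, he]
  rw [wp_block_cons, wp_setW]
  refine ⟨by simp; omega, ?_⟩
  rw [wp_block_cons, wp_setW]
  refine ⟨by simp; omega, ?_⟩
  simp only [Ref.addr, WExpr.eval, Function.update_self, ne_eq, Prod.mk.injEq, reduceCtorEq,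
    false_and, not_false_eq_true, Function.update_of_ne, hR.src, hR.dst]
  set f1 := Function.update (Function.update (Function.update f (.e, 0, 0) e) (.s, 0, 0) (X.src e))
    (.t, 0, 0) (X.dst e) with hf1
  have hR1 : X.Rep f1 S := hR.congr (by simp [f1, graphNames])
  have he1 : f1 (.e, 0, 0) = e := by simp [f1]
  have hs1 : f1 (.s, 0, 0) = s := by simp [f1, hs]
  have ht1 : f1 (.t, 0, 0) = t := by simp [f1, ht]
  -- the vertices that reach `s`
  refine (hR1.wp_search (x := .s) (x₀ := s) (Q := fun t f' g' =>
    t ≤ 10 * S.length + 11 * X.n + 16 ∧ ∀ v < X.n, f' (.vis, v, 0) = 1 ↔ X.Reach S v s)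
    isDir_bwd hL hs1 hsn (by decide) fun t f' g' _ h1 h2 => ⟨h1, fun v hv =>
      (h2 v hv).1.trans reach_bwd⟩).cons ?_
  rintro τ2 f2 g2 hf2 ⟨hτ2, hvis2⟩
  have hR2 := hR1.frame hf2 (by decide)
  refine (wp_copy (x := .setU) (y := .vis) (Q := fun t f' g' => t ≤ 4 * X.n + 3 ∧
    ∀ v < X.n, f' (.setU, v, 0) = f2 (.vis, v, 0)) hR2.n hL.1 (by decide) (by decide) (by decide)
    fun t f' g' _ h1 h2 => ⟨h1, h2⟩).cons ?_
  rintro τ3 f3 g3 hf3 ⟨hτ3, hU3⟩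
  have hR3 := hR2.frame hf3 (by decide)
  have hU3 : ∀ v < X.n, f3 (.setU, v, 0) = 1 ↔ X.Reach S v s := fun v hv => by
    rw [hU3 v hv, hvis2 v hv]
  have ht3 : f3 (.t, 0, 0) = t := by
    rw [hf3.word _ (by decide), hf2.word _ (by decide), ht1]
  -- the vertices that are reachable from `t`
  refine (hR3.wp_search (x := .t) (x₀ := t) (Q := fun τ f' g' =>
    τ ≤ 10 * S.length + 11 * X.n + 16 ∧ ∀ v < X.n, f' (.vis, v, 0) = 1 ↔ X.Reach S t v)
    isDir_fwd hL ht3 htn (by decide) fun t f' g' _ h1 h2 => ⟨h1, fun v hv => (h2 v hv).1⟩).cons ?_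
  rintro τ4 f4 g4 hf4 ⟨hτ4, hvis4⟩
  have hR4 := hR3.frame hf4 (by decide)
  refine (wp_copy (x := .setD) (y := .vis) (Q := fun t f' g' => t ≤ 4 * X.n + 3 ∧
    ∀ v < X.n, f' (.setD, v, 0) = f4 (.vis, v, 0)) hR4.n hL.1 (by decide) (by decide) (by decide)
    fun t f' g' _ h1 h2 => ⟨h1, h2⟩).cons ?_
  rintro τ5 f5 g5 hf5 ⟨hτ5, hD5⟩
  have hR5 := hR4.frame hf5 (by decide)
  have hD5 : ∀ v < X.n, f5 (.setD, v, 0) = 1 ↔ X.Reach S t v := fun v hv => by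
    rw [hD5 v hv, hvis4 v hv]
  have hU5 : ∀ v < X.n, f5 (.setU, v, 0) = 1 ↔ X.Reach S v s := fun v hv => by
    rw [hf5.word _ (by decide), hf4.word _ (by decide), hU3 v hv]
  -- the boundaries
  refine (hR5.wp_boundary (U := fun v => X.Reach S v s) (D := fun v => X.Reach S t v)
    (Q := fun τ f' g' => τ ≤ 11 * S.length + 20 * X.n + 20 ∧ ∃ B,
      IsBoundaryList X S (fun v => X.Reach S v s) (fun v => X.Reach S t v) f' B) hL hU5 hD5
    (fun v hv => hv.lt_right hR.lt htn) (fun v h1 h2 => hts (h1.trans h2))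
    (fun v w h1 h2 => .head h1 h2) fun τ f' g' B _ h1 h2 => ⟨h1, B, h2⟩).cons ?_
  rintro τ6 f6 g6 hf6 ⟨hτ6, B, hB⟩
  have hR6 := hR5.frame hf6 (by decide)
  let U : Finset ℕ := {v ∈ Finset.range X.n | X.Reach S v s}
  let D : Finset ℕ := {v ∈ Finset.range X.n | X.Reach S t v}
  have hU : ∀ v, v ∈ U ↔ X.Reach S v s := fun v => by
    simp only [U, Finset.mem_filter, Finset.mem_range, and_iff_right_iff_imp]
    exact fun h => h.lt_left hR.lt hsn
  have hD : ∀ v, v ∈ D ↔ X.Reach S t v := fun v => by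
    simp only [D, Finset.mem_filter, Finset.mem_range, and_iff_right_iff_imp]
    exact fun h => h.lt_right hR.lt htn
  have hBU : B.toFinset ⊆ U := fun b hb => (hU b).2 ((hB.mem b).1 (List.mem_toFinset.1 hb)).2.1
  have hcount := card_boundary_add_branching_le (B := B.toFinset) hsp hacS hts hU hD fun b hb => by
    obtain ⟨h1, h2, w, h3, h4, c, h5, h6⟩ := (hB.mem b).1 (List.mem_toFinset.1 hb)
    exact ⟨(hU b).2 h2, w, fun h => h3 ((hU w).1 h), h4, c, (hD c).2 h5, h6⟩
  rw [List.toFinset_card_of_nodup hB.nodup] at hcount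
  -- the marks
  refine (hR6.wp_marks (F := F) (Q := fun τ f' g' =>
    τ ≤ B.length * (20 * S.length + 30 * X.n + 43) + 3 ∧ IsMarks X S B f') hL hB (by omega)
    fun τ f' g' _ h1 h2 => ⟨h1, h2⟩).cons ?_
  rintro τ7 f7 g7 hf7 ⟨hτ7, hM⟩
  have hR7 := hR6.frame hf7 (by decide)
  have hU7 : ∀ v < X.n, f7 (.setU, v, 0) = 1 ↔ X.Reach S v s := fun v hv => by
    rw [hf7.word _ (by decide), hf6.word _ (by decide), hU5 v hv]
  have hD7 : ∀ v < X.n, f7 (.setD, v, 0) = 1 ↔ X.Reach S t v := fun v hv => by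
    rw [hf7.word _ (by decide), hf6.word _ (by decide), hD5 v hv]
  have hg7 : ∀ y i j, y ≠ .gval → g7 (y, i, j) = g (y, i, j) := fun y i j _ => by
    rw [hf7.weight _ (by cases y <;> decide), hf6.weight _ (by cases y <;> decide),
      hf5.weight _ (by cases y <;> decide), hf4.weight _ (by cases y <;> decide),
      hf3.weight _ (by cases y <;> decide), hf2.weight _ (by cases y <;> decide)]
  -- the gains
  let Y : GainData :=
    { n := X.n, k := B.length, mark := fun j v => f7 (.markOf, j, v)
      desc := fun j v => f7 (.reachOf, j, v), su := fun v => f7 (.setU, v, 0)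
      sd := fun v => f7 (.setD, v, 0), al := al
      mark_lt := fun j hj v hv => by have := (hM.mark j hj v hv).2; omega }
  have hY : Y.Holds f7 g7 := ⟨hR7.n, (hf7.word _ (by decide) _ _).trans hB.nB, fun _ _ => rfl,
    fun _ _ => rfl, fun _ => rfl, fun _ => rfl, fun v => (hg7 _ _ _ (by decide)).trans (hal v)⟩
  have hmarks : (({v ∈ Finset.range X.n | f7 (.setU, v, 0) = 1}).image Y.key).card ≤ F + 1 := by
    have h1 : ({v ∈ Finset.range X.n | f7 (.setU, v, 0) = 1} : Finset ℕ) = U := by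
      ext v
      simp only [U, Finset.mem_filter, Finset.mem_range]
      exact and_congr_right fun hv => hU7 v hv
    have h2 := card_image_marks_le (S := S.toFinset) (src := X.src) (dst := X.dst) Y.key hU hBU
      fun u hu v hv huv => by
        refine List.map_congr_left fun j hj => ?_
        have hj : j < B.length := List.mem_range.1 hj
        have hun : u < X.n := Finset.mem_range.1 (Finset.mem_filter.1 hu).1
        have hvn : v < X.n := Finset.mem_range.1 (Finset.mem_filter.1 hv).1
        have h3 := hM.mark j hj u hun
        have h4 := hM.mark j hj v hvn
        have h5 := huv B[j] (List.mem_toFinset.2 (List.getElem_mem hj))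
        have h6 : f7 (.markOf, j, u) = 1 ↔ f7 (.markOf, j, v) = 1 := by
          rw [h3.1, h4.1]; exact h5
        change f7 (.markOf, j, u) = f7 (.markOf, j, v)
        omega
    rw [List.toFinset_card_of_nodup hB.nodup] at h2
    rw [h1]
    refine le_trans (le_of_eq ?_) (h2.trans (by omega))
    congr!
  have hvalue : ∀ v < X.n, Y.value (Y.key v) = ∑ x ∈ Finset.range X.n with
      X.Reach S t x ∧ ¬ ∃ b ∈ B, X.Reach S v b ∧ X.Reach S b x, al x := by
    intro v hv
    rw [GainData.value]
    refine Finset.sum_congr (Finset.filter_congr fun x hx => ?_) fun _ _ => rfl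
    have hx : x < X.n := Finset.mem_range.1 hx
    refine and_congr (hD7 x hx) (not_congr ⟨?_, ?_⟩)
    · rintro ⟨j, hj, h1, h2⟩
      rw [GainData.getD_key hj] at h1
      exact ⟨B[j]'hj, List.getElem_mem _, (hM.mark j hj v hv).1.1 h1, (hM.reach j hj x hx).1 h2⟩
    · rintro ⟨b, hb, h1, h2⟩
      obtain ⟨j, hj, rfl⟩ := List.getElem_of_mem hb
      refine ⟨j, hj, ?_, (hM.reach j hj x hx).2 h2⟩
      rw [GainData.getD_key hj]
      exact (hM.mark j hj v hv).1.2 h1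
  refine WP.cons (Q' := fun τ f' g' => τ ≤ X.n * (14 * F + 20) + (F + 1) * (X.n * (6 * F + 13) + 10)
    + 20 ∧ ∀ v < X.n, f7 (.setU, v, 0) = 1 → f' (.leaf, v, 0) ≤ L ∧
      g' (.gval, f' (.leaf, v, 0), 0) = Y.value (Y.key v))
    (hY.wp_gains hL.1 (F := F) (by change B.length ≤ F; omega) (le_trans (Nat.mul_le_mul le_rfl
      (by change B.length ≤ F; omega)) hnF) fun τ f' g' _ h1 h2 => ⟨h1.trans ?_, h2⟩) ?_
  · have hk' : Y.k ≤ F := by change B.length ≤ F; omega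
    change X.n * (14 * Y.k + 20) + _ * (X.n * (6 * Y.k + 13) + 10) + 20 ≤ _
    gcongr
  rintro τ8 f8 g8 hf8 ⟨hτ8, hG8⟩
  have hR8 := hR7.frame hf8 (by decide)
  have hU8 : ∀ v, f8 (.setU, v, 0) = f7 (.setU, v, 0) := fun v => hf8.word _ (by decide) _ _
  have he8 : f8 (.e, 0, 0) = e := by
    rw [hf8.word _ (by decide), hf7.word _ (by decide), hf6.word _ (by decide),
      hf5.word _ (by decide), hf4.word _ (by decide), hf3.word _ (by decide),
      hf2.word _ (by decide), he1]
  have hr8 : ∀ v < X.n, g8 (.r, v, 0) = X.reachWeight S al v := fun v hv => by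
    rw [hf8.weight _ (by decide), hg7 _ _ _ (by decide), hr v hv]
  -- the update
  refine WP.cons (Q' := fun τ f' g' => τ ≤ X.n * (4 + 3) + 3 ∧
    ∀ v < X.n, g' (.r, v, 0) = X.reachWeight (e :: S) al v) ?_ ?_
  · refine wp_forUp_const (k := X.n) 4 (fun j _ g' => ∀ v < X.n, g' (.r, v, 0) =
      if v < j then X.reachWeight (e :: S) al v else X.reachWeight S al v) (by decide) (by decide)
      hR8.n (by simpa using hr8) (fun _ _ _ _ h => h) ?_ ?_
    · intro j hj f' g' hfr hv hI
      have hset : f' (.setU, j, 0) = f7 (.setU, j, 0) := (hfr.word _ (by decide) _ _).trans (hU8 j)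
      have hrec := reachWeight_cons hR.lt hem hac hB.mem al hj
      rw [wp_ite]
      refine ⟨by simp [hv]; omega, ?_⟩
      by_cases hc : f7 (.setU, j, 0) = 1
      · obtain ⟨hleaf, hgv⟩ := hG8 j hj hc
        have hleaf' : f' (.leaf, j, 0) = f8 (.leaf, j, 0) := hfr.word _ (by decide) _ _
        have hgv' : g' (.gval, f8 (.leaf, j, 0), 0) = Y.value (Y.key j) :=
          (hfr.weight _ (by decide) _ _).trans hgv
        rw [if_pos (by simp [hv, hset, hc])]
        simp only [wp_block_cons, wp_block_nil, wp_setW, wp_setA]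
        refine ⟨by simp [hv]; omega, by simp [hv, hleaf', hleaf]; omega, by omega, fun v hvn => ?_⟩
        simp only [Ref.addr, WExpr.eval, AExpr.eval, hv, hleaf', Function.update_self, ne_eq,
          Prod.mk.injEq, reduceCtorEq, false_and, not_false_eq_true, Function.update_of_ne, hgv',
          hI j hj, lt_irrefl, if_false]
        by_cases hvj : v = j
        · subst hvj
          rw [Function.update_self, if_pos (by omega), hrec, if_pos ((hU7 v hj).1 hc), hvalue v hj]
        · rw [Function.update_of_ne (by simp [hvj]), hI v hvn]
          simp only [show v < j + 1 ↔ v < j by omega]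
      · rw [if_neg (by simp [hv, hset, hc]), wp_skip]
        refine ⟨by omega, fun v hvn => ?_⟩
        rw [hI v hvn]
        by_cases hvj : v = j
        · subst hvj
          rw [if_neg (by omega), if_pos (by omega), hrec, if_neg (fun h => hc ((hU7 v hj).2 h))]
        · simp only [show v < j + 1 ↔ v < j by omega]
    · intro τ f' g' _ hτ hI
      exact ⟨hτ, fun v hv => by rw [hI v hv, if_pos hv]⟩
  rintro τ9 f9 g9 hf9 ⟨hτ9, hr9⟩
  have hR9 := hR8.frame hf9 (by decide)
  rw [wp_block_cons]
  refine hR9.wp_insertEdge hL ((hf9.word _ (by decide) _ _).trans he8) hem heS fun f' _ hR' => ?_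
  rw [wp_block_nil]
  refine ⟨?_, hR', hr9⟩
  have hτ7' : τ7 ≤ F * (20 * X.m + 30 * X.n + 43) + 3 := by
    refine hτ7.trans ?_
    have : B.length ≤ F := by omega
    gcongr
  -- the edge `e` exists, so that `F`, `n` and `m` are positive and absorb the lower order terms
  have hF : 1 ≤ F := by omega
  have hn : 1 ≤ X.n := by omega
  have hm : 1 ≤ X.m := by omega
  have e1 : F * X.n ≤ F ^ 2 * X.n := by
    rw [pow_two, mul_assoc]; exact Nat.le_mul_of_pos_left _ hF
  have e2 : X.n ≤ F * X.n := Nat.le_mul_of_pos_left _ hF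
  have e3 : F ≤ F * X.n := Nat.le_mul_of_pos_right _ hn
  have e4 : X.m ≤ F * X.m := Nat.le_mul_of_pos_left _ hF
  have h8 : X.n * (14 * F + 20) + (F + 1) * (X.n * (6 * F + 13) + 10) + 20 =
      6 * (F ^ 2 * X.n) + 33 * (F * X.n) + 33 * X.n + 10 * F + 30 := by ring
  have h7 : F * (20 * X.m + 30 * X.n + 43) = 20 * (F * X.m) + 30 * (F * X.n) + 43 * F := by ring
  rw [h8] at hτ8
  rw [h7] at hτ7'
  omega

end Input

end DescendantCounting

namespace DescendantCounting

open Relation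

/-! ### Algorithm 2 -/

/-- Sparsity is inherited by digraphs that are embedded in a sparse digraph. -/
theorem Sparse.of_embedding {V E V' E' : Type*} {k : ℕ} {S : Finset E} {src dst : E → V}
    {S' : Finset E'} {src' dst' : E' → V'} (h : Sparse k S' src' dst') {ι : V' → V}
    (hι : ι.Injective) (hmem : ∀ e ∈ S, ∃ e' ∈ S', ι (src' e') = src e ∧ ι (dst' e') = dst e)
    (hinj : ∀ e₁ ∈ S, ∀ e₂ ∈ S, src e₁ = src e₂ → dst e₁ = dst e₂ → e₁ = e₂) :
    Sparse k S src dst := by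
  classical
  intro Y hY
  let Y' := Y.preimage ι hι.injOn
  have hcard : (edgesWithin S src dst Y).card ≤ (edgesWithin S' src' dst' Y').card := by
    refine Finset.card_le_card_of_forall_subsingleton
      (fun e e' => ι (src' e') = src e ∧ ι (dst' e') = dst e) ?_ ?_
    · intro e he
      obtain ⟨he, h1, h2⟩ := Finset.mem_filter.1 he
      obtain ⟨e', he', h3, h4⟩ := hmem e he
      exact ⟨e', Finset.mem_filter.2 ⟨he', Finset.mem_preimage.2 (h3 ▸ h1),
        Finset.mem_preimage.2 (h4 ▸ h2)⟩, h3, h4⟩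
    · rintro e' - e₁ ⟨he₁, h1, h2⟩ e₂ ⟨he₂, h3, h4⟩
      exact hinj e₁ (Finset.mem_filter.1 he₁).1 e₂ (Finset.mem_filter.1 he₂).1 (h1.symm.trans h3)
        (h2.symm.trans h4)
  have hY' : Y'.card ≤ Y.card :=
    Finset.card_le_card_of_injOn ι (fun v hv => Finset.mem_preimage.1 hv) hι.injOn
  rcases Y'.eq_empty_or_nonempty with h0 | hne
  · have : edgesWithin S' src' dst' Y' = ∅ := by
      rw [h0, edgesWithin, Finset.filter_eq_empty_iff]
      simp
    rw [this, Finset.card_empty] at hcard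
    have := hY.card_pos
    omega
  · have := h Y' hne
    omega

namespace Input

variable {X : Input}

theorem adj_congr {S S' : List ℕ} (h : ∀ e, e ∈ S ↔ e ∈ S') : X.Adj S = X.Adj S' := by
  have : S.toFinset = S'.toFinset := by ext e; simpa using h e
  rw [Adj, this, Adj]

theorem reachWeight_congr {S S' : List ℕ} (h : ∀ e, e ∈ S ↔ e ∈ S') :
    X.reachWeight S = X.reachWeight S' := by
  have : X.Reach S = X.Reach S' := by rw [Reach, adj_congr h, Reach]
  funext al v
  rw [reachWeight, this, reachWeight]

theorem not_transGen_of_subset {S S' : List ℕ} (hac : ∀ v, ¬ TransGen (X.Adj S') v v)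
    (h : S ⊆ S') (v : ℕ) : ¬ TransGen (X.Adj S) v v := fun hv => by
  refine hac v (TransGen.mono (fun u w huw => ?_) _ _ hv)
  obtain ⟨e, he, h'⟩ := adj_iff.1 huw
  exact adj_iff.2 ⟨e, h he, h'⟩

theorem not_transGen_of_isAcyclic {S : List ℕ} (hS : ∀ e ∈ S, e < X.m)
    (hac : IsAcyclic (X.toDigraph S)) (v : ℕ) : ¬ TransGen (X.Adj S) v v := fun hv => by
  obtain ⟨w, hvw, hwv⟩ := TransGen.head'_iff.1 hv
  obtain ⟨e, he, h1, h2⟩ := adj_iff.1 hvw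
  have hvn : v < X.n := h1 ▸ X.src_lt e (hS e he)
  have hwn : w < X.n := h2 ▸ X.dst_lt e (hS e he)
  have hadj : (X.toDigraph S).Adj ⟨v, hvn⟩ ⟨w, hwn⟩ := hvw
  refine hac ⟨v, hvn⟩ (TransGen.head' hadj ?_)
  rwa [reach_toDigraph hS]

/-- Every round obeys the time bound for `F`, since its digraph is obtained from a polyforest by the
insertion of fewer than `F` edges. -/
theorem IsSplit.wp_rounds {L F : ℕ} {T R : List ℕ} {f : Words} {g : Weights} {al : ℕ → ℝ}
    {Q : ℕ → Words → Weights → Prop} (h : IsSplit X T R f) (hL : X.n ≤ L ∧ X.m ≤ L)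
    (hnF : X.n * F ≤ L) (hRF : R.length ≤ F) (hac : ∀ v, ¬ TransGen (X.Adj (List.range X.m)) v v)
    (hal : ∀ v, g (.a, v, 0) = al v) (hr : ∀ v < X.n, g (.r, v, 0) = X.reachWeight T al v)
    (post : ∀ t f' g', t ≤ R.length * (500 * (F ^ 2 * X.n + F * X.m) + 3) + 3 →
      (∀ v < X.n, g' (.r, v, 0) = X.reachWeight (List.range X.m) al v) → Q t f' g') :
    WP (allowed L F X.n) (forUp .i (val .nRev) round) f g Q := by
  have hRm : R.length ≤ X.m := by have := h.length; omega
  refine wp_forUp_const (k := R.length) (500 * (F ^ 2 * X.n + F * X.m))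
    (fun j f' g' => X.Rep f' ((R.take j).reverse ++ T) ∧
      ∀ v < X.n, g' (.r, v, 0) = X.reachWeight ((R.take j).reverse ++ T) al v)
    (by decide) (by decide) h.nRev ⟨by simpa using h.rep, by simpa using hr⟩ ?_ ?_ ?_
  · rintro j f' g' v ⟨h1, h2⟩
    exact ⟨h1.congr (by simp [graphNames]), h2⟩
  · rintro j hj f' g' hfr hi ⟨hR, hr'⟩
    have htake : (R.take (j + 1)).reverse ++ T = R[j] :: ((R.take j).reverse ++ T) := by
      rw [List.take_succ_eq_append_getElem hj, List.reverse_append]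
      rfl
    have hjR : R[j] ∈ R := List.getElem_mem hj
    have hjm : R[j] < X.m := (h.mem _).2 (Or.inr hjR)
    have hnot : R[j] ∉ (R.take j).reverse ++ T := by
      simp only [List.mem_append, List.mem_reverse, not_or]
      refine ⟨fun hmem => ?_, h.disj _ hjR⟩
      have h2 := h.nodup
      rw [← List.take_append_drop j R, List.nodup_append] at h2
      refine h2.2.2 _ hmem _ ?_ rfl
      rw [List.drop_eq_getElem_cons hj]
      exact List.mem_cons_self
    have hac' : ∀ v, ¬ TransGen (X.Adj (R[j] :: ((R.take j).reverse ++ T))) v v := by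
      refine not_transGen_of_subset hac fun e he => List.mem_range.2 ?_
      rcases List.mem_cons.1 he with rfl | he
      · exact hjm
      · exact hR.lt e he
    -- every inserted edge increases the parameter by at most one
    have hsp : ∀ i, Sparse i ((R.take i).reverse ++ T).toFinset X.src X.dst := by
      intro i
      induction i with
      | zero => simpa using h.sparse
      | succ i ih =>
        by_cases hi : i < R.length
        · rw [List.take_succ_eq_append_getElem hi, List.reverse_append, List.reverse_singleton,
            List.singleton_append, List.cons_append, List.toFinset_cons]
          convert ih.insert _
        · rw [List.take_of_length_le (by omega)] at ih ⊢
          intro Y hY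
          exact (ih Y hY).trans (by omega)
    refine hR.wp_round (i := j) (e := R[j]) (k := j) hL hnF hi (by omega)
      ((hfr.word _ (by decide) _ _).trans (arr_getElem h.rev hj)) hjm hnot hac' (hsp j) (by omega)
      (fun v => (hfr.weight _ (by decide) _ _).trans (hal v)) hr' ?_
    intro t f'' g'' _ ht hR'' hr''
    rw [htake]
    exact ⟨ht, hR'', hr''⟩
  · rintro t f' g' - ht ⟨-, hr'⟩
    refine post t f' g' ht fun v hv => ?_
    rw [hr' v hv, List.take_length]
    refine congrFun (congrFun (reachWeight_congr fun e => ?_) _) _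
    rw [List.mem_append, List.mem_reverse, List.mem_range, h.mem, or_comm]

/-- Correctness and running time of Algorithm 2, when the deletion of at most `F` edges leaves a
polyforest. -/
theorem Base.wp_algorithm2 {L F : ℕ} {f : Words} {g : Weights} (hB : X.Base f)
    (hL : X.n ≤ L ∧ X.m ≤ L) (hnF : X.n * F ≤ L)
    (hac : ∀ v, ¬ TransGen (X.Adj (List.range X.m)) v v) {T' : Finset ℕ}
    (hT' : ∀ e ∈ T', e < X.m) (hsp : Sparse 0 T' X.src X.dst) (hF : X.m ≤ T'.card + F) :
    WP (allowed L F X.n) algorithm2 f g fun t _ g' =>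
      t ≤ 500 * (F ^ 3 * X.n + F ^ 2 * X.m) + 100 * (X.n + X.m + 1) ∧
      ∀ v < X.n, g' (.r, v, 0) = X.reachWeight (List.range X.m) (fun v => g (.a, v, 0)) v := by
  refine (hB.wp_spanningPolyforest (Q := fun t f' _ => t ≤ 60 * (X.n + X.m + 1) ∧
    ∃ T R, IsSplit X T R f') hL fun t f' g' T R _ h1 h2 => ⟨h1, T, R, h2⟩).cons ?_
  rintro t1 f1 g1 hf1 ⟨ht1, T, R, h1⟩
  have hTm : ∀ e ∈ T, e < X.m := h1.rep.lt
  have hacT := not_transGen_of_subset hac fun e he => List.mem_range.2 (hTm e he)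
  -- as `T` is maximal, at most `F` edges are deleted
  have hmax := h1.max T' hT' hsp
  have hlen := h1.length
  have hal : ∀ v, g1 (.a, v, 0) = g (.a, v, 0) := fun v => hf1.weight _ (by decide) _ _
  refine (h1.rep.wp_algorithm1 (wt := X.reachWeight T fun v => g (.a, v, 0)) (Q := fun t f' g' =>
    t ≤ 15 * T.length + 30 * X.n + 30 ∧ ∀ v < X.n, g' (.r, v, 0) =
      X.reachWeight T (fun v => g (.a, v, 0)) v) hL hacT (fun v hv => ?_)
    fun t f' g' _ h1 h2 => ⟨h1, h2⟩).cons ?_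
  · rw [hal]
    exact reachWeight_eq_add_sum hTm h1.rep.nodup hacT h1.sparse _ hv
  rintro t2 f2 g2 hf2 ⟨ht2, hr2⟩
  have h2 : IsSplit X T R f2 := ⟨h1.rep.frame hf2 (by decide),
    (hf2.word _ (by decide) _ _).trans h1.nRev,
    (arr_congr fun _ _ => hf2.word _ (by decide) _ _).trans h1.rev, h1.nodup, h1.mem, h1.disj,
    h1.length, h1.sparse, h1.max⟩
  rw [wp_block_cons]
  refine h2.wp_rounds hL hnF (by omega) hac
    (fun v => (hf2.weight _ (by decide) _ _).trans (hal v)) hr2 fun t f' g' ht hr => ?_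
  rw [wp_block_nil]
  refine ⟨?_, hr⟩
  have e1 : R.length * (500 * (F ^ 2 * X.n + F * X.m)) ≤ F * (500 * (F ^ 2 * X.n + F * X.m)) :=
    Nat.mul_le_mul (by omega) le_rfl
  have e2 : F * (500 * (F ^ 2 * X.n + F * X.m)) = 500 * (F ^ 3 * X.n + F ^ 2 * X.m) := by ring
  have e3 : R.length * (500 * (F ^ 2 * X.n + F * X.m) + 3) =
    R.length * (500 * (F ^ 2 * X.n + F * X.m)) + R.length * 3 := by ring
  omega

end Input

/-- The implementation returns the weighted reachability numbers, within the bounds on time and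
space. -/
theorem exec_algorithm2 {n f : ℕ} {G : Digraph (Fin n)} {a : Fin n → ℝ}
    {edges : List (Fin n × Fin n)} {σ : State ℝ} (hG : IsAcyclic G) (hnd : edges.Nodup)
    (hedges : ∀ u v, (u, v) ∈ edges ↔ G.Adj u v) (hf : f = feedbackEdgeNumber G)
    (hσ : IsInitial σ n edges a) :
    (∀ v : Fin n, (algorithm2.exec σ).weight (.r, (v : ℕ), 0) = weightedReach G a v) ∧
    (algorithm2.exec σ).time ≤
      1000 * (f ^ 3 * n + f ^ 2 * edges.length + n + edges.length + 1) ∧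
    (algorithm2.exec σ).used.card ≤ 1000 * (f * n + n + edges.length + 1) := by
  classical
  let X : Input :=
    { n := n, m := edges.length, src := fun e => σ.word (.src, e, 0)
      dst := fun e => σ.word (.dst, e, 0)
      src_lt := fun e he => by rw [hσ.source e he]; exact Fin.is_lt _
      dst_lt := fun e he => by rw [hσ.target e he]; exact Fin.is_lt _ }
  have hB : X.Base σ.word := ⟨hσ.numVertices, hσ.numEdges, fun _ => rfl, fun _ => rfl⟩
  have hsrc : ∀ e (he : e < edges.length), X.src e = (edges[e].1 : ℕ) := hσ.source
  have hdst : ∀ e (he : e < edges.length), X.dst e = (edges[e].2 : ℕ) := hσ.target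
  have hinj : ∀ e₁ < edges.length, ∀ e₂ < edges.length, X.src e₁ = X.src e₂ → X.dst e₁ = X.dst e₂ →
      e₁ = e₂ := by
    intro e₁ h₁ e₂ h₂ h h'
    rw [hsrc e₁ h₁, hsrc e₂ h₂] at h
    rw [hdst e₁ h₁, hdst e₂ h₂] at h'
    exact (hnd.getElem_inj_iff).1 (Prod.ext (Fin.ext h) (Fin.ext h'))
  have hlt : ∀ e ∈ List.range X.m, e < X.m := fun e => List.mem_range.1
  have hXG : X.toDigraph (List.range X.m) = G := by
    ext u v
    rw [← hedges, List.mem_iff_getElem]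
    simp only [Input.toDigraph, Input.adj_iff, List.mem_range]
    constructor
    · rintro ⟨e, he, h1, h2⟩
      rw [hsrc e he] at h1
      rw [hdst e he] at h2
      exact ⟨e, he, Prod.ext (Fin.ext h1) (Fin.ext h2)⟩
    · rintro ⟨e, he, h⟩
      exact ⟨e, he, by rw [hsrc e he, h], by rw [hdst e he, h]⟩
  have hac := Input.not_transGen_of_isAcyclic hlt (hXG ▸ hG)
  -- the complement of a minimum set of feedback edges
  obtain ⟨F, hF, hpf, hcard⟩ := exists_card_eq_feedbackEdgeNumber G
  let P : ℕ → Prop := fun e => ∃ p ∈ F, (p.1 : ℕ) = X.src e ∧ (p.2 : ℕ) = X.dst e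
  let T' : Finset ℕ := {e ∈ Finset.range X.m | ¬ P e}
  have hT' : ∀ e ∈ T', e < X.m := fun e he => Finset.mem_range.1 (Finset.mem_filter.1 he).1
  have hsp : Sparse 0 T' X.src X.dst := by
    refine (hpf.sparse (hG.mono (deleteEdges_le G F))).of_embedding Fin.val_injective ?_
      fun e₁ h₁ e₂ h₂ => hinj e₁ (hT' e₁ h₁) e₂ (hT' e₂ h₂)
    intro e he
    have hem : e < edges.length := hT' e he
    refine ⟨edges[e], ?_, (hsrc e hem).symm, (hdst e hem).symm⟩
    simp only [Finset.mem_filter, Finset.mem_univ, true_and, deleteEdges, Prod.mk.eta]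
    refine ⟨(hedges _ _).1 (List.getElem_mem hem), fun hmem => ?_⟩
    exact (Finset.mem_filter.1 he).2 ⟨_, hmem, (hsrc e hem).symm, (hdst e hem).symm⟩
  have hmF : X.m ≤ T'.card + f := by
    have h1 : ({e ∈ Finset.range X.m | P e} : Finset ℕ).card ≤ F.card := by
      refine Finset.card_le_card_of_forall_subsingleton
        (fun e p => (p.1 : ℕ) = X.src e ∧ (p.2 : ℕ) = X.dst e)
        (fun e he => (Finset.mem_filter.1 he).2) ?_
      rintro p - e₁ ⟨he₁, h1, h2⟩ e₂ ⟨he₂, h3, h4⟩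
      exact hinj e₁ (Finset.mem_range.1 (Finset.mem_filter.1 he₁).1) e₂
        (Finset.mem_range.1 (Finset.mem_filter.1 he₂).1) (h1.symm.trans h3) (h2.symm.trans h4)
    have h2 : ({e ∈ Finset.range X.m | P e} : Finset ℕ).card + T'.card = X.m := by
      conv_rhs => rw [← Finset.card_range X.m]
      convert Finset.card_filter_add_card_filter_not (s := Finset.range X.m) P
    omega
  -- besides the root, the trie has at most one node for each of `n` vertices and `f` boundaries
  have hw := hB.wp_algorithm2 (g := σ.weight) (L := n * f + n + edges.length) (F := f)
    ⟨by change n ≤ _; omega, by change edges.length ≤ _; omega⟩ (by change n * f ≤ _; omega)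
    hac hT' hsp hmF
  have hσ' : (⟨σ.word, σ.weight, 0, ∅⟩ : State ℝ) = σ := by
    obtain ⟨w, g, t, u⟩ := σ
    have h1 : t = 0 := hσ.time
    have h2 : u = ∅ := hσ.used
    rw [h1, h2]
  obtain ⟨h1, h2, h3⟩ := hw
  rw [hσ'] at h1 h2 h3
  refine ⟨fun v => ?_, ?_, ?_⟩
  · have ha : a = fun v : Fin n => σ.weight (.a, (v : ℕ), 0) := funext fun v => (hσ.weight v).symm
    rw [h3 v v.2, ← hXG, ha]
    exact (Input.weightedReach_toDigraph hlt (fun v => σ.weight (.a, v, 0)) v).symm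
  · change _ ≤ 500 * (f ^ 3 * n + f ^ 2 * edges.length) + 100 * (n + edges.length + 1) at h2
    omega
  · have h4 := (Finset.card_le_card h1).trans (card_allowed_le _ _ _)
    change _ ≤ 50 * (n * f + n + edges.length + 1) + 2 * (f * n) at h4
    rw [mul_comm n f] at h4
    omega

end DescendantCounting

open DescendantCounting in
theorem mainTheorem1 :
    -- every run of the pseudocode, whatever choices it makes, returns `a(R_G(v))` for all `v`,
    -- and there is such a run
    (∀ (V : Type*) [Fintype V] (G : Digraph V) (a : V → ℝ), IsAcyclic G →
      ∀ r : V → ℝ, IsAlgorithm2Result G a r ↔ r = fun v => weightedReach G a v) ∧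
    -- the implementation returns `a(R_G(v))` for all `v`, within the bounds on time and space
    (∃ C : ℕ, ∀ (n m f : ℕ) (G : Digraph (Fin n)) (a : Fin n → ℝ)
      (edges : List (Fin n × Fin n)) (σ : State ℝ),
      IsAcyclic G → edges.Nodup → (∀ u v, (u, v) ∈ edges ↔ G.Adj u v) →
      m = edges.length → f = feedbackEdgeNumber G → IsInitial σ n edges a →
      (∀ v : Fin n, (algorithm2.exec σ).weight (.r, (v : ℕ), 0) = weightedReach G a v) ∧
      (algorithm2.exec σ).time ≤ C * (f ^ 3 * n + f ^ 2 * m + n + m + 1) ∧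
      (algorithm2.exec σ).used.card ≤ C * (f * n + n + m + 1)) := by
  refine ⟨fun V _ G a hG r => isAlgorithm2Result_iff a hG r, 1000, ?_⟩
  rintro n m f G a edges σ hG hnd hedges rfl hf hσ
  exact exec_algorithm2 hG hnd hedges hf hσ
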